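/- **Setting.** Let $n,m\ge 1$. For $t\in\mathbb R$ let $A(t)\in\mathbb R^{n\times n}$, $B(t)\in\mathbb R^{n\times m}$, $Q(t)\in\mathcal S^n_+$, $R(t)\in\mathcal S^m_{++}$ depend continuously on $t$, and let $P\in\mathcal S^n_+$, where $\mathcal S^p_+$ (resp. $\mathcal S^p_{++}$) is the set of symmetric positive semi-definite (resp. positive definite) real $p\times p$ matrices. Let $\Phi(\cdot,\cdot)$ be the state-transition matrix of $\dot x=A(t)x$, i.e. $\partial_t\Phi(t,s)=A(t)\Phi(t,s)$, $\Phi(s,s)=\mathrm{Id}$. For $t\in\mathbb R$, $E\in\mathcal S^n_+$, $h\ge 0$ put $$\mathcal F(t,E,h)=\mathcal M\,\mathcal N^{-1}\mathcal M^\top-\mathcal G,\quad \mathcal M=\mathcal M_1+\mathcal M_2,\quad \mathcal N=\mathcal N_1+\mathcal N_2+\mathcal N_3,\quad \mathcal G=\mathcal G_1+\mathcal G_2,$$ where for $h>0$, with $\Psi(\tau)=\int_{t-h}^{\tau}\Phi(\tau,\xi)B(\xi)\,d\xi$, $$\mathcal M_1=\Phi(t,t-h)^\top E\,\tfrac1h\!\int_{t-h}^t\!\Phi(t,\tau)B(\tau)\,d\tau,\qquad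 \mathcal M_2=\tfrac1h\!\int_{t-h}^t\!\Phi(\tau,t-h)^\top Q(\tau)\Psi(\tau)\,d\tau,$$ $$\mathcal N_1=\tfrac1h\!\int_{t-h}^t\!R(\tau)\,d\tau,\qquad \mathcal N_2=\tfrac1h\!\int_{t-h}^t\!\Psi(\tau)^\top Q(\tau)\Psi(\tau)\,d\tau,\qquad \mathcal N_3=\tfrac1h\Psi(t)^\top E\,\Psi(t),$$ $$\mathcal G_1=\tfrac1h\!\int_{t-h}^t\!\Phi(\tau,t-h)^\top Q(\tau)\Phi(\tau,t-h)\,d\tau,\qquad \mathcal G_2=\tfrac1h\big(\Phi(t,t-h)^\top E\,\Phi(t,t-h)-E\big),$$ and for $h=0$: $\mathcal M_1=EB(t)$, $\mathcal N_1=R(t)$, $\mathcal G_1=Q(t)$, $\mathcal G_2=A(t)^\top E+EA(t)$, $\mathcal M_2=0$, $\mathcal N_2=\mathcal N_3=0$. A *time partition* $\Delta$ of $[0,T]$, $T>0$, is a finite sequence $0=t_0<t_1<\dots<t_N=T$ with $N\ge1$; $h_i=t_i-t_{i-1}$ and $\|\Delta\|=\max_i h_i$. The setting is *autonomous* if $A,B,Q,R$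 do not depend on $t$; then $\mathcal F(t,E,h)=\mathcal F(E,h)$ does not depend on $t$. Consider the following Riccati equations: * (P-DRE) $E^T:[0,T]\to\mathcal S^n_+$, $\dot E^T(t)=\mathcal F(t,E^T(t),0)$ for all $t\in[0,T]$, $E^T(T)=P$. * (SD-DRE) $E^{T,\Delta}_0,\dots,E^{T,\Delta}_N\in\mathcal S^n_+$, $E^{T,\Delta}_{i+1}-E^{T,\Delta}_i=h_{i+1}\mathcal F(t_{i+1},E^{T,\Delta}_{i+1},h_{i+1})$ for $0\le i\le N-1$, $E^{T,\Delta}_N=P$. * (P-ARE), autonomous setting: $E^\infty\in\mathcal S^n_+$, $\mathcal F(E^\infty,0)=0$. * (SD-ARE), autonomous setting, $h>0$, $\Delta=\{ih\}_{i\in\mathbb N}$: $E^{\infty,\Delta}\in\mathcal S^n_+$, $\mathcal F(E^{\infty,\Delta},h)=0$. In the autonomous setting consider the assumptions: * $(\mathrm H_1)$ $Q\in\mathcal S^n_{++}$. * $(\mathrm H_2)$ For every $x_0\in\mathbb R^n$ there are $x:[0,\infty)\to\mathbb R^n$, absolutely continuous on each $[0,T]$, and $u\in L^2([0,\infty),\mathbb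 R^m)$ with $\dot x=Ax+Bu$ a.e., $x(0)=x_0$ and $\int_0^{\infty}(\langle Qx,x\rangle+\langle Ru,u\rangle)\,d\tau<\infty$. * $(\mathrm H_2^h)$, $h>0$: the same as $(\mathrm H_2)$ with "$u\in L^2$" replaced by "$u$ constant on $[ih,(i+1)h)$ for every $i\in\mathbb N$". **Theorem (Commutative diagram).** In each item the Riccati matrices that occur exist and are unique, and: (i) For every $T>0$, $$\lim_{\|\Delta\|\to0}\ \max_{i=0,\dots,N}\|E^T(t_i)-E^{T,\Delta}_i\|=0,$$ $\Delta$ ranging over all time partitions of $[0,T]$. (ii) In the autonomous setting with $P=0$, under $(\mathrm H_1)$ and $(\mathrm H_2)$, $\lim_{T\to+\infty}E^T(t)=E^\infty$ for every $t\ge0$. (iii) In the autonomous setting with $P=0$, let $h>0$, $t_i=ih$, $\Delta=\{t_i\}_{i\in\mathbb N}$, and $\Delta_N=\Delta\cap[0,t_N]$ for $N\ge1$. Under $(\mathrm H_1)$ and $(\mathrm H_2^h)$, $\lim_{N\to+\infty}E^{t_N,\Delta_N}_i=E^{\infty,\Delta}$ for every $i\in\mathbb N$. (iv) In the autonomous setting,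 under $(\mathrm H_1)$ and $(\mathrm H_2)$, there are $\overline h>0$ and $\overline c\ge0$ such that for every $0<h\le\overline h$ and every $x_0\in\mathbb R^n$ there is a pair $(x,u)$ as in $(\mathrm H_2^h)$ with cost $\int_0^{\infty}(\langle Qx,x\rangle+\langle Ru,u\rangle)\,d\tau\le\overline c\,\langle E^\infty x_0,x_0\rangle$; for $0<h\le\overline h$ the matrix $E^{\infty,\Delta}$ of the $h$-uniform partition $\Delta=\{ih\}_{i\in\mathbb N}$ is well defined, and $\lim_{h\to0}E^{\infty,\Delta}=E^\infty$. -/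

import Mathlib

open Set Filter Topology MeasureTheory
open scoped Matrix Matrix.Norms.L2Operator

noncomputable section

/-! ### State-transition matrix

The terms of the Peano–Baker series of `A` based at the time `s`; the state-transition matrix is
the sum of the series. It is proved below to be the solution `Z` of `Z' = A Z`, `Z(s) = Id`. -/

/-- `I₀ = Id` and `I_{k+1}(t) = ∫ₛᵗ A(τ) I_k(τ) dτ`. -/
def peanoBakerTerm {n : ℕ} (A : ℝ → Matrix (Fin n) (Fin n) ℝ) (s : ℝ) :
    ℕ → ℝ → Matrix (Fin n) (Fin n) ℝ
  | 0 => fun _ => 1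
  | k + 1 => fun t => ∫ τ in s..t, A τ * peanoBakerTerm A s k τ

/-- The state-transition matrix `Φ(t, s)` of the linear equation `x' = A(t) x`. -/
def stateTransition {n : ℕ} (A : ℝ → Matrix (Fin n) (Fin n) ℝ) (t s : ℝ) :
    Matrix (Fin n) (Fin n) ℝ :=
  ∑' k, peanoBakerTerm A s k t

theorem peanoBakerTerm_continuous {n : ℕ} {A : ℝ → Matrix (Fin n) (Fin n) ℝ}
    (hA : Continuous A) (s : ℝ) (k : ℕ) : Continuous (peanoBakerTerm A s k) := by
  induction k with
  | zero => exact continuous_const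
  | succ k ih =>
    exact intervalIntegral.continuous_primitive
      (fun a b => (hA.mul ih).intervalIntegrable a b) s

theorem peanoBakerTerm_hasDerivAt {n : ℕ} {A : ℝ → Matrix (Fin n) (Fin n) ℝ}
    (hA : Continuous A) (s : ℝ) (k : ℕ) (t : ℝ) :
    HasDerivAt (peanoBakerTerm A s (k + 1)) (A t * peanoBakerTerm A s k t) t :=
  intervalIntegral.integral_hasDerivAt_right
    ((hA.mul (peanoBakerTerm_continuous hA s k)).intervalIntegrable _ _)
    ((hA.mul (peanoBakerTerm_continuous hA s k)).stronglyMeasurableAtFilter _ _)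
    (hA.mul (peanoBakerTerm_continuous hA s k)).continuousAt

theorem peanoBakerTerm_norm_le {n : ℕ} {A : ℝ → Matrix (Fin n) (Fin n) ℝ} (s r K : ℝ)
    (hK : ∀ τ ∈ Metric.closedBall s r, ‖A τ‖ ≤ K) (k : ℕ) :
    ∀ t ∈ Metric.closedBall s r, ‖peanoBakerTerm A s k t‖ ≤
      ‖(1 : Matrix (Fin n) (Fin n) ℝ)‖ * ((K * |t - s|) ^ k / (Nat.factorial k : ℝ)) := by
  induction k with
  | zero => intro t _; simp [peanoBakerTerm]
  | succ k ih =>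
    intro t ht
    have hr : 0 ≤ r := dist_nonneg.trans (Metric.mem_closedBall.mp ht)
    have hK0 : 0 ≤ K := (norm_nonneg _).trans (hK s (Metric.mem_closedBall_self hr))
    have hsub : uIoc s t ⊆ Metric.closedBall s r := by
      refine uIoc_subset_uIcc.trans ?_
      rw [Real.closedBall_eq_Icc] at ht ⊢
      exact uIcc_subset_Icc ⟨by linarith, by linarith⟩ ht
    calc ‖peanoBakerTerm A s (k + 1) t‖
        ≤ ∫ τ in uIoc s t, ‖(1 : Matrix (Fin n) (Fin n) ℝ)‖ * K ^ (k + 1) /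
            (Nat.factorial k : ℝ) * |τ - s| ^ k := by
          simp only [peanoBakerTerm]
          rw [intervalIntegral.norm_intervalIntegral_eq]
          apply MeasureTheory.norm_integral_le_of_norm_le
            (Continuous.integrableOn_uIoc (by fun_prop))
          apply ae_restrict_mem measurableSet_uIoc |>.mono
          intro τ hτ
          have h1 := hK τ (hsub hτ)
          have h2 := ih τ (hsub hτ)
          calc ‖A τ * peanoBakerTerm A s k τ‖ ≤ ‖A τ‖ * ‖peanoBakerTerm A s k τ‖ :=
                norm_mul_le _ _
            _ ≤ K * (‖(1 : Matrix (Fin n) (Fin n) ℝ)‖ *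
                  ((K * |τ - s|) ^ k / (Nat.factorial k : ℝ))) := by gcongr
            _ = _ := by rw [mul_pow]; ring
      _ = _ := by
          rw [integral_const_mul, integral_pow_abs_sub_uIoc, Nat.factorial_succ]
          push_cast
          rw [mul_pow]
          field_simp

/-- For continuous `A`, the function `t ↦ Φ(t, s)` solves `Z' = A Z`, `Z(s) = Id` on `ℝ`. -/
theorem stateTransition_spec {n : ℕ} {A : ℝ → Matrix (Fin n) (Fin n) ℝ}
    (hA : Continuous A) (s : ℝ) :
    stateTransition A s s = 1 ∧
      ∀ t, HasDerivAt (fun t => stateTransition A t s) (A t * stateTransition A t s) t := by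
  have hs : ∀ k, peanoBakerTerm A s (k + 1) s = 0 := fun k => by simp [peanoBakerTerm]
  have hsum0 : HasSum (fun k => peanoBakerTerm A s k s) 1 := by
    have h := hasSum_single (f := fun k => peanoBakerTerm A s k s) 0 (fun k hk => by
      obtain ⟨j, rfl⟩ := Nat.exists_eq_succ_of_ne_zero hk
      exact hs j)
    simpa [peanoBakerTerm] using h
  refine ⟨hsum0.tsum_eq, fun t => ?_⟩
  set r : ℝ := |t - s| + 1 with hr
  have hr0 : 0 < r := by positivity
  obtain ⟨K, hK⟩ := (isCompact_closedBall s r).exists_bound_of_continuousOn hA.continuousOn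
  have hK0 : 0 ≤ K := (norm_nonneg _).trans (hK s (Metric.mem_closedBall_self hr0.le))
  set C : ℝ := ‖(1 : Matrix (Fin n) (Fin n) ℝ)‖ with hC
  have hbd : ∀ k, ∀ y ∈ Metric.ball s r,
      ‖peanoBakerTerm A s k y‖ ≤ C * ((K * r) ^ k / (Nat.factorial k : ℝ)) := by
    intro k y hy
    have hy' := Metric.ball_subset_closedBall hy
    refine (peanoBakerTerm_norm_le s r K hK k y hy').trans ?_
    have : |y - s| ≤ r := by simpa [Real.dist_eq] using hy'
    gcongr
  have hu0 : Summable fun k : ℕ => C * ((K * r) ^ k / (Nat.factorial k : ℝ)) :=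
    (Real.summable_pow_div_factorial (K * r)).mul_left C
  have ht : t ∈ Metric.ball s r := by
    rw [Metric.mem_ball, Real.dist_eq, hr]; linarith
  have hsumt : Summable fun k => peanoBakerTerm A s k t :=
    .of_norm_bounded hu0 fun k => hbd k t ht
  let g' : ℕ → ℝ → Matrix (Fin n) (Fin n) ℝ := fun k y =>
    Nat.casesOn k 0 (fun j => A y * peanoBakerTerm A s j y)
  let u : ℕ → ℝ := fun k =>
    Nat.casesOn k 0 (fun j => K * (C * ((K * r) ^ j / (Nat.factorial j : ℝ))))
  have hu : Summable u := (summable_nat_add_iff 1).mp (hu0.mul_left K)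
  have key := hasDerivAt_tsum_of_isPreconnected (g := fun k => peanoBakerTerm A s k)
    (g' := g') (u := u) (y₀ := s) (y := t) hu Metric.isOpen_ball
    (convex_ball s r).isPreconnected
    (by
      intro k y _
      cases k with
      | zero => exact hasDerivAt_const y 1
      | succ j => exact peanoBakerTerm_hasDerivAt hA s j y)
    (by
      intro k y hy
      cases k with
      | zero => simp [g', u]
      | succ j =>
        exact (norm_mul_le _ _).trans (mul_le_mul (hK y (Metric.ball_subset_closedBall hy))
          (hbd j y hy) (norm_nonneg _) hK0))
    (Metric.mem_ball_self hr0) hsum0.summable ht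
  have hg' : ∑' k, g' k t = A t * stateTransition A t s := by
    have hsg : Summable fun k => g' k t := by
      apply (summable_nat_add_iff 1).mp
      exact hsumt.mul_left (A t)
    rw [hsg.tsum_eq_zero_add]
    exact (zero_add _).trans (hsumt.tsum_mul_left (A t))
  rw [hg'] at key
  exact key

/-! ### Data of the linear-quadratic problem and the map `F` -/

/-- Time-dependent coefficients of a linear-quadratic problem with state dimension `n` and control
dimension `m`, subject to the standing assumptions: continuity in time, `Q(t)` symmetric positive
semi-definite and `R(t)` symmetric positive definite for every `t`. -/
structure LQSystem (n m : ℕ) where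
  A : ℝ → Matrix (Fin n) (Fin n) ℝ
  B : ℝ → Matrix (Fin n) (Fin m) ℝ
  Q : ℝ → Matrix (Fin n) (Fin n) ℝ
  R : ℝ → Matrix (Fin m) (Fin m) ℝ
  continuous_A : Continuous A
  continuous_B : Continuous B
  continuous_Q : Continuous Q
  continuous_R : Continuous R
  posSemidef_Q : ∀ t, (Q t).PosSemidef
  posDef_R : ∀ t, (R t).PosDef

namespace LQSystem

variable {n m : ℕ} (S : LQSystem n m)

/-- The autonomous setting: constant coefficients. -/
def IsAutonomous : Prop :=
  ∃ (A : Matrix (Fin n) (Fin n) ℝ) (B : Matrix (Fin n) (Fin m) ℝ)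
    (Q : Matrix (Fin n) (Fin n) ℝ) (R : Matrix (Fin m) (Fin m) ℝ),
    ∀ t, S.A t = A ∧ S.B t = B ∧ S.Q t = Q ∧ S.R t = R

/-- The state-transition matrix associated with `A(·)`. -/
def Φ (t s : ℝ) : Matrix (Fin n) (Fin n) ℝ := stateTransition S.A t s

def M₁ (t : ℝ) (E : Matrix (Fin n) (Fin n) ℝ) (h : ℝ) : Matrix (Fin n) (Fin m) ℝ :=
  if 0 < h then
    (S.Φ t (t - h))ᵀ * E * (h⁻¹ • ∫ τ in (t - h)..t, S.Φ t τ * S.B τ)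
  else E * S.B t

def M₂ (t : ℝ) (_E : Matrix (Fin n) (Fin n) ℝ) (h : ℝ) : Matrix (Fin n) (Fin m) ℝ :=
  if 0 < h then
    h⁻¹ • ∫ τ in (t - h)..t, (S.Φ τ (t - h))ᵀ * S.Q τ *
      (∫ ξ in (t - h)..τ, S.Φ τ ξ * S.B ξ)
  else 0

def N₁ (t : ℝ) (_E : Matrix (Fin n) (Fin n) ℝ) (h : ℝ) : Matrix (Fin m) (Fin m) ℝ :=
  if 0 < h then h⁻¹ • ∫ τ in (t - h)..t, S.R τ else S.R t

def N₂ (t : ℝ) (_E : Matrix (Fin n) (Fin n) ℝ) (h : ℝ) : Matrix (Fin m) (Fin m) ℝ :=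
  if 0 < h then
    h⁻¹ • ∫ τ in (t - h)..t,
      (∫ ξ in (t - h)..τ, (S.B ξ)ᵀ * (S.Φ τ ξ)ᵀ) * S.Q τ *
        (∫ ξ in (t - h)..τ, S.Φ τ ξ * S.B ξ)
  else 0

def N₃ (t : ℝ) (E : Matrix (Fin n) (Fin n) ℝ) (h : ℝ) : Matrix (Fin m) (Fin m) ℝ :=
  if 0 < h then
    h⁻¹ • ((∫ τ in (t - h)..t, (S.B τ)ᵀ * (S.Φ t τ)ᵀ) * E *
      (∫ τ in (t - h)..t, S.Φ t τ * S.B τ))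
  else 0

def G₁ (t : ℝ) (_E : Matrix (Fin n) (Fin n) ℝ) (h : ℝ) : Matrix (Fin n) (Fin n) ℝ :=
  if 0 < h then
    h⁻¹ • ∫ τ in (t - h)..t, (S.Φ τ (t - h))ᵀ * S.Q τ * S.Φ τ (t - h)
  else S.Q t

def G₂ (t : ℝ) (E : Matrix (Fin n) (Fin n) ℝ) (h : ℝ) : Matrix (Fin n) (Fin n) ℝ :=
  if 0 < h then h⁻¹ • ((S.Φ t (t - h))ᵀ * E * S.Φ t (t - h) - E)
  else (S.A t)ᵀ * E + E * S.A t

def M (t : ℝ) (E : Matrix (Fin n) (Fin n) ℝ) (h : ℝ) : Matrix (Fin n) (Fin m) ℝ :=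
  S.M₁ t E h + S.M₂ t E h

def N (t : ℝ) (E : Matrix (Fin n) (Fin n) ℝ) (h : ℝ) : Matrix (Fin m) (Fin m) ℝ :=
  S.N₁ t E h + S.N₂ t E h + S.N₃ t E h

def G (t : ℝ) (E : Matrix (Fin n) (Fin n) ℝ) (h : ℝ) : Matrix (Fin n) (Fin n) ℝ :=
  S.G₁ t E h + S.G₂ t E h

/-- The map `F(t, E, h) = M N⁻¹ Mᵀ - G`, considered for positive semi-definite `E` and `h ≥ 0`. -/
def F (t : ℝ) (E : Matrix (Fin n) (Fin n) ℝ) (h : ℝ) : Matrix (Fin n) (Fin n) ℝ :=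
  S.M t E h * (S.N t E h)⁻¹ * (S.M t E h)ᵀ - S.G t E h

end LQSystem

/-! ### Time partitions -/

/-- A time partition `0 = t₀ < t₁ < ⋯ < t_N = T` with `N ≥ 1`. Only the values `t i` with `i ≤ N`
are meaningful. -/
structure TimePartition (T : ℝ) where
  N : ℕ
  t : ℕ → ℝ
  N_pos : 0 < N
  t_zero : t 0 = 0
  t_last : t N = T
  t_lt : ∀ i, i < N → t i < t (i + 1)

/-- The step `t_{i+1} - t_i`. -/
def TimePartition.step {T : ℝ} (Δ : TimePartition T) (i : ℕ) : ℝ := Δ.t (i + 1) - Δ.t i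

/-- `‖Δ‖`, the largest step. -/
def TimePartition.mesh {T : ℝ} (Δ : TimePartition T) : ℝ :=
  (Finset.range Δ.N).sup' (Finset.nonempty_range_iff.mpr Δ.N_pos.ne') Δ.step

/-- The `h`-uniform time partition `t_i = i h` of `[0, N h]`. -/
def uniformPartition (h : ℝ) (hh : 0 < h) (N : ℕ) (hN : 0 < N) : TimePartition (N * h) where
  N := N
  t := fun i => i * h
  N_pos := hN
  t_zero := by simp
  t_last := rfl
  t_lt := fun i _ => by push_cast; linarith

namespace LQSystem

variable {n m : ℕ} (S : LQSystem n m)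

/-! ### The four Riccati equations -/

/-- `E : [0, T] → S⁺` solves the permanent differential Riccati equation with final value `P`. Only
the values on `[0, T]` are meaningful. -/
def IsPDRE (P : Matrix (Fin n) (Fin n) ℝ) (T : ℝ) (E : ℝ → Matrix (Fin n) (Fin n) ℝ) : Prop :=
  (∀ t ∈ Icc 0 T, (E t).PosSemidef) ∧
  (∀ t ∈ Icc 0 T, HasDerivWithinAt E (S.F t (E t) 0) (Icc 0 T) t) ∧
  E T = P

/-- `E₀, …, E_N` in `S⁺` solve the sampled-data difference Riccati equation with final value `P`.
Only the values `E i` with `i ≤ N` are meaningful. -/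
def IsSDDRE (P : Matrix (Fin n) (Fin n) ℝ) {T : ℝ} (Δ : TimePartition T)
    (E : ℕ → Matrix (Fin n) (Fin n) ℝ) : Prop :=
  (∀ i ≤ Δ.N, (E i).PosSemidef) ∧
  (∀ i < Δ.N, E (i + 1) - E i = Δ.step i • S.F (Δ.t (i + 1)) (E (i + 1)) (Δ.step i)) ∧
  E Δ.N = P

/-- `E` in `S⁺` solves the algebraic Riccati equation `F(E, h) = 0`: the permanent one for `h = 0`,
the sampled-data one for `h > 0`. Used in the autonomous setting, where `F` does not depend on
`t`. -/
def IsARE (h : ℝ) (E : Matrix (Fin n) (Fin n) ℝ) : Prop :=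
  E.PosSemidef ∧ ∀ t, S.F t E h = 0

/-! ### Infinite horizon: trajectories, cost and optimizability -/

/-- `x`, absolutely continuous on every `[0, T]`, satisfies `x(0) = x₀` and `x' = A x + B u` almost
everywhere on `[0, ∞)`. -/
def IsTrajectory (x₀ : Fin n → ℝ) (x : ℝ → Fin n → ℝ) (u : ℝ → Fin m → ℝ) : Prop :=
  (∀ T > 0, AbsolutelyContinuousOnInterval x 0 T) ∧
  (∀ᵐ t ∂(volume.restrict (Ici (0 : ℝ))), HasDerivAt x (S.A t *ᵥ x t + S.B t *ᵥ u t) t) ∧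
  x 0 = x₀

/-- The cost `∫₀^∞ (⟨Q x, x⟩ + ⟨R u, u⟩) dτ` in `[0, ∞]`; the integrand is nonnegative. -/
def cost (x : ℝ → Fin n → ℝ) (u : ℝ → Fin m → ℝ) : ENNReal :=
  ∫⁻ τ in Ici (0 : ℝ), ENNReal.ofReal ((S.Q τ *ᵥ x τ) ⬝ᵥ x τ + (S.R τ *ᵥ u τ) ⬝ᵥ u τ)

/-- `u` is constant on each `[i h, (i + 1) h)`. -/
def IsSampled (h : ℝ) (u : ℝ → Fin m → ℝ) : Prop :=
  ∃ v : ℕ → Fin m → ℝ, ∀ i : ℕ, ∀ t ∈ Ico (i * h) ((i + 1) * h), u t = v i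

/-- (H₁): `Q` is positive definite. -/
def H₁ : Prop := ∀ t, (S.Q t).PosDef

/-- (H₂), optimizability: from every initial state some permanent control has finite cost. -/
def H₂ : Prop :=
  ∀ x₀ : Fin n → ℝ, ∃ (x : ℝ → Fin n → ℝ) (u : ℝ → Fin m → ℝ),
    MemLp u 2 (volume.restrict (Ici (0 : ℝ))) ∧ S.IsTrajectory x₀ x u ∧ S.cost x u < ⊤

/-- (H₂ʰ), `h`-optimizability: from every initial state some `h`-sampled control has finite
cost. -/
def H₂Sampled (h : ℝ) : Prop :=
  ∀ x₀ : Fin n → ℝ, ∃ (x : ℝ → Fin n → ℝ) (u : ℝ → Fin m → ℝ),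
    IsSampled h u ∧ S.IsTrajectory x₀ x u ∧ S.cost x u < ⊤

end LQSystem

end

/-! Everything rests on one family of operators. A control frozen over a step of length `h` gives a
one-step problem with averaged coefficients (`RiccatiData`), and `F(t, E, h)` is its Riccati
operator (`F_eq_ricc`). The averages are rescaled to the unit interval, so they stay continuous at
`h = 0`, where the step becomes the infinitesimal problem; permanent and sampled equations are thus
treated together. Completing the square (`hamiltonian_eq`) shows that `-⟨F(E) x, x⟩` is the minimum
over controls of the running cost plus the variation of `⟨E x, x⟩`. Positivity, monotonicity and all
cost estimates follow from this.

(i) The differential equation is solved globally by linearization: `E = Y X⁻¹` with `(X, Y)` a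
solution of a linear Hamiltonian system, and the monotonicity of `Xᵀ Y` prevents `X` from
degenerating (`hamiltonian_isUnit`). The difference equation is an explicit backward recursion.
Convergence is consistency, by uniform continuity of the operator along the solution, together with
stability, from the factorization `ricc_sub_ricc` and a discrete Grönwall argument.

(ii), (iii) For zero final value the solutions grow with the horizon and are bounded by the cost of
any admissible control of finite cost. Monotone limits therefore exist, and they solve the algebraic
equations.

(iv) If `Q` is positive definite, subsolutions of an algebraic equation lie below supersolutions
(`le_of_ricc_nonpos_of_ricc_nonneg`), which gives uniqueness. Multiples `r E∞` are strict
supersolutions of the permanent equation for `r > 1` and strict subsolutions for `0 ≤ r < 1`.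
Strictness survives for small `h` by continuity. Then `2 E∞` bounds both the Riccati iterates and
the cost of a sampled feedback, and `(1 ± η) E∞` squeeze the sampled solutions. -/

noncomputable section

/-! ### Calculus of matrix-valued functions of a real variable -/

section MatrixCalculus

variable {a b c : ℕ}

theorem hasDerivAt_matrix {f : ℝ → Matrix (Fin a) (Fin b) ℝ} {f' : Matrix (Fin a) (Fin b) ℝ}
    {t : ℝ} : HasDerivAt f f' t ↔ ∀ i j, HasDerivAt (fun s => f s i j) (f' i j) t := by
  constructor
  · intro h i j
    exact (Matrix.entryLinearMap ℝ ℝ i j).toContinuousLinearMap.hasFDerivAt.comp_hasDerivAt t h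
  · intro h
    exact hasDerivAt_pi (φ := fun s i => f s i).2 fun i => hasDerivAt_pi.2 fun j => h i j

theorem HasDerivAt.matrix_mul {f : ℝ → Matrix (Fin a) (Fin b) ℝ} {f' : Matrix (Fin a) (Fin b) ℝ}
    {g : ℝ → Matrix (Fin b) (Fin c) ℝ} {g' : Matrix (Fin b) (Fin c) ℝ} {t : ℝ}
    (hf : HasDerivAt f f' t) (hg : HasDerivAt g g' t) :
    HasDerivAt (fun s => f s * g s) (f' * g t + f t * g') t := by
  rw [hasDerivAt_matrix] at *
  intro i j
  simp only [Matrix.mul_apply, Matrix.add_apply, ← Finset.sum_add_distrib]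
  exact HasDerivAt.fun_sum fun k _ => (hf i k).mul (hg k j)

theorem HasDerivAt.matrix_transpose {f : ℝ → Matrix (Fin a) (Fin b) ℝ}
    {f' : Matrix (Fin a) (Fin b) ℝ} {t : ℝ} (hf : HasDerivAt f f' t) :
    HasDerivAt (fun s => (f s)ᵀ) f'ᵀ t := by
  rw [hasDerivAt_matrix] at *
  exact fun i j => hf j i

theorem HasDerivAt.matrix_mulVec_const {f : ℝ → Matrix (Fin a) (Fin b) ℝ}
    {f' : Matrix (Fin a) (Fin b) ℝ} {t : ℝ} (hf : HasDerivAt f f' t) (x : Fin b → ℝ) :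
    HasDerivAt (fun s => f s *ᵥ x) (f' *ᵥ x) t := by
  refine hasDerivAt_pi.2 fun i => ?_
  simp only [Matrix.mulVec, dotProduct]
  exact HasDerivAt.fun_sum fun k _ => (hasDerivAt_matrix.1 hf i k).mul_const (x k)

/-- The value `x ⬝ᵥ M *ᵥ y` as a continuous linear function of the matrix `M`. -/
def dotForm (x : Fin a → ℝ) (y : Fin b → ℝ) : Matrix (Fin a) (Fin b) ℝ →L[ℝ] ℝ :=
  LinearMap.toContinuousLinearMap
    { toFun := fun M => x ⬝ᵥ M *ᵥ y
      map_add' := fun M N => by rw [Matrix.add_mulVec, dotProduct_add]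
      map_smul' := fun r M => by rw [Matrix.smul_mulVec, dotProduct_smul]; rfl }

@[simp]
theorem dotForm_apply (x : Fin a → ℝ) (y : Fin b → ℝ) (M : Matrix (Fin a) (Fin b) ℝ) :
    dotForm x y M = x ⬝ᵥ M *ᵥ y := rfl

theorem HasDerivAt.matrix_inv {f : ℝ → Matrix (Fin a) (Fin a) ℝ} {f' : Matrix (Fin a) (Fin a) ℝ}
    {t : ℝ} (hf : HasDerivAt f f' t) (h : IsUnit (f t)) :
    HasDerivAt (fun s => (f s)⁻¹) (-((f t)⁻¹ * f' * (f t)⁻¹)) t := by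
  obtain ⟨u, hu⟩ := h
  have h1 := hasFDerivAt_ringInverse (𝕜 := ℝ) u
  rw [hu] at h1
  have h2 := h1.comp_hasDerivAt t hf
  have h3 : (fun s => (f s)⁻¹) = Ring.inverse ∘ f := by
    funext s
    simp [Matrix.nonsing_inv_eq_ringInverse]
  rw [h3]
  refine h2.congr_deriv ?_
  rw [← hu, ← Matrix.coe_units_inv]
  simp

theorem continuousAt_matrix_inv_of_isUnit {M : Matrix (Fin a) (Fin a) ℝ} (h : IsUnit M) :
    ContinuousAt (fun M : Matrix (Fin a) (Fin a) ℝ => M⁻¹) M := by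
  refine continuousAt_matrix_inv M ?_
  obtain ⟨u, hu⟩ := (Matrix.isUnit_iff_isUnit_det M).1 h
  rw [← hu]
  exact NormedRing.inverse_continuousAt u

theorem intervalIntegral_transpose {f : ℝ → Matrix (Fin a) (Fin b) ℝ} (hf : Continuous f)
    (s t : ℝ) : (∫ τ in s..t, f τ)ᵀ = ∫ τ in s..t, (f τ)ᵀ :=
  (ContinuousLinearMap.intervalIntegral_comp_comm
    (Matrix.transposeLinearEquiv (Fin a) (Fin b) ℝ ℝ).toLinearMap.toContinuousLinearMap
    (hf.intervalIntegrable s t)).symm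

theorem intervalIntegral_const_matrix_mul {f : ℝ → Matrix (Fin b) (Fin c) ℝ} (hf : Continuous f)
    (M : Matrix (Fin a) (Fin b) ℝ) (s t : ℝ) :
    M * (∫ τ in s..t, f τ) = ∫ τ in s..t, M * f τ :=
  (ContinuousLinearMap.intervalIntegral_comp_comm
    (mulLeftLinearMap (Fin c) ℝ M).toContinuousLinearMap
    (hf.intervalIntegrable s t)).symm

theorem intervalIntegral_dotProduct_mulVec {f : ℝ → Matrix (Fin a) (Fin b) ℝ} (hf : Continuous f)
    (x : Fin a → ℝ) (y : Fin b → ℝ) (s t : ℝ) :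
    x ⬝ᵥ (∫ τ in s..t, f τ) *ᵥ y = ∫ τ in s..t, x ⬝ᵥ f τ *ᵥ y :=
  ((dotForm x y).intervalIntegral_comp_comm (hf.intervalIntegrable s t)).symm

end MatrixCalculus

/-! ### Quadratic forms and the Loewner order -/

section QuadraticForms

variable {a : ℕ}

theorem posSemidef_iff_quadForm {M : Matrix (Fin a) (Fin a) ℝ} :
    M.PosSemidef ↔ Mᵀ = M ∧ ∀ x, 0 ≤ x ⬝ᵥ M *ᵥ x := by
  constructor
  · intro h
    exact ⟨by simpa [Matrix.IsHermitian] using h.1, fun x => by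
      simpa using h.dotProduct_mulVec_nonneg x⟩
  · rintro ⟨h1, h2⟩
    exact Matrix.PosSemidef.of_dotProduct_mulVec_nonneg (by simpa [Matrix.IsHermitian] using h1)
      (by simpa using h2)

theorem Matrix.PosSemidef.transpose_eq {M : Matrix (Fin a) (Fin a) ℝ} (h : M.PosSemidef) :
    Mᵀ = M := (posSemidef_iff_quadForm.1 h).1

theorem Matrix.PosSemidef.quad_nonneg {M : Matrix (Fin a) (Fin a) ℝ} (h : M.PosSemidef)
    (x : Fin a → ℝ) : 0 ≤ x ⬝ᵥ M *ᵥ x := (posSemidef_iff_quadForm.1 h).2 x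

theorem posDef_iff_quadForm {M : Matrix (Fin a) (Fin a) ℝ} :
    M.PosDef ↔ Mᵀ = M ∧ ∀ x, x ≠ 0 → 0 < x ⬝ᵥ M *ᵥ x := by
  constructor
  · intro h
    exact ⟨by simpa [Matrix.IsHermitian] using h.1, fun x hx => by
      simpa using h.dotProduct_mulVec_pos hx⟩
  · rintro ⟨h1, h2⟩
    exact Matrix.PosDef.of_dotProduct_mulVec_pos (by simpa [Matrix.IsHermitian] using h1)
      (by simpa using h2)

theorem dotProduct_mulVec_comm_of_transpose_eq {M : Matrix (Fin a) (Fin a) ℝ} (h : Mᵀ = M)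
    (x y : Fin a → ℝ) : x ⬝ᵥ M *ᵥ y = y ⬝ᵥ M *ᵥ x := by
  rw [Matrix.dotProduct_mulVec, ← Matrix.mulVec_transpose, h, dotProduct_comm]

theorem quadForm_add_vec {M : Matrix (Fin a) (Fin a) ℝ} (h : Mᵀ = M) (x y : Fin a → ℝ) :
    (x + y) ⬝ᵥ M *ᵥ (x + y) = x ⬝ᵥ M *ᵥ x + 2 * (x ⬝ᵥ M *ᵥ y) + y ⬝ᵥ M *ᵥ y := by
  rw [Matrix.mulVec_add, add_dotProduct, dotProduct_add, dotProduct_add,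
    dotProduct_mulVec_comm_of_transpose_eq h y x]
  ring

/-- Polarization reduces limits and vanishing of symmetric matrices to their quadratic forms, on
which the order arguments operate. -/
theorem entry_eq_polarization {M : Matrix (Fin a) (Fin a) ℝ} (h : Mᵀ = M) (i j : Fin a) :
    M i j = ((Pi.single i 1 + Pi.single j 1) ⬝ᵥ M *ᵥ (Pi.single i 1 + Pi.single j 1)
      - Pi.single i 1 ⬝ᵥ M *ᵥ Pi.single i 1 - Pi.single j 1 ⬝ᵥ M *ᵥ Pi.single j 1) / 2 := by
  rw [quadForm_add_vec h]
  have : Pi.single i 1 ⬝ᵥ M *ᵥ Pi.single j 1 = M i j := by simp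
  rw [this]
  ring

theorem eq_zero_of_quadForm_eq_zero {M : Matrix (Fin a) (Fin a) ℝ} (h : Mᵀ = M)
    (h0 : ∀ x, x ⬝ᵥ M *ᵥ x = 0) : M = 0 := by
  ext i j
  rw [entry_eq_polarization h, h0, h0, h0]
  simp

theorem tendsto_matrix_iff {ι : Type*} {l : Filter ι} {b : ℕ} {f : ι → Matrix (Fin a) (Fin b) ℝ}
    {M : Matrix (Fin a) (Fin b) ℝ} :
    Tendsto f l (𝓝 M) ↔ ∀ i j, Tendsto (fun k => f k i j) l (𝓝 (M i j)) := by
  constructor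
  · intro h i j
    exact ((continuous_id.matrix_elem i j).tendsto M).comp h
  · intro h
    exact tendsto_pi_nhds.2 fun i => tendsto_pi_nhds.2 fun j => h i j

/-- Symmetric matrices converge as soon as their quadratic forms converge pointwise. -/
theorem exists_tendsto_of_tendsto_quadForm {ι : Type*} {l : Filter ι} [l.NeBot]
    {f : ι → Matrix (Fin a) (Fin a) ℝ} (hf : ∀ k, (f k).PosSemidef)
    (hq : ∀ x, ∃ r, Tendsto (fun k => x ⬝ᵥ f k *ᵥ x) l (𝓝 r)) :
    ∃ M : Matrix (Fin a) (Fin a) ℝ, Tendsto f l (𝓝 M) := by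
  choose q hq using hq
  refine ⟨fun i j => (q (Pi.single i 1 + Pi.single j 1) - q (Pi.single i 1)
    - q (Pi.single j 1)) / 2, tendsto_matrix_iff.2 fun i j => ?_⟩
  refine Tendsto.congr (fun k => (entry_eq_polarization (hf k).transpose_eq i j).symm) ?_
  exact (((hq _).sub (hq _)).sub (hq _)).div_const 2

theorem tendsto_of_tendsto_quadForm {ι : Type*} {l : Filter ι}
    {f : ι → Matrix (Fin a) (Fin a) ℝ} {M : Matrix (Fin a) (Fin a) ℝ}
    (hf : ∀ᶠ k in l, (f k)ᵀ = f k) (hM : Mᵀ = M)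
    (hq : ∀ x, Tendsto (fun k => x ⬝ᵥ f k *ᵥ x) l (𝓝 (x ⬝ᵥ M *ᵥ x))) :
    Tendsto f l (𝓝 M) := by
  refine tendsto_matrix_iff.2 fun i j => ?_
  rw [entry_eq_polarization hM]
  refine Tendsto.congr' (hf.mono fun k hk => (entry_eq_polarization hk i j).symm) ?_
  exact (((hq _).sub (hq _)).sub (hq _)).div_const 2

theorem isClosed_posSemidef : IsClosed {M : Matrix (Fin a) (Fin a) ℝ | M.PosSemidef} := by
  simp only [posSemidef_iff_quadForm, ofPred_and, ofPred_forall]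
  refine IsClosed.inter (isClosed_eq (by fun_prop) continuous_id) (isClosed_iInter fun x => ?_)
  exact isClosed_le continuous_const (dotForm x x).continuous

theorem dotProduct_self_nonneg_real (x : Fin a → ℝ) : 0 ≤ x ⬝ᵥ x := by
  simpa using dotProduct_star_self_nonneg x

/-- Cauchy–Schwarz; the norm is the Euclidean operator norm, so no dimensional constant appears. -/
theorem quadForm_le_norm_mul (M : Matrix (Fin a) (Fin a) ℝ) (x : Fin a → ℝ) :
    x ⬝ᵥ M *ᵥ x ≤ ‖M‖ * (x ⬝ᵥ x) := by
  have h2 := real_inner_le_norm (WithLp.toLp 2 x) (WithLp.toLp 2 (M *ᵥ x))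
  have h3 := Matrix.l2_opNorm_mulVec M (WithLp.toLp 2 x)
  have h4 : ‖WithLp.toLp 2 x‖ ^ 2 = x ⬝ᵥ x := by
    rw [← real_inner_self_eq_norm_sq, EuclideanSpace.inner_toLp_toLp]; simp
  rw [EuclideanSpace.inner_toLp_toLp, star_trivial, dotProduct_comm] at h2
  rw [← h4]
  calc _ ≤ _ := h2
    _ ≤ ‖WithLp.toLp 2 x‖ * (‖M‖ * ‖WithLp.toLp 2 x‖) := by
      gcongr
      exact h3
    _ = _ := by ring

/-- The constant is the minimum of the form on the compact unit sphere, and homogeneity does the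
rest. -/
theorem Matrix.PosDef.exists_quadForm_ge {M : Matrix (Fin a) (Fin a) ℝ} (h : M.PosDef) :
    ∃ c > 0, ∀ x, c * (x ⬝ᵥ x) ≤ x ⬝ᵥ M *ᵥ x := by
  have hcont : Continuous fun x : EuclideanSpace ℝ (Fin a) => x.ofLp ⬝ᵥ M *ᵥ x.ofLp := by fun_prop
  -- The sphere is empty only in dimension `0`, where any constant works.
  rcases (Metric.sphere (0 : EuclideanSpace ℝ (Fin a)) 1).eq_empty_or_nonempty with he | hne
  · refine ⟨1, one_pos, fun x => ?_⟩
    have : x = 0 := by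
      by_contra hx
      have hx' : WithLp.toLp 2 x ≠ (0 : EuclideanSpace ℝ (Fin a)) := by
        simpa using hx
      have : (‖WithLp.toLp 2 x‖⁻¹ • WithLp.toLp 2 x : EuclideanSpace ℝ (Fin a)) ∈
          Metric.sphere (0 : EuclideanSpace ℝ (Fin a)) 1 := by
        simp [norm_smul, hx]
      rw [he] at this
      exact this
    simp [this]
  · obtain ⟨z, hz, hmin⟩ := (isCompact_sphere _ _).exists_isMinOn hne hcont.continuousOn
    have hz0 : z.ofLp ≠ 0 := by
      intro h0
      have : z = 0 := by ext i; simpa using congrFun h0 i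
      simp [this] at hz
    refine ⟨_, (posDef_iff_quadForm.1 h).2 _ hz0, fun x => ?_⟩
    by_cases hx : x = 0
    · simp [hx]
    set y : EuclideanSpace ℝ (Fin a) := WithLp.toLp 2 x with hy
    have hy0 : y ≠ 0 := by simpa [hy] using hx
    have hyn : ‖y‖ ≠ 0 := norm_ne_zero_iff.2 hy0
    have h1 := hmin (show ‖y‖⁻¹ • y ∈ Metric.sphere (0 : EuclideanSpace ℝ (Fin a)) 1 by
      simp [norm_smul, hyn])
    have h4 : ‖y‖ ^ 2 = x ⬝ᵥ x := by
      rw [← real_inner_self_eq_norm_sq, EuclideanSpace.inner_toLp_toLp]; simp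
    simp only [WithLp.ofLp_smul, Matrix.mulVec_smul, smul_dotProduct, dotProduct_smul,
      smul_eq_mul, mem_ofPred_eq] at h1
    have h6 : 0 < ‖y‖ := norm_pos_iff.2 hy0
    rw [← h4]
    calc _ ≤ (‖y‖⁻¹ * (‖y‖⁻¹ * (x ⬝ᵥ M *ᵥ x))) * ‖y‖ ^ 2 := by
          gcongr
      _ = _ := by field_simp

/-- Bounded monotone sequences of positive semidefinite matrices converge. -/
theorem exists_tendsto_of_monotone_quadForm {ι : Type*} [Preorder ι] [Nonempty ι]
    [IsDirectedOrder ι]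
    {f : ι → Matrix (Fin a) (Fin a) ℝ} (hf : ∀ k, (f k).PosSemidef)
    (hmono : ∀ x, Monotone fun k => x ⬝ᵥ f k *ᵥ x)
    (hbdd : ∀ x, BddAbove (range fun k => x ⬝ᵥ f k *ᵥ x)) :
    ∃ M : Matrix (Fin a) (Fin a) ℝ, M.PosSemidef ∧ Tendsto f atTop (𝓝 M) ∧
      ∀ k x, x ⬝ᵥ f k *ᵥ x ≤ x ⬝ᵥ M *ᵥ x := by
  obtain ⟨M, hM⟩ := exists_tendsto_of_tendsto_quadForm hf
    fun x => ⟨_, tendsto_atTop_ciSup (hmono x) (hbdd x)⟩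
  exact ⟨M, isClosed_posSemidef.mem_of_tendsto hM (Eventually.of_forall hf), hM, fun k x =>
    (hmono x).ge_of_tendsto (((dotForm x x).continuous.tendsto M).comp hM) k⟩

/-- Matrices close to a positive definite one have a nonnegative quadratic form. -/
theorem Matrix.PosDef.eventually_quad_nonneg {ι : Type*} {l : Filter ι}
    {f : ι → Matrix (Fin a) (Fin a) ℝ} {M : Matrix (Fin a) (Fin a) ℝ} (hM : M.PosDef)
    (hf : Tendsto f l (𝓝 M)) : ∀ᶠ k in l, ∀ x, 0 ≤ x ⬝ᵥ f k *ᵥ x := by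
  obtain ⟨c, hc, hcle⟩ := hM.exists_quadForm_ge
  filter_upwards [Metric.tendsto_nhds.1 hf c hc] with k hk x
  have h1 := quadForm_le_norm_mul (M - f k) x
  rw [dist_comm, dist_eq_norm] at hk
  have h2 : ‖M - f k‖ * (x ⬝ᵥ x) ≤ c * (x ⬝ᵥ x) :=
    mul_le_mul_of_nonneg_right hk.le (dotProduct_self_nonneg_real x)
  rw [Matrix.sub_mulVec, dotProduct_sub] at h1
  linarith [hcle x]

end QuadraticForms

/-! ### Riccati operators with fixed coefficients -/

/-- Coefficients of one step of a linear-quadratic problem: over a step of length `h`, the state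
moves from `x` to `x + h (γ x + β v)` under the control `v`, at the average cost
`⟨g x, x⟩ + 2 ⟨μ v, x⟩ + ⟨ν v, v⟩`. The value `h = 0` describes the infinitesimal problem. -/
@[ext]
structure RiccatiData (n m : ℕ) where
  h : ℝ
  γ : Matrix (Fin n) (Fin n) ℝ
  β : Matrix (Fin n) (Fin m) ℝ
  g : Matrix (Fin n) (Fin n) ℝ
  μ : Matrix (Fin n) (Fin m) ℝ
  ν : Matrix (Fin m) (Fin m) ℝ
  h_nonneg : 0 ≤ h
  g_transpose : gᵀ = g
  ν_posDef : ν.PosDef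
  cost_nonneg : ∀ x v, 0 ≤ x ⬝ᵥ g *ᵥ x + 2 * (x ⬝ᵥ μ *ᵥ v) + v ⬝ᵥ ν *ᵥ v

namespace RiccatiData

variable {n m : ℕ} (D : RiccatiData n m) {E E' X Y : Matrix (Fin n) (Fin n) ℝ}

def stepCost (x : Fin n → ℝ) (v : Fin m → ℝ) : ℝ :=
  x ⬝ᵥ D.g *ᵥ x + 2 * (x ⬝ᵥ D.μ *ᵥ v) + v ⬝ᵥ D.ν *ᵥ v

def velocity (x : Fin n → ℝ) (v : Fin m → ℝ) : Fin n → ℝ := D.γ *ᵥ x + D.β *ᵥ v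

/-- `crossTerm`, `controlTerm` and `stateTerm` are the coefficients of `hamiltonian` as a quadratic
polynomial in `(x, v)` (`hamiltonian_eq_terms`); they correspond to `M`, `N` and `G`. -/
def crossTerm (E : Matrix (Fin n) (Fin n) ℝ) : Matrix (Fin n) (Fin m) ℝ :=
  (1 + D.h • D.γ)ᵀ * E * D.β + D.μ

def controlTerm (E : Matrix (Fin n) (Fin n) ℝ) : Matrix (Fin m) (Fin m) ℝ :=
  D.ν + D.h • (D.βᵀ * E * D.β)

def stateTerm (E : Matrix (Fin n) (Fin n) ℝ) : Matrix (Fin n) (Fin n) ℝ :=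
  D.g + (D.γᵀ * E + E * D.γ + D.h • (D.γᵀ * E * D.γ))

/-- The Riccati operator. -/
def ricc (E : Matrix (Fin n) (Fin n) ℝ) : Matrix (Fin n) (Fin n) ℝ :=
  D.crossTerm E * (D.controlTerm E)⁻¹ * (D.crossTerm E)ᵀ - D.stateTerm E

/-- The optimal feedback gain. -/
def gain (E : Matrix (Fin n) (Fin n) ℝ) : Matrix (Fin m) (Fin n) ℝ :=
  -((D.controlTerm E)⁻¹ * (D.crossTerm E)ᵀ)

def closedLoop (E : Matrix (Fin n) (Fin n) ℝ) : Matrix (Fin n) (Fin n) ℝ :=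
  D.γ + D.β * D.gain E

theorem controlTerm_posDef (hE : E.PosSemidef) : (D.controlTerm E).PosDef := by
  refine D.ν_posDef.add_posSemidef (Matrix.PosSemidef.smul ?_ D.h_nonneg)
  simpa using hE.conjTranspose_mul_mul_same D.β

theorem isUnit_controlTerm (hE : E.PosSemidef) : IsUnit (D.controlTerm E) :=
  (D.controlTerm_posDef hE).isUnit

theorem controlTerm_transpose (hE : E.PosSemidef) : (D.controlTerm E)ᵀ = D.controlTerm E :=
  (posDef_iff_quadForm.1 (D.controlTerm_posDef hE)).1

theorem stateTerm_transpose (hE : E.PosSemidef) : (D.stateTerm E)ᵀ = D.stateTerm E := by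
  simp only [stateTerm, Matrix.transpose_add, Matrix.transpose_smul, Matrix.transpose_mul,
    Matrix.transpose_transpose, hE.transpose_eq, D.g_transpose, Matrix.mul_assoc]
  abel

theorem ricc_transpose (hE : E.PosSemidef) : (D.ricc E)ᵀ = D.ricc E := by
  simp only [ricc, Matrix.transpose_sub, D.stateTerm_transpose hE, Matrix.transpose_mul,
    Matrix.transpose_transpose, Matrix.transpose_nonsing_inv, D.controlTerm_transpose hE,
    Matrix.mul_assoc]

theorem gain_transpose (hE : E.PosSemidef) :
    (D.gain E)ᵀ = -(D.crossTerm E * (D.controlTerm E)⁻¹) := by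
  simp only [gain, Matrix.transpose_neg, Matrix.transpose_mul, Matrix.transpose_transpose,
    Matrix.transpose_nonsing_inv, D.controlTerm_transpose hE]

theorem controlTerm_mul_gain (hE : E.PosSemidef) :
    D.controlTerm E * D.gain E = -(D.crossTerm E)ᵀ := by
  have := (Matrix.isUnit_iff_isUnit_det _).1 (D.isUnit_controlTerm hE)
  rw [gain, Matrix.mul_neg, Matrix.mul_nonsing_inv_cancel_left _ _ this]

theorem gain_transpose_mul_controlTerm (hE : E.PosSemidef) :
    (D.gain E)ᵀ * D.controlTerm E = -D.crossTerm E := by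
  have := (Matrix.isUnit_iff_isUnit_det _).1 (D.isUnit_controlTerm hE)
  rw [gain_transpose D hE, Matrix.neg_mul, Matrix.nonsing_inv_mul_cancel_right _ _ this]

theorem crossTerm_mul_gain :
    D.crossTerm E * D.gain E = -(D.ricc E + D.stateTerm E) := by
  rw [gain, ricc, sub_add_cancel, Matrix.mul_neg, Matrix.mul_assoc]

theorem gain_transpose_mul_crossTerm (hE : E.PosSemidef) :
    (D.gain E)ᵀ * (D.crossTerm E)ᵀ = -(D.ricc E + D.stateTerm E) := by
  rw [D.gain_transpose hE, ricc, sub_add_cancel, Matrix.neg_mul]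

/-- Both operators equal the same expression, affine in the matrix, when the gain of `E` is used on
the left and that of `E'` on the right. The gains then factor out of the difference, which explains
why closed loops of both matrices occur. This is the source of the Lipschitz bounds. -/
theorem ricc_sub_ricc (hE : E.PosSemidef) (hE' : E'.PosSemidef) :
    D.ricc E - D.ricc E' = -((D.closedLoop E)ᵀ * (E - E') + (E - E') * D.closedLoop E' +
      D.h • ((D.closedLoop E)ᵀ * (E - E') * D.closedLoop E')) := by
  have h1 : D.ricc E = -(D.stateTerm E + D.crossTerm E * D.gain E' +
      (D.gain E)ᵀ * (D.crossTerm E)ᵀ + (D.gain E)ᵀ * D.controlTerm E * D.gain E') := by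
    rw [D.gain_transpose_mul_crossTerm hE, D.gain_transpose_mul_controlTerm hE, Matrix.neg_mul]
    abel
  have h2 : D.ricc E' = -(D.stateTerm E' + D.crossTerm E' * D.gain E' +
      (D.gain E)ᵀ * (D.crossTerm E')ᵀ + (D.gain E)ᵀ * D.controlTerm E' * D.gain E') := by
    rw [Matrix.mul_assoc _ _ (D.gain E'), D.controlTerm_mul_gain hE', D.crossTerm_mul_gain,
      Matrix.mul_neg]
    abel
  rw [h1, h2]
  simp only [stateTerm, crossTerm, controlTerm, closedLoop, Matrix.transpose_add,
    Matrix.transpose_smul, Matrix.transpose_mul, Matrix.transpose_one, Matrix.transpose_transpose,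
    hE.transpose_eq, hE'.transpose_eq, Matrix.add_mul, Matrix.mul_add, Matrix.smul_mul,
    Matrix.mul_smul, Matrix.mul_sub, Matrix.sub_mul, Matrix.one_mul,
    Matrix.mul_assoc, smul_add, smul_sub]
  abel

/-- The Hamiltonian whose minimum over the controls is the opposite of the Riccati operator. -/
def hamiltonian (E : Matrix (Fin n) (Fin n) ℝ) (x : Fin n → ℝ) (v : Fin m → ℝ) : ℝ :=
  D.stepCost x v + 2 * (x ⬝ᵥ E *ᵥ D.velocity x v) +
    D.h * (D.velocity x v ⬝ᵥ E *ᵥ D.velocity x v)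

theorem hamiltonian_eq_terms (hE : E.PosSemidef) (x : Fin n → ℝ) (v : Fin m → ℝ) :
    D.hamiltonian E x v =
      x ⬝ᵥ D.stateTerm E *ᵥ x + 2 * (x ⬝ᵥ D.crossTerm E *ᵥ v) + v ⬝ᵥ D.controlTerm E *ᵥ v := by
  have ht (M : Matrix (Fin n) (Fin n) ℝ) (z : Fin n → ℝ) : x ⬝ᵥ Mᵀ *ᵥ z = (M *ᵥ x) ⬝ᵥ z := by
    rw [Matrix.dotProduct_mulVec, Matrix.vecMul_transpose]
  have ht' (z : Fin n → ℝ) : v ⬝ᵥ D.βᵀ *ᵥ z = (D.β *ᵥ v) ⬝ᵥ z := by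
    rw [Matrix.dotProduct_mulVec, Matrix.vecMul_transpose]
  simp only [hamiltonian, stepCost, velocity, stateTerm, crossTerm, controlTerm,
    quadForm_add_vec hE.transpose_eq]
  simp only [Matrix.transpose_add, Matrix.transpose_one, Matrix.transpose_smul, Matrix.add_mulVec,
    Matrix.mulVec_add, Matrix.smul_mulVec, dotProduct_add, dotProduct_smul, smul_eq_mul,
    Matrix.add_mul, Matrix.smul_mul, Matrix.one_mul, ← Matrix.mulVec_mulVec, Matrix.mul_assoc,
    ht, ht']
  rw [dotProduct_mulVec_comm_of_transpose_eq hE.transpose_eq (D.γ *ᵥ x) x]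
  ring

/-- Completing the square in `v`: the gain is the minimizer, because `controlTerm E` times the gain
is the opposite of the transposed cross term. -/
theorem hamiltonian_eq (hE : E.PosSemidef) (x : Fin n → ℝ) (v : Fin m → ℝ) :
    D.hamiltonian E x v = -(x ⬝ᵥ D.ricc E *ᵥ x) +
      (v - D.gain E *ᵥ x) ⬝ᵥ D.controlTerm E *ᵥ (v - D.gain E *ᵥ x) := by
  have hN := D.controlTerm_transpose hE
  have e1 (w : Fin m → ℝ) :
      (D.gain E *ᵥ x) ⬝ᵥ D.controlTerm E *ᵥ w = -(x ⬝ᵥ D.crossTerm E *ᵥ w) := by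
    rw [← Matrix.vecMul_transpose, ← Matrix.dotProduct_mulVec, Matrix.mulVec_mulVec,
      D.gain_transpose_mul_controlTerm hE, Matrix.neg_mulVec, dotProduct_neg]
  have e2 : (D.gain E *ᵥ x) ⬝ᵥ D.controlTerm E *ᵥ (D.gain E *ᵥ x) =
      x ⬝ᵥ D.ricc E *ᵥ x + x ⬝ᵥ D.stateTerm E *ᵥ x := by
    rw [e1, Matrix.mulVec_mulVec, D.crossTerm_mul_gain, Matrix.neg_mulVec, dotProduct_neg, neg_neg,
      Matrix.add_mulVec, dotProduct_add]
  rw [hamiltonian_eq_terms D hE, sub_eq_add_neg v, quadForm_add_vec hN]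
  simp only [Matrix.mulVec_neg, dotProduct_neg, neg_dotProduct, e2,
    dotProduct_mulVec_comm_of_transpose_eq hN v, e1]
  ring

theorem hamiltonian_gain (hE : E.PosSemidef) (x : Fin n → ℝ) :
    D.hamiltonian E x (D.gain E *ᵥ x) = -(x ⬝ᵥ D.ricc E *ᵥ x) := by
  rw [D.hamiltonian_eq hE]; simp

theorem neg_ricc_le_hamiltonian (hE : E.PosSemidef) (x : Fin n → ℝ) (v : Fin m → ℝ) :
    -(x ⬝ᵥ D.ricc E *ᵥ x) ≤ D.hamiltonian E x v := by
  rw [D.hamiltonian_eq hE]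
  have := (D.controlTerm_posDef hE).posSemidef.quad_nonneg (v - D.gain E *ᵥ x)
  linarith

/-- Apart from the step cost, the Hamiltonian is linear in `E`. The leftover `(1 - r)` times the
cost is what makes multiples of a solution strict sub- or supersolutions. -/
theorem hamiltonian_smul (r : ℝ) (x : Fin n → ℝ) (v : Fin m → ℝ) :
    D.hamiltonian (r • E) x v = (1 - r) * D.stepCost x v + r * D.hamiltonian E x v := by
  simp only [hamiltonian, Matrix.smul_mulVec, dotProduct_smul, smul_eq_mul]
  ring

/-- One step of the difference Riccati equation, backward in time. -/
def step (E : Matrix (Fin n) (Fin n) ℝ) : Matrix (Fin n) (Fin n) ℝ := E - D.h • D.ricc E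

/-- Bellman's identity: expanding the quadratic form at the next state relates the Riccati operator
to one step of dynamic programming. -/
theorem add_hamiltonian (hE : E.PosSemidef) (x : Fin n → ℝ) (v : Fin m → ℝ) :
    x ⬝ᵥ E *ᵥ x + D.h * D.hamiltonian E x v = D.h * D.stepCost x v +
      (x + D.h • D.velocity x v) ⬝ᵥ E *ᵥ (x + D.h • D.velocity x v) := by
  rw [quadForm_add_vec hE.transpose_eq]
  simp only [hamiltonian, Matrix.mulVec_smul, dotProduct_smul, smul_dotProduct, smul_eq_mul]
  ring

theorem quad_step (x : Fin n → ℝ) :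
    x ⬝ᵥ D.step E *ᵥ x = x ⬝ᵥ E *ᵥ x + D.h * (-(x ⬝ᵥ D.ricc E *ᵥ x)) := by
  simp only [step, Matrix.sub_mulVec, Matrix.smul_mulVec, dotProduct_sub, dotProduct_smul,
    smul_eq_mul]
  ring

theorem quad_step_le (hE : E.PosSemidef) (x : Fin n → ℝ) (v : Fin m → ℝ) :
    x ⬝ᵥ D.step E *ᵥ x ≤ D.h * D.stepCost x v +
      (x + D.h • D.velocity x v) ⬝ᵥ E *ᵥ (x + D.h • D.velocity x v) := by
  rw [← D.add_hamiltonian hE, quad_step]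
  have := mul_le_mul_of_nonneg_left (D.neg_ricc_le_hamiltonian hE x v) D.h_nonneg
  linarith

theorem quad_step_eq (hE : E.PosSemidef) (x : Fin n → ℝ) :
    x ⬝ᵥ D.step E *ᵥ x = D.h * D.stepCost x (D.gain E *ᵥ x) +
      (x + D.h • D.velocity x (D.gain E *ᵥ x)) ⬝ᵥ
        E *ᵥ (x + D.h • D.velocity x (D.gain E *ᵥ x)) := by
  rw [← D.add_hamiltonian hE, D.hamiltonian_gain hE, quad_step]

/-- Under the optimal control the new form is a nonnegative step cost plus a nonnegative form at the
next state. -/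
theorem step_posSemidef (hE : E.PosSemidef) : (D.step E).PosSemidef := by
  refine posSemidef_iff_quadForm.2 ⟨?_, fun x => ?_⟩
  · simp [step, hE.transpose_eq, D.ricc_transpose hE]
  · rw [D.quad_step_eq hE]
    exact add_nonneg (mul_nonneg D.h_nonneg (D.cost_nonneg _ _)) (hE.quad_nonneg _)

theorem iterate_step_posSemidef (k : ℕ) : (D.step^[k] 0).PosSemidef := by
  induction k with
  | zero => exact Matrix.PosSemidef.zero
  | succ k ih => rw [Function.iterate_succ_apply']; exact D.step_posSemidef ih

/-- The optimal control for the larger matrix is a competitor for the smaller one. -/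
theorem step_mono (hE : E.PosSemidef) (hE' : E'.PosSemidef)
    (hle : ∀ x, x ⬝ᵥ E *ᵥ x ≤ x ⬝ᵥ E' *ᵥ x) (x : Fin n → ℝ) :
    x ⬝ᵥ D.step E *ᵥ x ≤ x ⬝ᵥ D.step E' *ᵥ x := by
  rw [D.quad_step_eq hE' x]
  exact (D.quad_step_le hE x (D.gain E' *ᵥ x)).trans (by gcongr; exact hle _)

/-- Comparison principle for sub- and supersolutions of the algebraic Riccati equation. -/
theorem le_of_ricc_nonpos_of_ricc_nonneg (hcost : ∀ x v, x ≠ 0 → 0 < D.stepCost x v)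
    (hX : X.PosSemidef) (hY : Y.PosSemidef) (hFX : ∀ x, x ⬝ᵥ D.ricc X *ᵥ x ≤ 0)
    (hFY : ∀ x, 0 ≤ x ⬝ᵥ D.ricc Y *ᵥ x) (x : Fin n → ℝ) :
    x ⬝ᵥ X *ᵥ x ≤ x ⬝ᵥ Y *ᵥ x := by
  -- Consider the largest `r` in `[0, 1]` for which `r • X` lies below `Y`; the claim is `r = 1`.
  set s : Set ℝ := {r | r ∈ Icc 0 1 ∧ (Y - r • X).PosSemidef} with hs
  have hs0 : (0 : ℝ) ∈ s := ⟨by simp, by simpa using hY⟩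
  have hsc : IsCompact s := by
    refine isCompact_Icc.inter_right (isClosed_posSemidef.preimage ?_)
    fun_prop
  obtain ⟨r, ⟨hr01, hrP⟩, hrmax⟩ := hsc.exists_isGreatest ⟨0, hs0⟩
  rcases hr01.2.lt_or_eq with hr1 | rfl
  swap
  · have := hrP.quad_nonneg x
    simp only [one_smul, Matrix.sub_mulVec, dotProduct_sub] at this
    linarith
  exfalso
  by_cases hpd : (Y - r • X).PosDef
  · obtain ⟨c, hc, hcle⟩ := hpd.exists_quadForm_ge
    obtain ⟨C, hC, hCle⟩ : ∃ C > 0, ∀ z, z ⬝ᵥ X *ᵥ z ≤ C * (z ⬝ᵥ z) :=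
      ⟨‖X‖ + 1, by positivity, fun z => by
        linarith [quadForm_le_norm_mul X z, dotProduct_self_nonneg_real z]⟩
    -- If `Y - r • X` were positive definite, `r` could be increased: `1 - r` keeps it in `[0, 1]`,
    -- and `c / C` lets the coercivity of the gap absorb the extra multiple of `X`.
    have hε : 0 < min (1 - r) (c / C) := lt_min (by linarith) (by positivity)
    have hmem : r + min (1 - r) (c / C) ∈ s := by
      refine ⟨⟨by linarith [hr01.1], by linarith [min_le_left (1 - r) (c / C)]⟩, ?_⟩
      refine posSemidef_iff_quadForm.2 ⟨by simp [hX.transpose_eq, hY.transpose_eq], fun z => ?_⟩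
      have h1 := hcle z
      have h2 := hCle z
      have h3 : min (1 - r) (c / C) * (z ⬝ᵥ X *ᵥ z) ≤ c * (z ⬝ᵥ z) := by
        calc _ ≤ c / C * (C * (z ⬝ᵥ z)) := by
              gcongr
              · exact hX.quad_nonneg z
              · exact min_le_right _ _
          _ = _ := by field_simp
      simp only [Matrix.sub_mulVec, Matrix.smul_mulVec, dotProduct_sub, dotProduct_smul,
        smul_eq_mul] at h1 ⊢
      linarith
    linarith [hrmax hmem]
  · obtain ⟨z, hz, hz0⟩ : ∃ z, z ≠ 0 ∧ z ⬝ᵥ (Y - r • X) *ᵥ z = 0 := by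
      by_contra! hcon
      exact hpd (posDef_iff_quadForm.2 ⟨hrP.transpose_eq, fun z hz =>
        lt_of_le_of_ne (hrP.quad_nonneg z) (hcon z hz).symm⟩)
    have hker : (Y - r • X) *ᵥ z = 0 := (hrP.dotProduct_mulVec_zero_iff z).1 (by simpa using hz0)
    -- In the contact direction `z` the first-order terms of `Y` and `r • X` agree and the
    -- second-order term favours `Y`. Hence the Hamiltonian of `Y` at `(z, v)` is at least `(1 - r)`
    -- times a positive cost plus a nonnegative term, although `Y` being a supersolution makes it
    -- nonpositive.
    set v := D.gain Y *ᵥ z with hv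
    have h1 : D.hamiltonian Y z v = D.hamiltonian (r • X) z v +
        D.h * (D.velocity z v ⬝ᵥ (Y - r • X) *ᵥ D.velocity z v) := by
      have h2 : z ⬝ᵥ (Y - r • X) *ᵥ D.velocity z v = 0 := by
        rw [dotProduct_mulVec_comm_of_transpose_eq hrP.transpose_eq, hker, dotProduct_zero]
      simp only [hamiltonian, Matrix.sub_mulVec, dotProduct_sub] at h2 ⊢
      linarith
    have h3 : 0 ≤ D.h * (D.velocity z v ⬝ᵥ (Y - r • X) *ᵥ D.velocity z v) :=
      mul_nonneg D.h_nonneg (hrP.quad_nonneg _)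
    have h4 := D.neg_ricc_le_hamiltonian hX z v
    have h5 := D.hamiltonian_gain hY z
    rw [← hv, h1, D.hamiltonian_smul] at h5
    have h6 : 0 < (1 - r) * D.stepCost z v := mul_pos (by linarith) (hcost z v hz)
    have h7 : 0 ≤ r * D.hamiltonian X z v := mul_nonneg hr01.1 (by linarith [hFX z])
    linarith [hFY z]

/-- Use the optimal control of `E` as a competitor for `r • E`: its Hamiltonian vanishes at `E`, so
only the negative term `(1 - r)` times the cost remains. -/
theorem ricc_smul_pos (hcost : ∀ x v, x ≠ 0 → 0 < D.stepCost x v)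
    (hE : E.PosSemidef) (hF : D.ricc E = 0) {r : ℝ} (hr : 1 < r) {x : Fin n → ℝ} (hx : x ≠ 0) :
    0 < x ⬝ᵥ D.ricc (r • E) *ᵥ x := by
  have h1 := D.neg_ricc_le_hamiltonian (hE.smul (zero_le_one.trans hr.le)) x (D.gain E *ᵥ x)
  rw [hamiltonian_smul, D.hamiltonian_gain hE, hF] at h1
  simp only [Matrix.zero_mulVec, dotProduct_zero, neg_zero, mul_zero, add_zero] at h1
  have h2 : 0 < (r - 1) * D.stepCost x (D.gain E *ᵥ x) :=
    mul_pos (by linarith) (hcost x _ hx)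
  linarith

/-- Here the optimal control of `r • E` is used as a competitor for `E`. -/
theorem ricc_smul_neg (hcost : ∀ x v, x ≠ 0 → 0 < D.stepCost x v)
    (hE : E.PosSemidef) (hF : D.ricc E = 0) {r : ℝ} (hr0 : 0 ≤ r) (hr : r < 1) {x : Fin n → ℝ}
    (hx : x ≠ 0) : x ⬝ᵥ D.ricc (r • E) *ᵥ x < 0 := by
  have h1 := D.hamiltonian_gain (hE.smul hr0) x
  have h2 := D.neg_ricc_le_hamiltonian hE x (D.gain (r • E) *ᵥ x)
  rw [hamiltonian_smul] at h1
  rw [hF] at h2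
  simp only [Matrix.zero_mulVec, dotProduct_zero, neg_zero] at h2
  have h3 : 0 < (1 - r) * D.stepCost x (D.gain (r • E) *ᵥ x) :=
    mul_pos (by linarith) (hcost x _ hx)
  have h4 := mul_nonneg hr0 h2
  linarith

theorem eq_of_ricc_eq_zero (hcost : ∀ x v, x ≠ 0 → 0 < D.stepCost x v)
    (hX : X.PosSemidef) (hY : Y.PosSemidef) (hFX : D.ricc X = 0) (hFY : D.ricc Y = 0) :
    X = Y := by
  rw [← sub_eq_zero]
  refine eq_zero_of_quadForm_eq_zero (by simp [hX.transpose_eq, hY.transpose_eq]) fun x => ?_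
  have h1 := D.le_of_ricc_nonpos_of_ricc_nonneg hcost hX hY (by simp [hFX]) (by simp [hFY]) x
  have h2 := D.le_of_ricc_nonpos_of_ricc_nonneg hcost hY hX (by simp [hFY]) (by simp [hFX]) x
  rw [Matrix.sub_mulVec, dotProduct_sub]
  linarith

end RiccatiData

/-! ### Properties of the state-transition matrix -/

section Transition

variable {n b : ℕ} {A : ℝ → Matrix (Fin n) (Fin n) ℝ}

theorem eq_zero_of_linear_ode (hA : Continuous A) {f : ℝ → Matrix (Fin n) (Fin b) ℝ} {s : ℝ}
    (hf : ∀ t, HasDerivAt f (A t * f t) t) (hs : f s = 0) (t : ℝ) : f t = 0 := by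
  -- The margin of `1` on each side makes the base point `s` interior to the interval, as two-sided
  -- uniqueness requires.
  obtain ⟨K, hK⟩ := (isCompact_Icc (a := min s t - 1) (b := max s t + 1)).exists_bound_of_continuousOn
    hA.continuousOn
  have hcont : Continuous f := continuous_iff_continuousAt.2 fun t => (hf t).continuousAt
  have key := ODE_solution_unique_of_mem_Icc (v := fun t x => A t * x) (s := fun _ => univ)
    (K := K.toNNReal) (f := f) (g := fun _ => 0) (a := min s t - 1) (b := max s t + 1) (t₀ := s)
    (fun τ hτ => LipschitzOnWith.of_dist_le_mul fun x _ y _ => by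
      rw [dist_eq_norm, dist_eq_norm, ← Matrix.mul_sub]
      refine (Matrix.l2_opNorm_mul _ _).trans ?_
      gcongr
      exact (hK τ (Ioo_subset_Icc_self hτ)).trans (Real.le_coe_toNNReal K))
    ⟨by linarith [min_le_left s t], by linarith [le_max_left s t]⟩
    hcont.continuousOn (fun τ _ => hf τ) (fun _ _ => mem_univ _) continuousOn_const
    (fun τ _ => by rw [Matrix.mul_zero]; exact hasDerivAt_const τ 0) (fun _ _ => mem_univ _) hs
  exact key ⟨by linarith [min_le_right s t], by linarith [le_max_right s t]⟩

theorem stateTransition_self (hA : Continuous A) (s : ℝ) : stateTransition A s s = 1 :=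
  (stateTransition_spec hA s).1

theorem stateTransition_hasDerivAt (hA : Continuous A) (s t : ℝ) :
    HasDerivAt (fun t => stateTransition A t s) (A t * stateTransition A t s) t :=
  (stateTransition_spec hA s).2 t

theorem eq_stateTransition_mul (hA : Continuous A) {f : ℝ → Matrix (Fin n) (Fin b) ℝ}
    (hf : ∀ t, HasDerivAt f (A t * f t) t) (s t : ℝ) : f t = stateTransition A t s * f s := by
  rw [← sub_eq_zero]
  refine eq_zero_of_linear_ode hA (f := fun t => f t - stateTransition A t s * f s) (s := s)
    (fun τ => ?_) (by simp [stateTransition_self hA]) t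
  have h := (hf τ).fun_sub
    ((stateTransition_hasDerivAt hA s τ).matrix_mul (hasDerivAt_const τ (f s)))
  refine h.congr_deriv ?_
  rw [Matrix.mul_zero, add_zero, Matrix.mul_sub, Matrix.mul_assoc]

theorem stateTransition_mul (hA : Continuous A) (t s r : ℝ) :
    stateTransition A t s * stateTransition A s r = stateTransition A t r :=
  (eq_stateTransition_mul hA (stateTransition_hasDerivAt hA r) s t).symm

theorem stateTransition_mul_symm (hA : Continuous A) (t s : ℝ) :
    stateTransition A t s * stateTransition A s t = 1 := by
  rw [stateTransition_mul hA, stateTransition_self hA]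

theorem stateTransition_inv (hA : Continuous A) (t s : ℝ) :
    (stateTransition A t s)⁻¹ = stateTransition A s t :=
  Matrix.inv_eq_right_inv (stateTransition_mul_symm hA t s)

theorem isUnit_stateTransition (hA : Continuous A) (t s : ℝ) : IsUnit (stateTransition A t s) :=
  IsUnit.of_mul_eq_one _ (stateTransition_mul_symm hA t s)

/-- `Φ(t, s)` is the inverse of `Φ(s, t)`, whose derivative in `s` is known. -/
theorem stateTransition_hasDerivAt_right (hA : Continuous A) (t s : ℝ) :
    HasDerivAt (fun s => stateTransition A t s) (-(stateTransition A t s * A s)) s := by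
  have h := (stateTransition_hasDerivAt hA t s).matrix_inv (isUnit_stateTransition hA s t)
  simp only [stateTransition_inv hA] at h
  refine h.congr_deriv ?_
  rw [Matrix.mul_assoc, Matrix.mul_assoc, stateTransition_mul_symm hA, Matrix.mul_one]

/-- Factoring `Φ(t, s) = Φ(t, 0) Φ(0, s)` reduces joint continuity to one variable at a time. -/
theorem stateTransition_continuous (hA : Continuous A) :
    Continuous fun p : ℝ × ℝ => stateTransition A p.1 p.2 := by
  have h1 : Continuous fun t => stateTransition A t 0 :=
    continuous_iff_continuousAt.2 fun t => (stateTransition_hasDerivAt hA 0 t).continuousAt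
  have h2 : Continuous fun t => stateTransition A 0 t :=
    continuous_iff_continuousAt.2 fun t => (stateTransition_hasDerivAt_right hA 0 t).continuousAt
  have h3 : (fun p : ℝ × ℝ => stateTransition A p.1 p.2) =
      fun p : ℝ × ℝ => stateTransition A p.1 0 * stateTransition A 0 p.2 :=
    funext fun p => (stateTransition_mul hA _ 0 _).symm
  rw [h3]
  exact (h1.comp continuous_fst).matrix_mul (h2.comp continuous_snd)

theorem stateTransition_add_right (hA : Continuous A) {c : ℝ} (hc : ∀ t, A (t + c) = A t)
    (t s : ℝ) : stateTransition A (t + c) (s + c) = stateTransition A t s := by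
  have h := eq_stateTransition_mul hA (f := fun t => stateTransition A (t + c) (s + c))
    (fun τ => by
      have := (stateTransition_hasDerivAt hA (s + c) (τ + c)).comp_add_const τ c
      rwa [hc] at this) s t
  simpa [stateTransition_self hA] using h

end Transition

/-! ### Averages over a step -/

section StepAverage

variable {X : Type*} [NormedAddCommGroup X] [NormedSpace ℝ X]

/-- The average of `f s` over `[s, s + h]`. -/
def stepAverage (f : ℝ → ℝ → X) (s h : ℝ) : X := ∫ σ in (0 : ℝ)..1, f s (s + h * σ)

theorem smul_stepAverage (f : ℝ → ℝ → X) (s h : ℝ) :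
    h • stepAverage f s h = ∫ τ in s..(s + h), f s τ := by
  rw [stepAverage, intervalIntegral.smul_integral_comp_add_mul, mul_zero, add_zero, mul_one]

theorem stepAverage_zero (f : ℝ → ℝ → X) (s : ℝ) [CompleteSpace X] :
    stepAverage f s 0 = f s s := by
  simp [stepAverage]

/-- Integrating over the fixed interval `[0, 1]` removes the division by `h`, so continuity includes
`h = 0`. -/
theorem stepAverage_continuous {f : ℝ → ℝ → X} (hf : Continuous fun p : ℝ × ℝ => f p.1 p.2) :
    Continuous fun p : ℝ × ℝ => stepAverage f p.1 p.2 := by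
  refine intervalIntegral.continuous_parametric_intervalIntegral_of_continuous
    (f := fun (p : ℝ × ℝ) σ => f p.1 (p.1 + p.2 * σ)) (s := fun _ => 1) ?_ continuous_const
  exact hf.comp (f := fun q : (ℝ × ℝ) × ℝ => (q.1.1, q.1.1 + q.1.2 * q.2)) (by fun_prop)

theorem integral_sub_eq_smul_stepAverage (f : ℝ → ℝ → X) (t h : ℝ) :
    ∫ τ in (t - h)..t, f (t - h) τ = h • stepAverage f (t - h) h := by
  rw [smul_stepAverage, sub_add_cancel]

end StepAverage

/-! ### The Riccati data of a linear-quadratic system -/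

namespace LQSystem

variable {n m : ℕ} (S : LQSystem n m)

theorem Φ_continuous : Continuous fun p : ℝ × ℝ => S.Φ p.1 p.2 :=
  stateTransition_continuous S.continuous_A

theorem Φ_self (s : ℝ) : S.Φ s s = 1 := stateTransition_self S.continuous_A s

/-- The response at time `τ` to a constant control applied since the time `s`. -/
def response (s τ : ℝ) : Matrix (Fin n) (Fin m) ℝ := ∫ ξ in s..τ, S.Φ τ ξ * S.B ξ

theorem response_self (s : ℝ) : S.response s s = 0 := by simp [response]

theorem continuous_Φ_mul_B : Continuous fun p : ℝ × ℝ => S.Φ p.1 p.2 * S.B p.2 :=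
  S.Φ_continuous.matrix_mul (S.continuous_B.comp continuous_snd)

theorem continuous_Φ_mul_B_right (s : ℝ) : Continuous fun ξ => S.Φ s ξ * S.B ξ :=
  S.continuous_Φ_mul_B.comp (f := fun ξ : ℝ => (s, ξ)) (by fun_prop)

theorem response_eq (s τ : ℝ) : S.response s τ = S.Φ τ s * ∫ ξ in s..τ, S.Φ s ξ * S.B ξ := by
  rw [intervalIntegral_const_matrix_mul (S.continuous_Φ_mul_B_right s)]
  simp only [response, ← Matrix.mul_assoc, Φ, stateTransition_mul S.continuous_A]

/-- This form displays the factor `τ - s` and makes the joint continuity of the response a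
consequence of that of averages. -/
theorem response_eq_stepAverage (s τ : ℝ) : S.response s τ =
    (τ - s) • (S.Φ τ s * stepAverage (fun s ξ => S.Φ s ξ * S.B ξ) s (τ - s)) := by
  rw [response_eq, ← Matrix.mul_smul, smul_stepAverage, add_sub_cancel]

theorem response_continuous : Continuous fun p : ℝ × ℝ => S.response p.1 p.2 := by
  simp only [response_eq_stepAverage]
  refine Continuous.smul (continuous_snd.sub continuous_fst) (Continuous.matrix_mul ?_ ?_)
  · exact S.Φ_continuous.comp (f := fun p : ℝ × ℝ => (p.2, p.1)) (by fun_prop)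
  · exact (stepAverage_continuous (f := fun s ξ => S.Φ s ξ * S.B ξ) S.continuous_Φ_mul_B).comp
      (f := fun p : ℝ × ℝ => (p.1, p.2 - p.1)) (by fun_prop)

theorem response_transpose (s τ : ℝ) :
    (S.response s τ)ᵀ = ∫ ξ in s..τ, (S.B ξ)ᵀ * (S.Φ τ ξ)ᵀ := by
  rw [response, intervalIntegral_transpose (S.continuous_Φ_mul_B_right τ)]
  simp only [Matrix.transpose_mul]

theorem response_hasDerivAt (s τ : ℝ) :
    HasDerivAt (fun τ => S.response s τ) (S.A τ * S.response s τ + S.B τ) τ := by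
  have h1 := intervalIntegral.integral_hasDerivAt_right
    ((S.continuous_Φ_mul_B_right s).intervalIntegrable s τ)
    ((S.continuous_Φ_mul_B_right s).stronglyMeasurableAtFilter _ _)
    (S.continuous_Φ_mul_B_right s).continuousAt
  have h2 := (stateTransition_hasDerivAt S.continuous_A s τ).matrix_mul h1
  simp only [response_eq]
  refine h2.congr_deriv ?_
  rw [← Matrix.mul_assoc (stateTransition S.A τ s), Φ, stateTransition_mul_symm S.continuous_A,
    Matrix.one_mul, Matrix.mul_assoc]
  rfl

def γIntegrand (s τ : ℝ) : Matrix (Fin n) (Fin n) ℝ := S.A τ * S.Φ τ s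

def gIntegrand (s τ : ℝ) : Matrix (Fin n) (Fin n) ℝ := (S.Φ τ s)ᵀ * S.Q τ * S.Φ τ s

def μIntegrand (s τ : ℝ) : Matrix (Fin n) (Fin m) ℝ := (S.Φ τ s)ᵀ * S.Q τ * S.response s τ

def νIntegrand (s τ : ℝ) : Matrix (Fin m) (Fin m) ℝ :=
  S.R τ + (S.response s τ)ᵀ * S.Q τ * S.response s τ

theorem Φ_swap_continuous : Continuous fun p : ℝ × ℝ => S.Φ p.2 p.1 :=
  S.Φ_continuous.comp (f := fun p : ℝ × ℝ => (p.2, p.1)) (by fun_prop)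

theorem γIntegrand_continuous : Continuous fun p : ℝ × ℝ => S.γIntegrand p.1 p.2 :=
  (S.continuous_A.comp continuous_snd).matrix_mul S.Φ_swap_continuous

theorem gIntegrand_continuous : Continuous fun p : ℝ × ℝ => S.gIntegrand p.1 p.2 :=
  (S.Φ_swap_continuous.matrix_transpose.matrix_mul
    (S.continuous_Q.comp continuous_snd)).matrix_mul S.Φ_swap_continuous

theorem μIntegrand_continuous : Continuous fun p : ℝ × ℝ => S.μIntegrand p.1 p.2 :=
  (S.Φ_swap_continuous.matrix_transpose.matrix_mul
    (S.continuous_Q.comp continuous_snd)).matrix_mul S.response_continuous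

theorem νIntegrand_continuous : Continuous fun p : ℝ × ℝ => S.νIntegrand p.1 p.2 :=
  (S.continuous_R.comp continuous_snd).add
    ((S.response_continuous.matrix_transpose.matrix_mul
    (S.continuous_Q.comp continuous_snd)).matrix_mul S.response_continuous)

/-- The running cost. -/
def runningCost (τ : ℝ) (x : Fin n → ℝ) (v : Fin m → ℝ) : ℝ :=
  (S.Q τ *ᵥ x) ⬝ᵥ x + (S.R τ *ᵥ v) ⬝ᵥ v

theorem runningCost_nonneg (τ : ℝ) (x : Fin n → ℝ) (v : Fin m → ℝ) :
    0 ≤ S.runningCost τ x v := by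
  rw [runningCost, dotProduct_comm, dotProduct_comm (S.R τ *ᵥ v)]
  exact add_nonneg ((S.posSemidef_Q τ).quad_nonneg x) ((S.posDef_R τ).posSemidef.quad_nonneg v)

/-- The trajectory with the constant control `v` which is at `x` at the time `s`. -/
def arc (s τ : ℝ) (x : Fin n → ℝ) (v : Fin m → ℝ) : Fin n → ℝ :=
  S.Φ τ s *ᵥ x + S.response s τ *ᵥ v

theorem arc_self (s : ℝ) (x : Fin n → ℝ) (v : Fin m → ℝ) : S.arc s s x v = x := by
  simp [arc, Φ_self, response_self]

theorem arc_hasDerivAt (s τ : ℝ) (x : Fin n → ℝ) (v : Fin m → ℝ) :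
    HasDerivAt (fun τ => S.arc s τ x v) (S.A τ *ᵥ S.arc s τ x v + S.B τ *ᵥ v) τ := by
  have h := ((stateTransition_hasDerivAt S.continuous_A s τ).matrix_mulVec_const x).fun_add
    ((S.response_hasDerivAt s τ).matrix_mulVec_const v)
  refine h.congr_deriv ?_
  simp only [arc, Matrix.mulVec_add, Matrix.add_mulVec, Matrix.mulVec_mulVec, Φ, add_assoc]

theorem arc_continuous (s : ℝ) (x : Fin n → ℝ) (v : Fin m → ℝ) :
    Continuous fun τ => S.arc s τ x v :=
  continuous_iff_continuousAt.2 fun τ => (S.arc_hasDerivAt s τ x v).continuousAt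

theorem runningCost_arc_continuous (s : ℝ) (x : Fin n → ℝ) (v : Fin m → ℝ) :
    Continuous fun τ => S.runningCost τ (S.arc s τ x v) v := by
  have h1 := S.arc_continuous s x v
  have h2 := S.continuous_Q
  have h3 := S.continuous_R
  unfold runningCost
  exact ((h2.matrix_mulVec h1).dotProduct h1).add
    ((h3.matrix_mulVec continuous_const).dotProduct continuous_const)

theorem runningCost_arc (s τ : ℝ) (x : Fin n → ℝ) (v : Fin m → ℝ) :
    S.runningCost τ (S.arc s τ x v) v = x ⬝ᵥ S.gIntegrand s τ *ᵥ x +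
      2 * (x ⬝ᵥ S.μIntegrand s τ *ᵥ v) + v ⬝ᵥ S.νIntegrand s τ *ᵥ v := by
  have ht {a b : ℕ} (M : Matrix (Fin a) (Fin b) ℝ) (y : Fin b → ℝ) (z : Fin a → ℝ) :
      y ⬝ᵥ Mᵀ *ᵥ z = (M *ᵥ y) ⬝ᵥ z := by
    rw [Matrix.dotProduct_mulVec, Matrix.vecMul_transpose]
  rw [runningCost, dotProduct_comm, dotProduct_comm (S.R τ *ᵥ v), arc,
    quadForm_add_vec (S.posSemidef_Q τ).transpose_eq]
  simp only [gIntegrand, μIntegrand, νIntegrand, Matrix.mul_assoc, ← Matrix.mulVec_mulVec,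
    Matrix.add_mulVec, dotProduct_add, ht]
  ring

theorem stepAverage_dotForm {a b : ℕ} {f : ℝ → ℝ → Matrix (Fin a) (Fin b) ℝ}
    (hf : Continuous fun p : ℝ × ℝ => f p.1 p.2) (s h : ℝ) (x : Fin a → ℝ) (y : Fin b → ℝ) :
    x ⬝ᵥ stepAverage f s h *ᵥ y = stepAverage (fun s τ => x ⬝ᵥ f s τ *ᵥ y) s h :=
  intervalIntegral_dotProduct_mulVec
    (hf.comp (f := fun σ : ℝ => (s, s + h * σ)) (by fun_prop)) x y 0 1

/-- Averaging `runningCost_arc` over the step identifies the averaged coefficients with the average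
cost of an arc, whence the sign conditions in `RiccatiData`. -/
theorem stepAverage_runningCost (s h : ℝ) (x : Fin n → ℝ) (v : Fin m → ℝ) :
    x ⬝ᵥ stepAverage S.gIntegrand s h *ᵥ x + 2 * (x ⬝ᵥ stepAverage S.μIntegrand s h *ᵥ v) +
      v ⬝ᵥ stepAverage S.νIntegrand s h *ᵥ v =
      stepAverage (fun s τ => S.runningCost τ (S.arc s τ x v) v) s h := by
  rw [stepAverage_dotForm S.gIntegrand_continuous, stepAverage_dotForm S.μIntegrand_continuous,
    stepAverage_dotForm S.νIntegrand_continuous]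
  simp only [runningCost_arc, stepAverage]
  have hc {a b : ℕ} {f : ℝ → ℝ → Matrix (Fin a) (Fin b) ℝ}
      (hf : Continuous fun p : ℝ × ℝ => f p.1 p.2) (x : Fin a → ℝ) (y : Fin b → ℝ) :
      IntervalIntegrable (fun σ => x ⬝ᵥ f s (s + h * σ) *ᵥ y) volume 0 1 :=
    ((dotForm x y).continuous.comp
      (hf.comp (f := fun σ : ℝ => (s, s + h * σ)) (by fun_prop))).intervalIntegrable 0 1
  have h1 := hc S.gIntegrand_continuous x x
  have h2 := (hc S.μIntegrand_continuous x v).const_mul 2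
  have h3 := hc S.νIntegrand_continuous v v
  rw [intervalIntegral.integral_add (h1.add h2) h3, intervalIntegral.integral_add h1 h2,
    intervalIntegral.integral_const_mul]

theorem stepAverage_runningCost_nonneg (s h : ℝ) (x : Fin n → ℝ) (v : Fin m → ℝ) :
    0 ≤ stepAverage (fun s τ => S.runningCost τ (S.arc s τ x v) v) s h :=
  intervalIntegral.integral_nonneg zero_le_one fun _ _ => S.runningCost_nonneg _ _ _

theorem stepAverage_transpose {a : ℕ} {f : ℝ → ℝ → Matrix (Fin a) (Fin a) ℝ}
    (hf : Continuous fun p : ℝ × ℝ => f p.1 p.2) (hsymm : ∀ s τ, (f s τ)ᵀ = f s τ) (s h : ℝ) :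
    (stepAverage f s h)ᵀ = stepAverage f s h := by
  have hc : Continuous fun σ => f s (s + h * σ) :=
    hf.comp (f := fun σ : ℝ => (s, s + h * σ)) (by fun_prop)
  rw [stepAverage, intervalIntegral_transpose hc]
  simp only [hsymm]

/-- The form at `v` is the average cost of the arc starting at `0`. Its integrand is continuous,
nonnegative, and equal to `⟨R v, v⟩ > 0` at the start of the step. -/
theorem stepAverage_νIntegrand_posDef (s h : ℝ) : (stepAverage S.νIntegrand s h).PosDef := by
  refine posDef_iff_quadForm.2 ⟨stepAverage_transpose S.νIntegrand_continuous (fun s τ => ?_) s h,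
    fun v hv => ?_⟩
  · simp [νIntegrand, (S.posDef_R τ).posSemidef.transpose_eq, (S.posSemidef_Q τ).transpose_eq,
      Matrix.mul_assoc]
  · have h1 := S.stepAverage_runningCost s h 0 v
    simp only [zero_dotProduct, zero_add, mul_zero] at h1
    rw [h1]
    have hc : Continuous fun σ : ℝ =>
        S.runningCost (s + h * σ) (S.arc s (s + h * σ) 0 v) v :=
      (S.runningCost_arc_continuous s 0 v).comp (by fun_prop)
    refine intervalIntegral.integral_pos one_pos hc.continuousOn
      (fun _ _ => S.runningCost_nonneg _ _ _) ⟨0, by simp, ?_⟩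
    simp only [mul_zero, add_zero, arc_self, runningCost, Matrix.mulVec_zero, dotProduct_zero,
      zero_add]
    rw [dotProduct_comm]
    exact (posDef_iff_quadForm.1 (S.posDef_R s)).2 v hv

/-- The Riccati data of the step `[t - h, t]`. -/
def data (t : ℝ) (h : NNReal) : RiccatiData n m where
  h := h
  γ := stepAverage S.γIntegrand (t - h) h
  β := S.Φ t (t - h) * stepAverage (fun s ξ => S.Φ s ξ * S.B ξ) (t - h) h
  g := stepAverage S.gIntegrand (t - h) h
  μ := stepAverage S.μIntegrand (t - h) h
  ν := stepAverage S.νIntegrand (t - h) h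
  h_nonneg := h.coe_nonneg
  g_transpose := stepAverage_transpose S.gIntegrand_continuous
    (fun s τ => by simp [gIntegrand, (S.posSemidef_Q τ).transpose_eq, Matrix.mul_assoc]) _ _
  ν_posDef := S.stepAverage_νIntegrand_posDef _ _
  cost_nonneg x v := by
    rw [S.stepAverage_runningCost]
    exact S.stepAverage_runningCost_nonneg _ _ _ _

@[simp]
theorem data_h (t : ℝ) (h : NNReal) : (S.data t h).h = h := rfl

theorem data_stepCost (t : ℝ) (h : NNReal) (x : Fin n → ℝ) (v : Fin m → ℝ) :
    (S.data t h).stepCost x v =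
      stepAverage (fun s τ => S.runningCost τ (S.arc s τ x v) v) (t - h) h :=
  S.stepAverage_runningCost _ _ x v

theorem data_smul_stepCost (t : ℝ) (h : NNReal) (x : Fin n → ℝ) (v : Fin m → ℝ) :
    (h : ℝ) * (S.data t h).stepCost x v =
      ∫ τ in (t - h)..t, S.runningCost τ (S.arc (t - h) τ x v) v := by
  rw [data_stepCost, ← smul_eq_mul,
    integral_sub_eq_smul_stepAverage fun s τ => S.runningCost τ (S.arc s τ x v) v]

/-- At the start of the step the integrand is at least `⟨Q x, x⟩ > 0`, and it is continuous and
nonnegative. Through this strict positivity (H₁) enters the comparison principle. -/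
theorem data_stepCost_pos (hQ : S.H₁) (t : ℝ) (h : NNReal) (x : Fin n → ℝ) (v : Fin m → ℝ)
    (hx : x ≠ 0) : 0 < (S.data t h).stepCost x v := by
  rw [data_stepCost]
  have hc : Continuous fun σ : ℝ =>
      S.runningCost (t - h + h * σ) (S.arc (t - h) (t - h + h * σ) x v) v :=
    (S.runningCost_arc_continuous (t - h) x v).comp (by fun_prop)
  refine intervalIntegral.integral_pos one_pos hc.continuousOn
    (fun _ _ => S.runningCost_nonneg _ _ _) ⟨0, by simp, ?_⟩
  simp only [mul_zero, add_zero, arc_self, runningCost]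
  rw [dotProduct_comm, dotProduct_comm (S.R _ *ᵥ v)]
  exact add_pos_of_pos_of_nonneg ((posDef_iff_quadForm.1 (hQ _)).2 x hx)
    ((S.posDef_R _).posSemidef.quad_nonneg v)

theorem one_add_data_γ (t : ℝ) (h : NNReal) :
    1 + (S.data t h).h • (S.data t h).γ = S.Φ t (t - h) := by
  change 1 + (h : ℝ) • stepAverage S.γIntegrand (t - h) h = _
  rw [← integral_sub_eq_smul_stepAverage]
  have hc : Continuous fun τ => S.γIntegrand (t - h) τ :=
    S.γIntegrand_continuous.comp (f := fun τ : ℝ => (t - (h : ℝ), τ)) (by fun_prop)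
  have := intervalIntegral.integral_eq_sub_of_hasDerivAt (f := fun τ => S.Φ τ (t - h))
    (fun τ _ => stateTransition_hasDerivAt S.continuous_A (t - h) τ)
    (hc.intervalIntegrable (t - h) t)
  exact (congrArg (1 + ·) this).trans (by simp [Φ_self])

theorem data_β (t : ℝ) (h : NNReal) :
    (S.data t h).h • (S.data t h).β = S.response (t - h) t := by
  rw [response_eq_stepAverage, sub_sub_cancel]
  rfl

theorem data_velocity (t : ℝ) (h : NNReal) (x : Fin n → ℝ) (v : Fin m → ℝ) :
    x + (h : ℝ) • (S.data t h).velocity x v = S.arc (t - h) t x v := by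
  rw [arc, ← data_β, ← one_add_data_γ]
  simp only [RiccatiData.velocity, Matrix.add_mulVec, Matrix.smul_mulVec, Matrix.one_mulVec,
    smul_add, add_assoc, data_h]

/-- For `h > 0` the averages, `1 + h γ = Φ(t, t - h)` and `h β = Ψ(t)` give back the integral
formulas. For `h = 0` the averages are point values and the response vanishes, so the same data
produce the other branch of the definitions. -/
theorem F_eq_ricc (t : ℝ) (E : Matrix (Fin n) (Fin n) ℝ) (h : NNReal) :
    S.F t E h = (S.data t h).ricc E := by
  have hM : S.M t E h = (S.data t h).crossTerm E := by
    rw [M, RiccatiData.crossTerm, one_add_data_γ, M₁, M₂]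
    split_ifs with hh
    · congr 1
      · congr 1
        rw [← response, ← data_β, data_h, inv_smul_smul₀ hh.ne']
      · exact (congrArg (_ • ·) (integral_sub_eq_smul_stepAverage S.μIntegrand t h)).trans
          (inv_smul_smul₀ hh.ne' _)
    · have h0 : (h : ℝ) = 0 := le_antisymm (not_lt.1 hh) h.2
      simp only [data, h0, sub_zero, stepAverage_zero, Φ_self, μIntegrand, response_self]
      simp
  have hN : S.N t E h = (S.data t h).controlTerm E := by
    rw [N, RiccatiData.controlTerm, N₁, N₂, N₃]
    split_ifs with hh
    · congr 1
      · rw [← smul_add, ← intervalIntegral.integral_add]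
        · have := integral_sub_eq_smul_stepAverage S.νIntegrand t h
          rw [inv_smul_eq_iff₀ hh.ne']
          refine Eq.trans ?_ this
          simp only [νIntegrand, response_transpose]
          rfl
        · exact S.continuous_R.intervalIntegrable _ _
        · have hc : Continuous fun τ => (S.response (t - h) τ)ᵀ * S.Q τ * S.response (t - h) τ := by
            have hr : Continuous fun τ => S.response (t - h) τ :=
              S.response_continuous.comp (f := fun τ : ℝ => (t - (h : ℝ), τ)) (by fun_prop)
            exact (hr.matrix_transpose.matrix_mul S.continuous_Q).matrix_mul hr
          simp only [response_transpose] at hc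
          exact hc.intervalIntegrable _ _
      · rw [← response_transpose, ← response, ← data_β, data_h]
        simp only [Matrix.transpose_smul, Matrix.smul_mul, Matrix.mul_smul]
        rw [inv_smul_smul₀ hh.ne']
    · have h0 : (h : ℝ) = 0 := le_antisymm (not_lt.1 hh) h.2
      simp only [data, h0, sub_zero, stepAverage_zero, νIntegrand, response_self]
      simp
  have hG : S.G t E h = (S.data t h).stateTerm E := by
    rw [G, RiccatiData.stateTerm, G₁, G₂]
    split_ifs with hh
    · congr 1
      · exact (congrArg (_ • ·) (integral_sub_eq_smul_stepAverage S.gIntegrand t h)).trans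
          (inv_smul_smul₀ hh.ne' _)
      · rw [← one_add_data_γ, inv_smul_eq_iff₀ hh.ne']
        simp only [data_h, Matrix.transpose_add, Matrix.transpose_one, Matrix.transpose_smul,
          Matrix.add_mul, Matrix.mul_add, Matrix.one_mul, Matrix.mul_one, Matrix.smul_mul,
          Matrix.mul_smul, smul_add]
        abel
    · have h0 : (h : ℝ) = 0 := le_antisymm (not_lt.1 hh) h.2
      simp only [data, h0, sub_zero, stepAverage_zero, gIntegrand, γIntegrand, Φ_self]
      simp
  rw [F, RiccatiData.ricc, hM, hN, hG]

end LQSystem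

namespace LQSystem

variable {n m : ℕ} (S : LQSystem n m)

/-! ### Continuity and Lipschitz bounds for the Riccati operators -/

theorem stepAverage_sub_continuous {X : Type*} [NormedAddCommGroup X] [NormedSpace ℝ X]
    {f : ℝ → ℝ → X} (hf : Continuous fun p : ℝ × ℝ => f p.1 p.2) :
    Continuous fun p : ℝ × NNReal => stepAverage f (p.1 - p.2) p.2 :=
  (stepAverage_continuous hf).comp (f := fun p : ℝ × NNReal => (p.1 - (p.2 : ℝ), (p.2 : ℝ)))
    (by fun_prop)

theorem data_γ_continuous : Continuous fun p : ℝ × NNReal => (S.data p.1 p.2).γ :=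
  stepAverage_sub_continuous (f := S.γIntegrand) S.γIntegrand_continuous

theorem data_g_continuous : Continuous fun p : ℝ × NNReal => (S.data p.1 p.2).g :=
  stepAverage_sub_continuous (f := S.gIntegrand) S.gIntegrand_continuous

theorem data_μ_continuous : Continuous fun p : ℝ × NNReal => (S.data p.1 p.2).μ :=
  stepAverage_sub_continuous (f := S.μIntegrand) S.μIntegrand_continuous

theorem data_ν_continuous : Continuous fun p : ℝ × NNReal => (S.data p.1 p.2).ν :=
  stepAverage_sub_continuous (f := S.νIntegrand) S.νIntegrand_continuous

theorem data_β_continuous : Continuous fun p : ℝ × NNReal => (S.data p.1 p.2).β :=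
  (S.Φ_continuous.comp (f := fun p : ℝ × NNReal => (p.1, p.1 - (p.2 : ℝ)))
    (by fun_prop)).matrix_mul (stepAverage_sub_continuous
      (f := fun s ξ => S.Φ s ξ * S.B ξ) S.continuous_Φ_mul_B)

theorem crossTerm_continuous : Continuous fun q : (ℝ × NNReal) × Matrix (Fin n) (Fin n) ℝ =>
    (S.data q.1.1 q.1.2).crossTerm q.2 := by
  have h1 := S.data_γ_continuous.comp
    (continuous_fst (X := ℝ × NNReal) (Y := Matrix (Fin n) (Fin n) ℝ))
  have h2 := S.data_β_continuous.comp
    (continuous_fst (X := ℝ × NNReal) (Y := Matrix (Fin n) (Fin n) ℝ))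
  have h3 := S.data_μ_continuous.comp
    (continuous_fst (X := ℝ × NNReal) (Y := Matrix (Fin n) (Fin n) ℝ))
  have h0 : Continuous fun q : (ℝ × NNReal) × Matrix (Fin n) (Fin n) ℝ => (q.1.2 : ℝ) := by fun_prop
  exact (((continuous_const.add (h0.smul h1)).matrix_transpose.matrix_mul
    continuous_snd).matrix_mul h2).add h3

theorem controlTerm_continuous : Continuous fun q : (ℝ × NNReal) × Matrix (Fin n) (Fin n) ℝ =>
    (S.data q.1.1 q.1.2).controlTerm q.2 := by
  have h2 := S.data_β_continuous.comp
    (continuous_fst (X := ℝ × NNReal) (Y := Matrix (Fin n) (Fin n) ℝ))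
  have h3 := S.data_ν_continuous.comp
    (continuous_fst (X := ℝ × NNReal) (Y := Matrix (Fin n) (Fin n) ℝ))
  have h0 : Continuous fun q : (ℝ × NNReal) × Matrix (Fin n) (Fin n) ℝ => (q.1.2 : ℝ) := by fun_prop
  exact h3.add (h0.smul ((h2.matrix_transpose.matrix_mul continuous_snd).matrix_mul h2))

theorem stateTerm_continuous : Continuous fun q : (ℝ × NNReal) × Matrix (Fin n) (Fin n) ℝ =>
    (S.data q.1.1 q.1.2).stateTerm q.2 := by
  have h1 := S.data_γ_continuous.comp
    (continuous_fst (X := ℝ × NNReal) (Y := Matrix (Fin n) (Fin n) ℝ))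
  have h2 := S.data_g_continuous.comp
    (continuous_fst (X := ℝ × NNReal) (Y := Matrix (Fin n) (Fin n) ℝ))
  have h0 : Continuous fun q : (ℝ × NNReal) × Matrix (Fin n) (Fin n) ℝ => (q.1.2 : ℝ) := by fun_prop
  have h4 := h1.matrix_transpose.matrix_mul
    (continuous_snd (X := ℝ × NNReal) (Y := Matrix (Fin n) (Fin n) ℝ))
  exact h2.add ((h4.add (continuous_snd.matrix_mul h1)).add (h0.smul (h4.matrix_mul h1)))

/-- Semidefiniteness of `E` makes the control term invertible, and inversion is continuous at
invertible matrices. -/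
theorem gain_continuousOn : ContinuousOn
    (fun q : (ℝ × NNReal) × Matrix (Fin n) (Fin n) ℝ => (S.data q.1.1 q.1.2).gain q.2)
    {q | q.2.PosSemidef} := by
  intro q hq
  refine ContinuousAt.continuousWithinAt ?_
  have h1 : ContinuousAt (fun q : (ℝ × NNReal) × Matrix (Fin n) (Fin n) ℝ =>
      ((S.data q.1.1 q.1.2).controlTerm q.2)⁻¹) q :=
    ContinuousAt.comp (f := fun q : (ℝ × NNReal) × Matrix (Fin n) (Fin n) ℝ =>
      (S.data q.1.1 q.1.2).controlTerm q.2)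
      (continuousAt_matrix_inv_of_isUnit ((S.data q.1.1 q.1.2).isUnit_controlTerm hq))
      S.controlTerm_continuous.continuousAt
  have h2 := (S.crossTerm_continuous.matrix_transpose).continuousAt (x := q)
  have h3 : Continuous fun p : Matrix (Fin m) (Fin m) ℝ × Matrix (Fin m) (Fin n) ℝ =>
      -(p.1 * p.2) := (continuous_fst.matrix_mul continuous_snd).neg
  exact h3.continuousAt.comp (h1.prodMk h2)

/-- Joint continuity down to `h = 0` serves twice: for the consistency of the scheme, and for the
persistence of strict inequalities under small sampling periods. -/
theorem ricc_continuousOn : ContinuousOn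
    (fun q : (ℝ × NNReal) × Matrix (Fin n) (Fin n) ℝ => (S.data q.1.1 q.1.2).ricc q.2)
    {q | q.2.PosSemidef} := by
  have h3 : Continuous fun p : Matrix (Fin n) (Fin m) ℝ × Matrix (Fin m) (Fin n) ℝ =>
      -(p.1 * p.2) := (continuous_fst.matrix_mul continuous_snd).neg
  refine ContinuousOn.congr ((h3.comp_continuousOn
    (S.crossTerm_continuous.continuousOn.prodMk S.gain_continuousOn)).sub
    S.stateTerm_continuous.continuousOn) fun q _ => ?_
  change (S.data q.1.1 q.1.2).ricc q.2 = -((S.data q.1.1 q.1.2).crossTerm q.2 *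
    (S.data q.1.1 q.1.2).gain q.2) - (S.data q.1.1 q.1.2).stateTerm q.2
  rw [RiccatiData.crossTerm_mul_gain]
  abel

theorem ricc_continuousOn_right (t : ℝ) (h : NNReal) :
    ContinuousOn (fun E => (S.data t h).ricc E) {E | E.PosSemidef} :=
  S.ricc_continuousOn.comp (f := fun E => ((t, h), E)) (by fun_prop) fun _ hE => hE

theorem closedLoop_continuousOn : ContinuousOn
    (fun q : (ℝ × NNReal) × Matrix (Fin n) (Fin n) ℝ => (S.data q.1.1 q.1.2).closedLoop q.2)
    {q | q.2.PosSemidef} := by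
  have h1 := S.data_γ_continuous.comp
    (continuous_fst (X := ℝ × NNReal) (Y := Matrix (Fin n) (Fin n) ℝ))
  have h2 := S.data_β_continuous.comp
    (continuous_fst (X := ℝ × NNReal) (Y := Matrix (Fin n) (Fin n) ℝ))
  have h3 : Continuous fun p : Matrix (Fin n) (Fin m) ℝ × Matrix (Fin m) (Fin n) ℝ => p.1 * p.2 :=
    continuous_fst.matrix_mul continuous_snd
  exact h1.continuousOn.add
    (h3.comp_continuousOn (h2.continuousOn.prodMk S.gain_continuousOn))

/-- By `ricc_sub_ricc` a bound on the closed loops suffices; they are continuous on the compact set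
of admissible `(t, h, E)`. Uniformity in `h` gives stability of the scheme. -/
theorem exists_norm_ricc_sub_le (T ρ : ℝ) (H : NNReal) : ∃ L : ℝ, 0 ≤ L ∧
    ∀ t ∈ Icc 0 T, ∀ h ≤ H, ∀ E E' : Matrix (Fin n) (Fin n) ℝ, E.PosSemidef → E'.PosSemidef →
      ‖E‖ ≤ ρ → ‖E'‖ ≤ ρ →
      ‖(S.data t h).ricc E - (S.data t h).ricc E'‖ ≤ L * ‖E - E'‖ := by
  have hK : IsCompact ((Icc 0 T ×ˢ Icc 0 H) ×ˢ
      (Metric.closedBall (0 : Matrix (Fin n) (Fin n) ℝ) ρ ∩ {E | E.PosSemidef})) :=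
    (isCompact_Icc.prod isCompact_Icc).prod
      ((isCompact_closedBall _ _).inter_right isClosed_posSemidef)
  obtain ⟨C, hC⟩ := hK.exists_bound_of_continuousOn
    (S.closedLoop_continuousOn.mono fun q hq => hq.2.2)
  refine ⟨|C| + |C| + H * (|C| * |C|), by positivity, fun t ht h hh E E' hE hE' hn hn' => ?_⟩
  have hb : ∀ X : Matrix (Fin n) (Fin n) ℝ, X.PosSemidef → ‖X‖ ≤ ρ →
      ‖(S.data t h).closedLoop X‖ ≤ |C| := fun X hX hXn =>
    (hC ((t, h), X) ⟨⟨ht, h.coe_nonneg, hh⟩, by simpa using hXn, hX⟩).trans (le_abs_self C)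
  have h1 := hb E hE hn
  have h2 := hb E' hE' hn'
  -- Transposition preserves the operator norm, so the bound also holds for the transposed closed
  -- loop on the left.
  rw [← Matrix.l2_opNorm_conjTranspose, Matrix.conjTranspose_eq_transpose_of_trivial] at h1
  rw [RiccatiData.ricc_sub_ricc _ hE hE', norm_neg]
  refine (norm_add₃_le).trans ?_
  rw [norm_smul, data_h, add_mul, add_mul]
  rw [Real.norm_of_nonneg h.coe_nonneg, mul_assoc (H : ℝ)]
  refine add_le_add (add_le_add ?_ ?_) (mul_le_mul hh ?_ (norm_nonneg _) H.coe_nonneg)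
  · exact (norm_mul_le _ _).trans (by gcongr)
  · exact (norm_mul_le _ _).trans (by rw [mul_comm]; gcongr)
  · calc _ ≤ _ := norm_mul₃_le
      _ ≤ |C| * ‖E - E'‖ * |C| := by gcongr
      _ = _ := by ring

/-! ### Uniqueness of solutions and convergence of the sampled-data scheme -/

variable {S} {P : Matrix (Fin n) (Fin n) ℝ} {T : ℝ}

theorem F_zero_eq_ricc (t : ℝ) (E : Matrix (Fin n) (Fin n) ℝ) :
    S.F t E 0 = (S.data t 0).ricc E := by
  rw [← F_eq_ricc, NNReal.coe_zero]

theorem IsPDRE.continuousOn {E : ℝ → Matrix (Fin n) (Fin n) ℝ} (h : S.IsPDRE P T E) :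
    ContinuousOn E (Icc 0 T) := fun t ht => (h.2.1 t ht).continuousWithinAt

/-- Both solutions stay in a bounded set of semidefinite matrices, where the right-hand side is
Lipschitz; Grönwall is applied backward from `T`. -/
theorem IsPDRE.eqOn {E E' : ℝ → Matrix (Fin n) (Fin n) ℝ} (h : S.IsPDRE P T E)
    (h' : S.IsPDRE P T E') : EqOn E E' (Icc 0 T) := by
  obtain ⟨ρ, hρ⟩ := isCompact_Icc.exists_bound_of_continuousOn h.continuousOn
  obtain ⟨ρ', hρ'⟩ := isCompact_Icc.exists_bound_of_continuousOn h'.continuousOn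
  obtain ⟨L, hL0, hL⟩ := S.exists_norm_ricc_sub_le T (max ρ ρ') 0
  refine ODE_solution_unique_of_mem_Icc_left (v := fun t E => S.F t E 0) (K := L.toNNReal)
    (s := fun _ => {E | E.PosSemidef ∧ ‖E‖ ≤ max ρ ρ'}) (fun t ht => ?_)
    h.continuousOn (fun t ht => ?_)
    (fun t ht => ⟨h.1 t (Ioc_subset_Icc_self ht),
      (hρ t (Ioc_subset_Icc_self ht)).trans (le_max_left _ _)⟩)
    h'.continuousOn (fun t ht => ?_)
    (fun t ht => ⟨h'.1 t (Ioc_subset_Icc_self ht),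
      (hρ' t (Ioc_subset_Icc_self ht)).trans (le_max_right _ _)⟩) (h.2.2.trans h'.2.2.symm)
  · refine LipschitzOnWith.of_dist_le_mul fun X hX Y hY => ?_
    rw [dist_eq_norm, dist_eq_norm, F_zero_eq_ricc, F_zero_eq_ricc, Real.coe_toNNReal L hL0]
    exact hL t (Ioc_subset_Icc_self ht) 0 le_rfl X Y hX.1 hY.1 hX.2 hY.2
  · exact (h.2.1 t (Ioc_subset_Icc_self ht)).mono_of_mem_nhdsWithin (Icc_mem_nhdsLE_of_mem ht)
  · exact (h'.2.1 t (Ioc_subset_Icc_self ht)).mono_of_mem_nhdsWithin (Icc_mem_nhdsLE_of_mem ht)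

end LQSystem

/-! ### Elementary bounds for time partitions -/

namespace TimePartition

variable {T : ℝ} (Δ : TimePartition T)

theorem t_mono {i j : ℕ} (hij : i ≤ j) (hj : j ≤ Δ.N) : Δ.t i ≤ Δ.t j := by
  induction j, hij using Nat.le_induction with
  | base => exact le_rfl
  | succ j _ ih => exact (ih (by lia)).trans (Δ.t_lt j (by lia)).le

theorem t_mem {i : ℕ} (hi : i ≤ Δ.N) : Δ.t i ∈ Icc 0 T :=
  ⟨Δ.t_zero.symm.le.trans (Δ.t_mono (Nat.zero_le i) hi),
    (Δ.t_mono hi le_rfl).trans Δ.t_last.le⟩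

theorem step_pos {i : ℕ} (hi : i < Δ.N) : 0 < Δ.step i := sub_pos.2 (Δ.t_lt i hi)

theorem step_le_mesh {i : ℕ} (hi : i < Δ.N) : Δ.step i ≤ Δ.mesh :=
  Finset.le_sup' Δ.step (Finset.mem_range.2 hi)

theorem step_le {i : ℕ} (hi : i < Δ.N) : Δ.step i ≤ T := by
  have h1 := (Δ.t_mem hi.le).1
  have h2 := (Δ.t_mem hi).2
  rw [step]; linarith

end TimePartition

/-! ### The sampled-data recursion, its truncation error and its convergence -/

namespace LQSystem

variable {n m : ℕ} {S : LQSystem n m} {P : Matrix (Fin n) (Fin n) ℝ} {T : ℝ}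

/-- Backward recursion. -/
def sddreSol (S : LQSystem n m) (P : Matrix (Fin n) (Fin n) ℝ) (Δ : TimePartition T) :
    ℕ → Matrix (Fin n) (Fin n) ℝ
  | 0 => P
  | j + 1 => (S.data (Δ.t (Δ.N - j)) (Δ.step (Δ.N - (j + 1))).toNNReal).step (sddreSol S P Δ j)

theorem sddreSol_posSemidef (hP : P.PosSemidef) (Δ : TimePartition T) (j : ℕ) :
    (sddreSol S P Δ j).PosSemidef := by
  induction j with
  | zero => exact hP
  | succ j ih => exact RiccatiData.step_posSemidef _ ih

theorem IsSDDRE.eq_step {Δ : TimePartition T} {E : ℕ → Matrix (Fin n) (Fin n) ℝ}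
    (h : S.IsSDDRE P Δ E) {i : ℕ} (hi : i < Δ.N) :
    E i = (S.data (Δ.t (i + 1)) (Δ.step i).toNNReal).step (E (i + 1)) := by
  rw [RiccatiData.step, ← F_eq_ricc, data_h, Real.coe_toNNReal _ (Δ.step_pos hi).le, ← h.2.1 i hi]
  abel

theorem IsSDDRE.eq_sddreSol {Δ : TimePartition T} {E : ℕ → Matrix (Fin n) (Fin n) ℝ}
    (h : S.IsSDDRE P Δ E) (j : ℕ) (hj : j ≤ Δ.N) : E (Δ.N - j) = sddreSol S P Δ j := by
  induction j with
  | zero => exact h.2.2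
  | succ j ih =>
    rw [h.eq_step (by lia), show Δ.N - (j + 1) + 1 = Δ.N - j by lia, ih (by lia)]
    rfl

theorem isSDDRE_sddreSol (hP : P.PosSemidef) (Δ : TimePartition T) :
    S.IsSDDRE P Δ fun i => sddreSol S P Δ (Δ.N - i) := by
  refine ⟨fun i _ => sddreSol_posSemidef hP Δ _, fun i hi => ?_, by simp [sddreSol]⟩
  have h1 : Δ.N - i = Δ.N - (i + 1) + 1 := by lia
  beta_reduce
  rw [h1, sddreSol, ← h1, show Δ.N - (Δ.N - i) = i by lia,
    show Δ.N - (Δ.N - (i + 1)) = i + 1 by lia, RiccatiData.step, data_h, ← F_eq_ricc,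
    Real.coe_toNNReal _ (Δ.step_pos hi).le]
  abel

theorem IsSDDRE.eq {Δ : TimePartition T} {E E' : ℕ → Matrix (Fin n) (Fin n) ℝ}
    (h : S.IsSDDRE P Δ E) (h' : S.IsSDDRE P Δ E') (i : ℕ) (hi : i ≤ Δ.N) : E i = E' i := by
  have h1 := h.eq_sddreSol (Δ.N - i) (by lia)
  have h2 := h'.eq_sddreSol (Δ.N - i) (by lia)
  rw [show Δ.N - (Δ.N - i) = i by lia] at h1 h2
  rw [h1, h2]

/-- The local truncation error of the sampled-data scheme. -/
theorem IsPDRE.exists_norm_truncation_le (hT : 0 ≤ T) {E : ℝ → Matrix (Fin n) (Fin n) ℝ}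
    (hE : S.IsPDRE P T E) {η : ℝ} (hη : 0 < η) :
    ∃ δ > 0, ∀ s ∈ Icc 0 T, ∀ h : NNReal, (h : ℝ) < δ → s + h ∈ Icc 0 T →
      ‖E s - (S.data (s + h) h).step (E (s + h))‖ ≤ h * η := by
  have hK : IsCompact (Icc 0 T ×ˢ Icc 0 T.toNNReal) := isCompact_Icc.prod isCompact_Icc
  have hφ : ContinuousOn (fun p : ℝ × NNReal => (S.data p.1 p.2).ricc (E p.1))
      (Icc 0 T ×ˢ Icc 0 T.toNNReal) :=
    S.ricc_continuousOn.comp (f := fun p : ℝ × NNReal => (p, E p.1))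
      (continuousOn_id.prodMk (hE.continuousOn.comp continuousOn_fst fun p hp => hp.1))
      fun p hp => hE.1 _ hp.1
  obtain ⟨δ, hδ, hunif⟩ := Metric.uniformContinuousOn_iff.1
    (hK.uniformContinuousOn_of_continuous hφ) η hη
  refine ⟨δ, hδ, fun s hs h hh hsh => ?_⟩
  set c := (S.data (s + h) h).ricc (E (s + h)) with hc
  have hsub : Icc s (s + h) ⊆ Icc 0 T := Icc_subset_Icc hs.1 hsh.2
  have hle : s ≤ s + h := by linarith [h.2]
  -- After subtraction of the line of slope `c`, the derivative compares the operator at `(τ, 0)`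
  -- with that at `(s + h, h)`. Uniform continuity makes it at most `η`, and the mean value
  -- inequality concludes.
  have hder : ∀ τ ∈ Icc s (s + h), HasDerivWithinAt (fun τ => E τ - τ • c)
      (S.F τ (E τ) 0 - c) (Icc s (s + h)) τ := fun τ hτ => by
    have h1 := (hE.2.1 τ (hsub hτ)).mono hsub
    have h2 := ((hasDerivWithinAt_id τ (Icc s (s + h))).smul_const c)
    rw [one_smul] at h2
    exact h1.sub h2
  have hbound : ∀ τ ∈ Icc s (s + h), ‖S.F τ (E τ) 0 - c‖ ≤ η := fun τ hτ => by
    rw [F_zero_eq_ricc, ← dist_eq_norm]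
    refine (hunif (τ, 0) ⟨hsub hτ, by simp⟩ (s + h, h) ⟨hsh, h.coe_nonneg, ?_⟩ ?_).le
    · rw [← NNReal.coe_le_coe, Real.coe_toNNReal T hT]
      linarith [hs.1, hsh.2]
    · rw [Prod.dist_eq, max_lt_iff]
      constructor
      · rw [Real.dist_eq, abs_lt]
        constructor <;> linarith [hτ.1, hτ.2]
      · rw [NNReal.dist_eq]
        simpa using hh
  have key := Convex.norm_image_sub_le_of_norm_hasDerivWithin_le hder hbound (convex_Icc _ _)
    (right_mem_Icc.2 hle) (left_mem_Icc.2 hle)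
  have e1 : E s - (S.data (s + h) h).step (E (s + h)) = E s - s • c - (E (s + h) - (s + h) • c) := by
    rw [RiccatiData.step, ← hc, data_h, add_smul]
    abel
  rw [e1]
  refine key.trans (le_of_eq ?_)
  rw [Real.norm_eq_abs, sub_add_cancel_left, abs_neg, abs_of_nonneg h.coe_nonneg]
  ring

/-- Consistency and stability imply convergence. The Lipschitz bound is only local, so the backward
induction must also keep the discrete solution near the exact one. -/
theorem IsPDRE.exists_norm_sub_lt (hT : 0 < T) {E : ℝ → Matrix (Fin n) (Fin n) ℝ}
    (hE : S.IsPDRE P T E) {ε : ℝ} (hε : 0 < ε) :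
    ∃ δ > 0, ∀ Δ : TimePartition T, Δ.mesh < δ → ∀ EΔ, S.IsSDDRE P Δ EΔ →
      ∀ i ≤ Δ.N, ‖E (Δ.t i) - EΔ i‖ < ε := by
  obtain ⟨ρ, hρ⟩ := isCompact_Icc.exists_bound_of_continuousOn hE.continuousOn
  -- Radius `ρ + 1` leaves room for an error of size `1` around the exact solution.
  obtain ⟨L, hL0, hL⟩ := S.exists_norm_ricc_sub_le T (ρ + 1) T.toNNReal
  set C := T * Real.exp (L * T) with hC
  have hC0 : 0 < C := by positivity
  -- The accumulated error is at most `η C`. Staying below `ε` is the claim; staying below `1` keeps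
  -- the discrete solution in the ball of radius `ρ + 1`.
  set η := min ε 1 / (2 * C) with hη
  have hη0 : 0 < η := by positivity
  have hηC : η * C < min ε 1 := by
    have : 0 < min ε 1 := by positivity
    rw [hη]
    field_simp
    linarith
  obtain ⟨δ, hδ, htr⟩ := hE.exists_norm_truncation_le hT.le hη0
  refine ⟨δ, hδ, fun Δ hΔ EΔ hEΔ => ?_⟩
  have hsmall : ∀ i ≤ Δ.N, η * ((T - Δ.t i) * Real.exp (L * (T - Δ.t i))) < min ε 1 := by
    intro i hi
    refine lt_of_le_of_lt ?_ hηC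
    have := Δ.t_mem hi
    rw [hC]
    gcongr <;> linarith [this.1, this.2]
  have main : ∀ j i, i + j = Δ.N →
      ‖E (Δ.t i) - EΔ i‖ ≤ η * ((T - Δ.t i) * Real.exp (L * (T - Δ.t i))) := by
    intro j
    induction j with
    | zero =>
      rintro i hi
      rw [add_zero] at hi
      rw [hi, hEΔ.2.2, Δ.t_last, hE.2.2]
      simp
    | succ j ih =>
      intro i hi
      have hi' : i < Δ.N := by lia
      have hprev := ih (i + 1) (by lia)
      have hsm := hsmall (i + 1) (by lia)
      set h : NNReal := (Δ.step i).toNNReal with hh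
      have hcoe : (h : ℝ) = Δ.step i := Real.coe_toNNReal _ (Δ.step_pos hi').le
      have ht : Δ.t (i + 1) = Δ.t i + h := by rw [hcoe, TimePartition.step]; ring
      have hmem := Δ.t_mem (i := i + 1) (by lia)
      have hEn : ‖E (Δ.t (i + 1))‖ ≤ ρ + 1 := (hρ _ hmem).trans (by linarith)
      have hEΔn : ‖EΔ (i + 1)‖ ≤ ρ + 1 := by
        have h1 : ‖E (Δ.t (i + 1)) - EΔ (i + 1)‖ ≤ 1 :=
          hprev.trans (hsm.le.trans (min_le_right _ _))
        have h2 := norm_sub_norm_le (EΔ (i + 1)) (E (Δ.t (i + 1)))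
        rw [norm_sub_rev] at h2
        linarith [hρ _ hmem]
      have hlip := hL _ hmem h (by
        rw [hh]; exact Real.toNNReal_le_toNNReal (Δ.step_le hi')) _ _ (hE.1 _ hmem)
        (hEΔ.1 (i + 1) (by lia)) hEn hEΔn
      have htrunc := htr (Δ.t i) (Δ.t_mem (by lia)) h
        (by rw [hcoe]; exact (Δ.step_le_mesh hi').trans_lt hΔ) (ht ▸ hmem)
      rw [← ht] at htrunc
      rw [hEΔ.eq_step hi', ← hh]
      set D := S.data (Δ.t (i + 1)) h with hD
      set e := ‖E (Δ.t (i + 1)) - EΔ (i + 1)‖ with he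
      have hstep : ‖D.step (E (Δ.t (i + 1))) - D.step (EΔ (i + 1))‖ ≤ e + h * (L * e) := by
        have e1 : D.step (E (Δ.t (i + 1))) - D.step (EΔ (i + 1)) =
            (E (Δ.t (i + 1)) - EΔ (i + 1)) -
              (h : ℝ) • (D.ricc (E (Δ.t (i + 1))) - D.ricc (EΔ (i + 1))) := by
          simp only [RiccatiData.step, smul_sub, hD, data_h]
          abel
        rw [e1]
        refine (norm_sub_le _ _).trans ?_
        rw [norm_smul, Real.norm_of_nonneg h.coe_nonneg]
        gcongr
      have htri : ‖E (Δ.t i) - D.step (EΔ (i + 1))‖ ≤ h * η + (e + h * (L * e)) := by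
        rw [← sub_add_sub_cancel (E (Δ.t i)) (D.step (E (Δ.t (i + 1))))]
        exact (norm_add_le _ _).trans (add_le_add htrunc hstep)
      refine htri.trans ?_
      set τ := T - Δ.t (i + 1) with hτ
      have hτ0 : 0 ≤ τ := by rw [hτ]; linarith [hmem.2]
      have e2 : T - Δ.t i = τ + h := by rw [hτ, ht]; ring
      rw [e2]
      -- Discrete Grönwall: the old error is amplified by at most `exp (L h)`, and the new
      -- truncation error `h η` is enlarged by an exponential factor so that the two terms add up to
      -- the bound at `τ + h`.
      have hexp1 : 1 + L * h ≤ Real.exp (L * h) := by linarith [Real.add_one_le_exp (L * (h : ℝ))]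
      have hexp2 : 1 ≤ Real.exp (L * (τ + h)) := Real.one_le_exp (by positivity)
      have hh0 : (0 : ℝ) ≤ h := h.2
      calc (h : ℝ) * η + (e + h * (L * e)) = (1 + L * h) * e + h * η := by ring
        _ ≤ Real.exp (L * h) * (η * (τ * Real.exp (L * τ))) +
            h * η * Real.exp (L * (τ + h)) := by
          refine add_le_add (mul_le_mul hexp1 hprev (norm_nonneg _) (Real.exp_pos _).le) ?_
          exact le_mul_of_one_le_right (by positivity) hexp2
        _ = _ := by
          rw [mul_add L, Real.exp_add]
          ring
  intro i hi
  exact (main (Δ.N - i) i (by lia)).trans_lt ((hsmall i hi).trans_le (min_le_left _ _))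

end LQSystem

/-! ### Existence for the differential Riccati equation -/

section HamiltonianSystem

variable {n : ℕ}

/-- Projection to the first half of the coordinates. -/
def fstProj (n : ℕ) : Matrix (Fin n) (Fin (n + n)) ℝ :=
  (1 : Matrix (Fin (n + n)) (Fin (n + n)) ℝ).submatrix (Fin.castAdd n) id

/-- Projection to the second half of the coordinates. -/
def sndProj (n : ℕ) : Matrix (Fin n) (Fin (n + n)) ℝ :=
  (1 : Matrix (Fin (n + n)) (Fin (n + n)) ℝ).submatrix (Fin.natAdd n) id

theorem fstProj_mul_transpose : fstProj n * (fstProj n)ᵀ = 1 := by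
  ext i j
  simp [fstProj, Matrix.mul_apply, Matrix.one_apply, eq_comm]

theorem sndProj_mul_transpose : sndProj n * (sndProj n)ᵀ = 1 := by
  ext i j
  simp [sndProj, Matrix.mul_apply, Matrix.one_apply, eq_comm]

theorem fstProj_mul_sndProj_transpose : fstProj n * (sndProj n)ᵀ = 0 := by
  ext i j
  simp only [fstProj, sndProj, Matrix.mul_apply, Matrix.one_apply, Matrix.submatrix_apply,
    Matrix.transpose_apply, id, Matrix.zero_apply]
  refine Finset.sum_eq_zero fun k _ => ?_
  rcases eq_or_ne (Fin.castAdd n i) k with rfl | h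
  · have : Fin.natAdd n j ≠ Fin.castAdd n i := fun h => by
      have := congrArg Fin.val h
      simp at this
      lia
    rw [if_neg this, mul_zero]
  · simp [h]

theorem sndProj_mul_fstProj_transpose : sndProj n * (fstProj n)ᵀ = 0 := by
  rw [← Matrix.transpose_transpose (sndProj n), ← Matrix.transpose_mul,
    fstProj_mul_sndProj_transpose, Matrix.transpose_zero]

/-- Solutions of linear Hamiltonian systems with prescribed final value. -/
theorem exists_hamiltonian_solution {A V Q : ℝ → Matrix (Fin n) (Fin n) ℝ} (hA : Continuous A)
    (hV : Continuous V) (hQ : Continuous Q) (P : Matrix (Fin n) (Fin n) ℝ) (T : ℝ) :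
    ∃ X Y : ℝ → Matrix (Fin n) (Fin n) ℝ, X T = 1 ∧ Y T = P ∧
      (∀ t, HasDerivAt X (A t * X t - V t * Y t) t) ∧
      ∀ t, HasDerivAt Y (-(Q t * X t) - (A t)ᵀ * Y t) t := by
  -- The block matrix with rows `(A, -V)` and `(-Q, -Aᵀ)`, written on `Fin (n + n)` so that its
  -- state-transition matrix is available.
  set H : ℝ → Matrix (Fin (n + n)) (Fin (n + n)) ℝ := fun t =>
    (fstProj n)ᵀ * (A t * fstProj n - V t * sndProj n) -
      (sndProj n)ᵀ * (Q t * fstProj n + (A t)ᵀ * sndProj n) with hH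
  have hHc : Continuous H :=
    (continuous_const.matrix_mul ((hA.matrix_mul continuous_const).sub
      (hV.matrix_mul continuous_const))).sub
      (continuous_const.matrix_mul ((hQ.matrix_mul continuous_const).add
        (hA.matrix_transpose.matrix_mul continuous_const)))
  set C : Matrix (Fin (n + n)) (Fin n) ℝ := (fstProj n)ᵀ + (sndProj n)ᵀ * P with hC
  have hder (L : Matrix (Fin n) (Fin (n + n)) ℝ) (t : ℝ) :
      HasDerivAt (fun t => L * (stateTransition H t T * C))
        (L * (H t * stateTransition H t T * C)) t := by
    have h1 := (stateTransition_hasDerivAt hHc T t).matrix_mul (hasDerivAt_const t C)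
    have h2 := (hasDerivAt_const t L).matrix_mul h1
    simpa using h2
  refine ⟨fun t => fstProj n * (stateTransition H t T * C),
    fun t => sndProj n * (stateTransition H t T * C), ?_, ?_, fun t => ?_, fun t => ?_⟩
  · simp only [stateTransition_self hHc, Matrix.one_mul, hC, Matrix.mul_add, ← Matrix.mul_assoc,
      fstProj_mul_transpose, fstProj_mul_sndProj_transpose, Matrix.zero_mul, add_zero]
  · simp only [stateTransition_self hHc, Matrix.one_mul, hC, Matrix.mul_add, ← Matrix.mul_assoc,
      sndProj_mul_transpose, sndProj_mul_fstProj_transpose, zero_add]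
  · refine (hder _ t).congr_deriv ?_
    have : fstProj n * H t = A t * fstProj n - V t * sndProj n := by
      simp only [hH, Matrix.mul_sub (fstProj n), ← Matrix.mul_assoc (fstProj n),
        fstProj_mul_transpose, fstProj_mul_sndProj_transpose, Matrix.zero_mul, sub_zero,
        Matrix.one_mul]
    rw [Matrix.mul_assoc (H t), ← Matrix.mul_assoc (fstProj n), this, Matrix.sub_mul,
      Matrix.mul_assoc, Matrix.mul_assoc]
  · refine (hder _ t).congr_deriv ?_
    have : sndProj n * H t = -(Q t * fstProj n) - (A t)ᵀ * sndProj n := by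
      simp only [hH, Matrix.mul_sub (sndProj n), ← Matrix.mul_assoc (sndProj n),
        sndProj_mul_transpose, sndProj_mul_fstProj_transpose, Matrix.zero_mul, zero_sub,
        Matrix.one_mul, neg_add']
    rw [Matrix.mul_assoc (H t), ← Matrix.mul_assoc (sndProj n), this, Matrix.sub_mul,
      Matrix.neg_mul, Matrix.mul_assoc, Matrix.mul_assoc]

variable {A V Q X Y : ℝ → Matrix (Fin n) (Fin n) ℝ} {P : Matrix (Fin n) (Fin n) ℝ} {T : ℝ}

theorem hamiltonian_transpose_mul_hasDerivAt (hV : ∀ t, (V t).PosSemidef)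
    (hX : ∀ t, HasDerivAt X (A t * X t - V t * Y t) t)
    (hY : ∀ t, HasDerivAt Y (-(Q t * X t) - (A t)ᵀ * Y t) t) (t : ℝ) :
    HasDerivAt (fun t => (X t)ᵀ * Y t) (-((Y t)ᵀ * V t * Y t + (X t)ᵀ * Q t * X t)) t := by
  refine ((hX t).matrix_transpose.matrix_mul (hY t)).congr_deriv ?_
  simp only [Matrix.transpose_sub, Matrix.transpose_mul, (hV t).transpose_eq, Matrix.sub_mul,
    Matrix.mul_sub, Matrix.mul_neg, Matrix.mul_assoc]
  abel

theorem dotProduct_conj_mulVec {a b : ℕ} (M : Matrix (Fin a) (Fin a) ℝ)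
    (N : Matrix (Fin a) (Fin b) ℝ) (v : Fin b → ℝ) :
    v ⬝ᵥ (Nᵀ * M * N) *ᵥ v = (N *ᵥ v) ⬝ᵥ M *ᵥ (N *ᵥ v) := by
  rw [Matrix.mul_assoc, ← Matrix.mulVec_mulVec, Matrix.dotProduct_mulVec, Matrix.vecMul_transpose,
    Matrix.mulVec_mulVec]

theorem hamiltonian_transpose_mul_antitone (hV : ∀ t, (V t).PosSemidef)
    (hQ : ∀ t, (Q t).PosSemidef) (hX : ∀ t, HasDerivAt X (A t * X t - V t * Y t) t)
    (hY : ∀ t, HasDerivAt Y (-(Q t * X t) - (A t)ᵀ * Y t) t) (v : Fin n → ℝ) :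
    Antitone fun t => v ⬝ᵥ ((X t)ᵀ * Y t) *ᵥ v := by
  have hd := fun t => (dotForm v v).hasFDerivAt.comp_hasDerivAt t
    (hamiltonian_transpose_mul_hasDerivAt hV hX hY t)
  refine antitone_of_hasDerivAt_nonpos hd fun t => ?_
  rw [Pi.zero_apply, dotForm_apply, Matrix.neg_mulVec, dotProduct_neg, Matrix.add_mulVec, dotProduct_add,
    dotProduct_conj_mulVec, dotProduct_conj_mulVec]
  linarith [(hV t).quad_nonneg (Y t *ᵥ v), (hQ t).quad_nonneg (X t *ᵥ v)]

/-- Symmetry holds at `T` and the antisymmetric part has zero derivative. The quadratic form is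
nonincreasing in time, hence at least its final value, which is nonnegative. -/
theorem hamiltonian_transpose_mul_posSemidef (hV : ∀ t, (V t).PosSemidef)
    (hQ : ∀ t, (Q t).PosSemidef) (hP : P.PosSemidef) (hXT : X T = 1) (hYT : Y T = P)
    (hX : ∀ t, HasDerivAt X (A t * X t - V t * Y t) t)
    (hY : ∀ t, HasDerivAt Y (-(Q t * X t) - (A t)ᵀ * Y t) t) {t : ℝ} (ht : t ≤ T) :
    ((X t)ᵀ * Y t).PosSemidef := by
  refine posSemidef_iff_quadForm.2 ⟨?_, fun v => ?_⟩
  · rw [← sub_eq_zero]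
    refine eq_zero_of_linear_ode (A := fun _ => 0) continuous_const (s := T)
      (f := fun t => ((X t)ᵀ * Y t)ᵀ - (X t)ᵀ * Y t) (fun τ => ?_) ?_ t
    · have h := hamiltonian_transpose_mul_hasDerivAt hV hX hY τ
      refine (h.matrix_transpose.fun_sub h).congr_deriv ?_
      simp [(hV τ).transpose_eq, (hQ τ).transpose_eq, Matrix.mul_assoc]
    · simp [hXT, hYT, hP.transpose_eq]
  · refine le_trans ?_ (hamiltonian_transpose_mul_antitone hV hQ hX hY v ht)
    simpa [hXT, hYT] using hP.quad_nonneg v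

/-- Suppose `X(t) v = 0`. The nonincreasing function `⟨Xᵀ Y v, v⟩` vanishes at `t` and is
nonnegative at `T`, so it is zero in between. Its derivative then forces `V Y v = 0`, so `X v`
solves `x' = A x` on `[t, T]` from the value `0`, and `v = X(T) v = 0`. -/
theorem hamiltonian_isUnit (hA : Continuous A) (hV : ∀ t, (V t).PosSemidef)
    (hQ : ∀ t, (Q t).PosSemidef) (hP : P.PosSemidef) (hXT : X T = 1) (hYT : Y T = P)
    (hX : ∀ t, HasDerivAt X (A t * X t - V t * Y t) t)
    (hY : ∀ t, HasDerivAt Y (-(Q t * X t) - (A t)ᵀ * Y t) t) {t : ℝ} (ht : t ≤ T) :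
    IsUnit (X t) := by
  rcases ht.eq_or_lt with rfl | htT
  · rw [hXT]; exact isUnit_one
  rw [Matrix.isUnit_iff_isUnit_det, isUnit_iff_ne_zero]
  intro hdet
  obtain ⟨v, hv0, hv⟩ := Matrix.exists_mulVec_eq_zero_iff.2 hdet
  refine hv0 ?_
  have hanti := hamiltonian_transpose_mul_antitone hV hQ hX hY v
  have hf0 : ∀ s ∈ Icc t T, v ⬝ᵥ ((X s)ᵀ * Y s) *ᵥ v = 0 := fun s hs => by
    have h1 : v ⬝ᵥ ((X t)ᵀ * Y t) *ᵥ v = 0 := by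
      rw [← Matrix.mulVec_mulVec, Matrix.dotProduct_mulVec, Matrix.vecMul_transpose, hv,
        zero_dotProduct]
    have h2 : 0 ≤ v ⬝ᵥ ((X T)ᵀ * Y T) *ᵥ v := by simpa [hXT, hYT] using hP.quad_nonneg v
    exact le_antisymm (h1 ▸ hanti hs.1) (h2.trans (hanti hs.2))
  have hVY : ∀ s ∈ Icc t T, V s *ᵥ (Y s *ᵥ v) = 0 := fun s hs => by
    have hd := ((dotForm v v).hasFDerivAt.comp_hasDerivAt s
      (hamiltonian_transpose_mul_hasDerivAt hV hX hY s)).hasDerivWithinAt (s := Icc t T)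
    have h0 : HasDerivWithinAt (fun _ => (0 : ℝ)) _ (Icc t T) s :=
      hd.congr (fun τ hτ => (hf0 τ hτ).symm) (hf0 s hs).symm
    have h1 := (uniqueDiffOn_Icc htT s hs).eq_deriv _ h0 (hasDerivWithinAt_const s _ (0 : ℝ))
    rw [dotForm_apply, Matrix.neg_mulVec, dotProduct_neg, Matrix.add_mulVec, dotProduct_add,
      dotProduct_conj_mulVec, dotProduct_conj_mulVec] at h1
    refine ((hV s).dotProduct_mulVec_zero_iff _).1 ?_
    rw [star_trivial]
    linarith [(hV s).quad_nonneg (Y s *ᵥ v), (hQ s).quad_nonneg (X s *ᵥ v)]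
  -- Variation of constants: transporting `X(s) v` back to time `t` leaves only the term `V Y v`,
  -- which was shown to vanish on `[t, T]`.
  have hw : ∀ s, HasDerivAt (fun s => (stateTransition A t s * X s) *ᵥ v)
      (-(stateTransition A t s *ᵥ (V s *ᵥ (Y s *ᵥ v)))) s := fun s => by
    refine (((stateTransition_hasDerivAt_right hA t s).matrix_mul (hX s)).matrix_mulVec_const
      v).congr_deriv ?_
    simp only [Matrix.mulVec_mulVec, ← Matrix.neg_mulVec]
    congr 1
    simp only [Matrix.neg_mul, Matrix.mul_sub, Matrix.mul_assoc]
    abel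
  have hconst := constant_of_has_deriv_right_zero (a := t) (b := T)
    (f := fun s => (stateTransition A t s * X s) *ᵥ v)
    (fun s _ => (hw s).continuousAt.continuousWithinAt) (fun s hs => by
      have := (hw s).hasDerivWithinAt (s := Ici s)
      rwa [hVY s (Ico_subset_Icc_self hs), Matrix.mulVec_zero, neg_zero] at this)
    T (right_mem_Icc.2 ht)
  simp only [hXT, Matrix.mul_one, stateTransition_self hA, Matrix.one_mul, hv] at hconst
  calc v = (stateTransition A T t * stateTransition A t T) *ᵥ v := by
        rw [stateTransition_mul_symm hA, Matrix.one_mulVec]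
    _ = 0 := by rw [← Matrix.mulVec_mulVec, hconst, Matrix.mulVec_zero]

end HamiltonianSystem

namespace LQSystem

variable {n m : ℕ} (S : LQSystem n m)

theorem F_zero (t : ℝ) (E : Matrix (Fin n) (Fin n) ℝ) :
    S.F t E 0 = E * (S.B t * (S.R t)⁻¹ * (S.B t)ᵀ) * Eᵀ - (S.Q t + ((S.A t)ᵀ * E + E * S.A t)) := by
  simp only [F, M, N, G, M₁, M₂, N₁, N₂, N₃, G₁, G₂, lt_irrefl, if_false, add_zero,
    Matrix.transpose_mul, Matrix.mul_assoc]

theorem control_weight_posSemidef (t : ℝ) : (S.B t * (S.R t)⁻¹ * (S.B t)ᵀ).PosSemidef := by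
  have := (S.posDef_R t).inv.posSemidef.mul_mul_conjTranspose_same (S.B t)
  rwa [Matrix.conjTranspose_eq_transpose_of_trivial] at this

theorem control_weight_continuous : Continuous fun t => S.B t * (S.R t)⁻¹ * (S.B t)ᵀ := by
  have h : Continuous fun t => (S.R t)⁻¹ := continuous_iff_continuousAt.2 fun t =>
    ContinuousAt.comp (f := S.R) (continuousAt_matrix_inv_of_isUnit (S.posDef_R t).isUnit)
      S.continuous_R.continuousAt
  exact (S.continuous_B.matrix_mul h).matrix_mul S.continuous_B.matrix_transpose

/-- The differential Riccati equation can be solved backward in time on `(-∞, T]`. -/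
theorem exists_riccati_solution {P : Matrix (Fin n) (Fin n) ℝ} (hP : P.PosSemidef) (T : ℝ) :
    ∃ E : ℝ → Matrix (Fin n) (Fin n) ℝ, E T = P ∧
      ∀ t ≤ T, (E t).PosSemidef ∧ HasDerivAt E (S.F t (E t) 0) t := by
  obtain ⟨X, Y, hXT, hYT, hX, hY⟩ := exists_hamiltonian_solution S.continuous_A
    S.control_weight_continuous S.continuous_Q P T
  have hV := S.control_weight_posSemidef
  have hQ := S.posSemidef_Q
  -- The matrix `Y X⁻¹` is congruent to `Xᵀ Y` through `X⁻¹`, hence semidefinite; differentiating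
  -- the quotient produces the quadratic term of the Riccati equation.
  refine ⟨fun t => Y t * (X t)⁻¹, by simp [hXT, hYT], fun t ht => ?_⟩
  have hu := hamiltonian_isUnit S.continuous_A hV hQ hP hXT hYT hX hY ht
  have hdet := (Matrix.isUnit_iff_isUnit_det _).1 hu
  have hpos : (Y t * (X t)⁻¹).PosSemidef := by
    have h1 := (hamiltonian_transpose_mul_posSemidef hV hQ hP hXT hYT hX hY
      ht).conjTranspose_mul_mul_same (X t)⁻¹
    rwa [Matrix.conjTranspose_eq_transpose_of_trivial, ← Matrix.mul_assoc, ← Matrix.transpose_mul,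
      Matrix.mul_nonsing_inv _ hdet, Matrix.transpose_one, Matrix.one_mul] at h1
  refine ⟨hpos, ((hY t).matrix_mul ((hX t).matrix_inv hu)).congr_deriv ?_⟩
  rw [F_zero, hpos.transpose_eq]
  simp only [Matrix.sub_mul, Matrix.neg_mul, Matrix.mul_sub, Matrix.mul_neg, Matrix.mul_assoc,
    Matrix.mul_nonsing_inv _ hdet, Matrix.mul_one]
  abel

theorem isPDRE_of_hasDerivAt {E : ℝ → Matrix (Fin n) (Fin n) ℝ} {T : ℝ}
    (hE : ∀ t ≤ T, (E t).PosSemidef ∧ HasDerivAt E (S.F t (E t) 0) t) :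
    S.IsPDRE (E T) T E :=
  ⟨fun t ht => (hE t ht.2).1, fun t ht => (hE t ht.2).2.hasDerivWithinAt, rfl⟩

end LQSystem

/-! ### Calculus along absolutely continuous trajectories -/

section AbsolutelyContinuous

variable {n : ℕ} {a b : ℝ}

theorem AbsolutelyContinuousOnInterval.apply {x : ℝ → Fin n → ℝ}
    (hx : AbsolutelyContinuousOnInterval x a b) (i : Fin n) :
    AbsolutelyContinuousOnInterval (fun t => x t i) a b := by
  rw [absolutelyContinuousOnInterval_iff] at hx ⊢
  intro ε hε
  obtain ⟨δ, hδ, h⟩ := hx ε hε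
  exact ⟨δ, hδ, fun E hE hEδ => (Finset.sum_le_sum fun k _ => dist_le_pi_dist _ _ i).trans_lt
    (h E hE hEδ)⟩

theorem AbsolutelyContinuousOnInterval.sum {ι : Type*} (s : Finset ι) {f : ι → ℝ → ℝ}
    (hf : ∀ i ∈ s, AbsolutelyContinuousOnInterval (f i) a b) :
    AbsolutelyContinuousOnInterval (fun t => ∑ i ∈ s, f i t) a b := by
  classical
  induction s using Finset.induction_on with
  | empty =>
    simp only [Finset.sum_empty]
    exact (LipschitzWith.const (0 : ℝ)).lipschitzOnWith.absolutelyContinuousOnInterval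
  | insert i s hi ih =>
    simp only [Finset.sum_insert hi]
    exact (hf i (Finset.mem_insert_self i s)).fun_add
      (ih fun j hj => hf j (Finset.mem_insert_of_mem hj))

theorem AbsolutelyContinuousOnInterval.dotProduct {x y : ℝ → Fin n → ℝ}
    (hx : ∀ i, AbsolutelyContinuousOnInterval (fun t => x t i) a b)
    (hy : ∀ i, AbsolutelyContinuousOnInterval (fun t => y t i) a b) :
    AbsolutelyContinuousOnInterval (fun t => x t ⬝ᵥ y t) a b :=
  AbsolutelyContinuousOnInterval.sum Finset.univ fun i _ => (hx i).fun_mul (hy i)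

theorem HasDerivAt.dotProduct {x y : ℝ → Fin n → ℝ} {x' y' : Fin n → ℝ} {t : ℝ}
    (hx : HasDerivAt x x' t) (hy : HasDerivAt y y' t) :
    HasDerivAt (fun t => x t ⬝ᵥ y t) (x' ⬝ᵥ y t + x t ⬝ᵥ y') t := by
  rw [hasDerivAt_pi] at hx hy
  simp only [_root_.dotProduct, ← Finset.sum_add_distrib]
  exact HasDerivAt.fun_sum fun i _ => (hx i).mul (hy i)

theorem HasDerivAt.matrix_mulVec {m : ℕ} {M : ℝ → Matrix (Fin m) (Fin n) ℝ}
    {M' : Matrix (Fin m) (Fin n) ℝ} {x : ℝ → Fin n → ℝ} {x' : Fin n → ℝ} {t : ℝ}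
    (hM : HasDerivAt M M' t) (hx : HasDerivAt x x' t) :
    HasDerivAt (fun t => M t *ᵥ x t) (M' *ᵥ x t + M t *ᵥ x') t := by
  rw [hasDerivAt_pi] at hx ⊢
  intro i
  simp only [Matrix.mulVec, _root_.dotProduct, Pi.add_apply, ← Finset.sum_add_distrib]
  exact HasDerivAt.fun_sum fun j _ => (hasDerivAt_matrix.1 hM i j).mul (hx j)

theorem absolutelyContinuousOnInterval_of_hasDerivAt {f f' : ℝ → ℝ} (hab : a ≤ b)
    (hf : ∀ t ∈ Icc a b, HasDerivAt f (f' t) t) (hf' : ContinuousOn f' (Icc a b)) :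
    AbsolutelyContinuousOnInterval f a b := by
  obtain ⟨C, hC⟩ := isCompact_Icc.exists_bound_of_continuousOn hf'
  refine LipschitzOnWith.absolutelyContinuousOnInterval (K := C.toNNReal) ?_
  rw [uIcc_of_le hab]
  refine (convex_Icc a b).lipschitzOnWith_of_nnnorm_hasDerivWithin_le
    (fun t ht => (hf t ht).hasDerivWithinAt) fun t ht => ?_
  rw [← NNReal.coe_le_coe]
  exact (hC t ht).trans (Real.le_coe_toNNReal C)

end AbsolutelyContinuous

namespace LQSystem

variable {n m : ℕ} {S : LQSystem n m}

/-! ### The infinitesimal problem -/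

theorem data_zero_stepCost (t : ℝ) (x : Fin n → ℝ) (v : Fin m → ℝ) :
    (S.data t 0).stepCost x v = S.runningCost t x v := by
  rw [data_stepCost, NNReal.coe_zero, stepAverage_zero, sub_zero, arc_self]

theorem data_zero_velocity (t : ℝ) (x : Fin n → ℝ) (v : Fin m → ℝ) :
    (S.data t 0).velocity x v = S.A t *ᵥ x + S.B t *ᵥ v := by
  simp [RiccatiData.velocity, data, stepAverage_zero, γIntegrand, Φ_self]

/-- Solutions of the Riccati equation bound the cost from below. -/
theorem quad_le_toReal_cost {E : ℝ → Matrix (Fin n) (Fin n) ℝ} {T : ℝ} (hT : 0 < T)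
    (hE : ∀ t ≤ T, (E t).PosSemidef ∧ HasDerivAt E (S.F t (E t) 0) t) (hET : E T = 0)
    {x₀ : Fin n → ℝ} {x : ℝ → Fin n → ℝ} {u : ℝ → Fin m → ℝ} (hx : S.IsTrajectory x₀ x u)
    (hcost : S.cost x u < ⊤) : x₀ ⬝ᵥ E 0 *ᵥ x₀ ≤ (S.cost x u).toReal := by
  -- Verification argument: along the trajectory `-V'` is at most the running cost, since the
  -- Hamiltonian is at least `-⟨F(E) x, x⟩`. Absolute continuity of `V` permits integration of this
  -- almost everywhere inequality.
  set V : ℝ → ℝ := fun t => x t ⬝ᵥ E t *ᵥ x t with hV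
  have hxi := (hx.1 T hT).apply
  have hFc : ContinuousOn (fun t => S.F t (E t) 0) (Icc 0 T) := by
    simp only [F_zero_eq_ricc]
    exact S.ricc_continuousOn.comp (f := fun t : ℝ => ((t, (0 : NNReal)), E t))
      ((continuousOn_id.prodMk continuousOn_const).prodMk
        fun t ht => (hE t ht.2).2.continuousAt.continuousWithinAt) fun t ht => (hE t ht.2).1
  have hEij : ∀ i j, AbsolutelyContinuousOnInterval (fun t => E t i j) 0 T := fun i j =>
    absolutelyContinuousOnInterval_of_hasDerivAt hT.le
      (fun t ht => hasDerivAt_matrix.1 (hE t ht.2).2 i j)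
      (((continuous_id (X := Matrix (Fin n) (Fin n) ℝ)).matrix_elem i j).comp_continuousOn hFc)
  have hVac : AbsolutelyContinuousOnInterval V 0 T :=
    AbsolutelyContinuousOnInterval.dotProduct (y := fun t => E t *ᵥ x t) hxi fun i =>
      AbsolutelyContinuousOnInterval.sum Finset.univ (f := fun j t => E t i j * x t j)
        fun j _ => (hEij i j).fun_mul (hxi j)
  have hder : ∀ᵐ t ∂(volume.restrict (Ioc 0 T)),
      -deriv V t ≤ S.runningCost t (x t) (u t) := by
    have h1 := ae_restrict_of_ae_restrict_of_subset
      (Ioc_subset_Icc_self.trans Icc_subset_Ici_self : Ioc 0 T ⊆ Ici 0) hx.2.1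
    filter_upwards [h1, ae_restrict_mem measurableSet_Ioc] with t hxt htT
    have hEt := hE t htT.2
    have hd := (hxt.dotProduct (hEt.2.matrix_mulVec hxt)).deriv
    rw [hV, hd, ← data_zero_velocity, ← data_zero_stepCost, dotProduct_add,
      dotProduct_mulVec_comm_of_transpose_eq hEt.1.transpose_eq _ (x t)]
    have h2 := (S.data t 0).neg_ricc_le_hamiltonian hEt.1 (x t) (u t)
    rw [RiccatiData.hamiltonian, data_h, NNReal.coe_zero, zero_mul, add_zero,
      ← F_zero_eq_ricc] at h2
    linarith
  have hint := hVac.integral_deriv_eq_sub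
  have hV0 : V 0 = x₀ ⬝ᵥ E 0 *ᵥ x₀ := by simp [hV, hx.2.2]
  have hVT : V T = 0 := by simp [hV, hET]
  rw [hVT, hV0, zero_sub] at hint
  have hintegrable : Integrable (fun t => -deriv V t) (volume.restrict (Ioc 0 T)) :=
    (hVac.intervalIntegrable_deriv.1).neg
  calc x₀ ⬝ᵥ E 0 *ᵥ x₀ = ∫ t in Ioc 0 T, -deriv V t := by
        rw [integral_neg, ← intervalIntegral.integral_of_le hT.le, hint, neg_neg]
    _ ≤ (∫⁻ t in Ioc 0 T, ENNReal.ofReal (-deriv V t)).toReal := by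
        -- `-V'` need not be nonnegative; discarding its negative part only increases the integral.
        rw [integral_eq_lintegral_pos_part_sub_lintegral_neg_part hintegrable]
        exact sub_le_self _ ENNReal.toReal_nonneg
    _ ≤ (S.cost x u).toReal := by
        refine ENNReal.toReal_mono hcost.ne ?_
        calc _ ≤ ∫⁻ t in Ioc 0 T, ENNReal.ofReal (S.runningCost t (x t) (u t)) :=
              lintegral_mono_ae (hder.mono fun t ht => ENNReal.ofReal_le_ofReal ht)
          _ ≤ _ := lintegral_mono_set (Ioc_subset_Icc_self.trans Icc_subset_Ici_self)

/-! ### Monotonicity with respect to the final value -/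

theorem sddreSol_mono {P P' : Matrix (Fin n) (Fin n) ℝ} {T : ℝ} (hP : P.PosSemidef)
    (hP' : P'.PosSemidef) (hle : ∀ x, x ⬝ᵥ P *ᵥ x ≤ x ⬝ᵥ P' *ᵥ x) (Δ : TimePartition T) (j : ℕ)
    (x : Fin n → ℝ) : x ⬝ᵥ sddreSol S P Δ j *ᵥ x ≤ x ⬝ᵥ sddreSol S P' Δ j *ᵥ x := by
  induction j generalizing x with
  | zero => exact hle x
  | succ j ih =>
    exact RiccatiData.step_mono _ (sddreSol_posSemidef hP Δ j) (sddreSol_posSemidef hP' Δ j) ih x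

/-- The partition of `[0, T]` in `k + 1` equal intervals. -/
def equalPartition {T : ℝ} (hT : 0 < T) (k : ℕ) : TimePartition T where
  N := k + 1
  t i := i * (T / (k + 1))
  N_pos := Nat.succ_pos k
  t_zero := by simp
  t_last := by push_cast; field_simp
  t_lt i _ := by
    have : 0 < T / (k + 1) := by positivity
    push_cast
    linarith

theorem equalPartition_mesh {T : ℝ} (hT : 0 < T) (k : ℕ) :
    (equalPartition hT k).mesh ≤ T / (k + 1) := by
  refine Finset.sup'_le _ _ fun i _ => le_of_eq ?_
  simp only [TimePartition.step, equalPartition]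
  push_cast
  ring

theorem IsPDRE.tendsto_sddreSol {P : Matrix (Fin n) (Fin n) ℝ} {T : ℝ} (hP : P.PosSemidef)
    (hT : 0 < T) {E : ℝ → Matrix (Fin n) (Fin n) ℝ} (hE : S.IsPDRE P T E) :
    Tendsto (fun k : ℕ => sddreSol S P (equalPartition hT k) (k + 1)) atTop (𝓝 (E 0)) := by
  rw [Metric.tendsto_atTop]
  intro ε hε
  obtain ⟨δ, hδ, h⟩ := hE.exists_norm_sub_lt hT hε
  obtain ⟨k₀, hk₀⟩ := exists_nat_gt (T / δ)
  refine ⟨k₀, fun k hk => ?_⟩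
  have hmesh : (equalPartition hT k).mesh < δ := by
    refine (equalPartition_mesh hT k).trans_lt ?_
    have h1 : (k₀ : ℝ) ≤ k := Nat.cast_le.2 hk
    rw [div_lt_iff₀ hδ] at hk₀
    rw [div_lt_iff₀ (by positivity)]
    nlinarith
  have h2 := h _ hmesh _ (isSDDRE_sddreSol hP _) 0 (Nat.zero_le _)
  rw [TimePartition.t_zero, norm_sub_rev] at h2
  rw [dist_eq_norm]
  exact h2

/-- The order is preserved by each step of the difference scheme, and it passes to the limit by the
convergence on equal partitions. -/
theorem IsPDRE.quad_le {P P' : Matrix (Fin n) (Fin n) ℝ} {T : ℝ} (hP : P.PosSemidef)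
    (hP' : P'.PosSemidef) (hle : ∀ x, x ⬝ᵥ P *ᵥ x ≤ x ⬝ᵥ P' *ᵥ x) (hT : 0 < T)
    {E E' : ℝ → Matrix (Fin n) (Fin n) ℝ} (hE : S.IsPDRE P T E) (hE' : S.IsPDRE P' T E')
    (x : Fin n → ℝ) : x ⬝ᵥ E 0 *ᵥ x ≤ x ⬝ᵥ E' 0 *ᵥ x :=
  le_of_tendsto_of_tendsto' (((dotForm x x).continuous.tendsto _).comp (hE.tendsto_sddreSol hP hT))
    (((dotForm x x).continuous.tendsto _).comp (hE'.tendsto_sddreSol hP' hT))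
    fun _ => sddreSol_mono hP hP' hle _ _ x

/-! ### Autonomous systems -/

theorem IsAutonomous.Φ_add (hS : S.IsAutonomous) (t s c : ℝ) : S.Φ (t + c) (s + c) = S.Φ t s := by
  obtain ⟨A, B, Q, R, h⟩ := hS
  exact stateTransition_add_right S.continuous_A (fun t => (h (t + c)).1.trans (h t).1.symm) t s

theorem stepAverage_add {X : Type*} [NormedAddCommGroup X] [NormedSpace ℝ X] {f : ℝ → ℝ → X}
    {c : ℝ} (hf : ∀ s τ, f (s + c) (τ + c) = f s τ) (s h : ℝ) :
    stepAverage f (s + c) h = stepAverage f s h := by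
  simp only [stepAverage, add_right_comm s c, hf]

theorem IsAutonomous.data_eq (hS : S.IsAutonomous) (t : ℝ) (h : NNReal) :
    S.data t h = S.data 0 h := by
  have hΦ : ∀ s τ, S.Φ (τ + t) (s + t) = S.Φ τ s := fun s τ => hS.Φ_add τ s t
  obtain ⟨A, B, Q, R, hc⟩ := hS
  have hB : ∀ s τ, S.Φ (s + t) (τ + t) * S.B (τ + t) = S.Φ s τ * S.B τ := fun s τ => by
    rw [hΦ, (hc _).2.1, (hc τ).2.1]
  have hr : ∀ s τ, S.response (s + t) (τ + t) = S.response s τ := fun s τ => by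
    rw [response_eq_stepAverage, response_eq_stepAverage, hΦ, add_sub_add_right_eq_sub,
      stepAverage_add (f := fun s ξ => S.Φ s ξ * S.B ξ) hB]
  have e : t - (h : ℝ) = 0 - h + t := by ring
  have e0 : S.Φ t (t - h) = S.Φ 0 (0 - h) := by
    have := hΦ (0 - h) 0
    rwa [zero_add, ← e] at this
  refine RiccatiData.ext rfl ?_ ?_ ?_ ?_ ?_
  · refine (congrArg (fun s => stepAverage S.γIntegrand s h) e).trans
      (stepAverage_add (fun s τ => ?_) _ _)
    rw [γIntegrand, γIntegrand, hΦ, (hc _).1, (hc τ).1]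
  · refine congrArg₂ (· * ·) e0 ((congrArg (fun s => stepAverage
      (fun s ξ => S.Φ s ξ * S.B ξ) s h) e).trans (stepAverage_add hB _ _))
  · refine (congrArg (fun s => stepAverage S.gIntegrand s h) e).trans
      (stepAverage_add (fun s τ => ?_) _ _)
    rw [gIntegrand, gIntegrand, hΦ, (hc _).2.2.1, (hc τ).2.2.1]
  · refine (congrArg (fun s => stepAverage S.μIntegrand s h) e).trans
      (stepAverage_add (fun s τ => ?_) _ _)
    rw [μIntegrand, μIntegrand, hΦ, hr, (hc _).2.2.1, (hc τ).2.2.1]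
  · refine (congrArg (fun s => stepAverage S.νIntegrand s h) e).trans
      (stepAverage_add (fun s τ => ?_) _ _)
    rw [νIntegrand, νIntegrand, hr, (hc _).2.2.1, (hc τ).2.2.1, (hc _).2.2.2, (hc τ).2.2.2]

theorem IsAutonomous.F_eq (hS : S.IsAutonomous) (t : ℝ) (E : Matrix (Fin n) (Fin n) ℝ)
    (h : NNReal) : S.F t E h = (S.data 0 h).ricc E := by
  rw [F_eq_ricc, hS.data_eq]

theorem IsAutonomous.isARE_iff (hS : S.IsAutonomous) (h : NNReal)
    (E : Matrix (Fin n) (Fin n) ℝ) :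
    S.IsARE h E ↔ E.PosSemidef ∧ (S.data 0 h).ricc E = 0 := by
  simp [IsARE, hS.F_eq]

theorem IsAutonomous.isARE_zero_iff (hS : S.IsAutonomous) (E : Matrix (Fin n) (Fin n) ℝ) :
    S.IsARE 0 E ↔ E.PosSemidef ∧ (S.data 0 0).ricc E = 0 := by
  rw [← hS.isARE_iff, NNReal.coe_zero]

theorem IsAutonomous.isARE_unique (hS : S.IsAutonomous) (hQ : S.H₁) {h : NNReal}
    {E E' : Matrix (Fin n) (Fin n) ℝ} (hE : S.IsARE h E) (hE' : S.IsARE h E') : E = E' := by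
  rw [hS.isARE_iff] at hE hE'
  exact (S.data 0 h).eq_of_ricc_eq_zero (S.data_stepCost_pos hQ 0 h) hE.1 hE'.1 hE.2 hE'.2

section InfiniteHorizon

variable {Y : ℝ → Matrix (Fin n) (Fin n) ℝ}

/-- By time invariance, translates of one solution on `(-∞, 0]` supply the solutions for all
horizons. -/
theorem IsAutonomous.shift (hS : S.IsAutonomous)
    (hY : ∀ t ≤ 0, (Y t).PosSemidef ∧ HasDerivAt Y (S.F t (Y t) 0) t) {T c : ℝ} (hc : T ≤ c) :
    ∀ t ≤ T, (Y (t - c)).PosSemidef ∧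
      HasDerivAt (fun t => Y (t - c)) (S.F t (Y (t - c)) 0) t := fun t ht => by
  obtain ⟨h1, h2⟩ := hY (t - c) (by linarith)
  refine ⟨h1, ?_⟩
  have h3 := h2.comp_sub_const t c
  rwa [F_zero_eq_ricc, hS.data_eq, ← hS.data_eq t, ← F_zero_eq_ricc] at h3

/-- On the common horizon `-t`, the translates taking the values `Y t` and `Y s` at time `0` have
final values `0` and `Y (s - t) ≥ 0`; monotonicity in the final value compares them. -/
theorem IsAutonomous.quad_antitone (hS : S.IsAutonomous) (hY0 : Y 0 = 0)
    (hY : ∀ t ≤ 0, (Y t).PosSemidef ∧ HasDerivAt Y (S.F t (Y t) 0) t) {s t : ℝ} (hst : s ≤ t)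
    (ht : t ≤ 0) (x : Fin n → ℝ) : x ⬝ᵥ Y t *ᵥ x ≤ x ⬝ᵥ Y s *ᵥ x := by
  rcases ht.eq_or_lt with rfl | ht
  · simpa [hY0] using (hY s hst).1.quad_nonneg x
  · have h1 := S.isPDRE_of_hasDerivAt (hS.shift hY (T := -t) (c := -t) le_rfl)
    have h2 := S.isPDRE_of_hasDerivAt (hS.shift hY (T := -t) (c := -s) (by linarith))
    have hP : (Y (-t - -t)).PosSemidef := (hY _ (by linarith)).1
    have hP' : (Y (-t - -s)).PosSemidef := (hY _ (by linarith)).1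
    have := h1.quad_le hP hP' (fun x => by
      simpa [hY0] using hP'.quad_nonneg x) (by linarith) h2 x
    simpa using this

/-- A control of finite cost bounds `Y (-s)`, which increases with `s`. The limit is an equilibrium:
the increments over unit intervals tend to `0`, and the mean value theorem writes each one as a
value of the operator. -/
theorem IsAutonomous.exists_tendsto_riccati (hS : S.IsAutonomous) (h2 : S.H₂) (hY0 : Y 0 = 0)
    (hY : ∀ t ≤ 0, (Y t).PosSemidef ∧ HasDerivAt Y (S.F t (Y t) 0) t) :
    ∃ M, S.IsARE 0 M ∧ Tendsto (fun s => Y (-s)) atTop (𝓝 M) := by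
  -- Truncation at `0` makes the family semidefinite and monotone for every real index.
  have hle : ∀ s : ℝ, -max s 0 ≤ 0 := fun s => by simp
  obtain ⟨M, hM, hlim, -⟩ := exists_tendsto_of_monotone_quadForm
    (f := fun s : ℝ => Y (-max s 0)) (fun s => (hY _ (hle s)).1)
    (fun x s t hst => hS.quad_antitone hY0 hY (neg_le_neg (max_le_max_right 0 hst)) (hle s) x)
    (fun x => by
      obtain ⟨z, u, -, htraj, hcost⟩ := h2 x
      refine ⟨(S.cost z u).toReal, ?_⟩
      rintro _ ⟨s, rfl⟩
      -- The extra unit makes the horizon positive even when `max s 0 = 0`; monotonicity then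
      -- removes it.
      have h3 := hS.shift hY (T := max s 0 + 1) le_rfl
      have h4 := quad_le_toReal_cost (by positivity) h3 (by simp [hY0]) htraj hcost
      refine le_trans ?_ h4
      exact hS.quad_antitone hY0 hY (by linarith) (hle s) x)
  have hlim' : Tendsto (fun s => Y (-s)) atTop (𝓝 M) :=
    hlim.congr' ((eventually_ge_atTop 0).mono fun s hs => by simp [max_eq_left hs])
  refine ⟨M, (hS.isARE_zero_iff M).2 ⟨hM, ?_⟩, hlim'⟩
  refine eq_zero_of_quadForm_eq_zero (RiccatiData.ricc_transpose _ hM) fun x => ?_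
  have hslope : ∀ k : ℕ, ∃ ξ : ℝ, (k : ℝ) ≤ ξ ∧ x ⬝ᵥ (S.data 0 0).ricc (Y (-ξ)) *ᵥ x =
      x ⬝ᵥ Y (-(k : ℝ)) *ᵥ x - x ⬝ᵥ Y (-((k : ℝ) + 1)) *ᵥ x := fun k => by
    have hk : (0 : ℝ) ≤ k := k.cast_nonneg
    have hd : ∀ s ≤ 0, HasDerivAt (fun s => x ⬝ᵥ Y s *ᵥ x)
        (x ⬝ᵥ (S.data 0 0).ricc (Y s) *ᵥ x) s := fun s hs => by
      have := (hY s hs).2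
      rw [F_zero_eq_ricc, hS.data_eq] at this
      exact (dotForm x x).hasFDerivAt.comp_hasDerivAt s this
    obtain ⟨ξ, hξ, h⟩ := exists_hasDerivAt_eq_slope _ _
      (show -((k : ℝ) + 1) < -k by linarith)
      (fun s hs => (hd s (by linarith [hs.2])).continuousAt.continuousWithinAt)
      (fun s hs => hd s (by linarith [hs.2]))
    refine ⟨-ξ, by linarith [hξ.2], ?_⟩
    rw [neg_neg, h, show -(k : ℝ) - -((k : ℝ) + 1) = 1 by ring, div_one]
  choose ξ hξ hξ' using hslope
  have hξlim : Tendsto ξ atTop atTop := tendsto_atTop_mono hξ tendsto_natCast_atTop_atTop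
  have hquad : Tendsto (fun s => x ⬝ᵥ Y (-s) *ᵥ x) atTop (𝓝 (x ⬝ᵥ M *ᵥ x)) :=
    ((dotForm x x).continuous.tendsto M).comp hlim'
  have hR := (hquad.comp tendsto_natCast_atTop_atTop).sub
    (hquad.comp (tendsto_atTop_add_const_right atTop (1 : ℝ) tendsto_natCast_atTop_atTop))
  rw [sub_self] at hR
  have hF : Tendsto (fun k => (S.data 0 0).ricc (Y (-ξ k))) atTop
      (𝓝 ((S.data 0 0).ricc M)) :=
    (S.ricc_continuousOn_right 0 0 M hM).tendsto.comp
      (tendsto_nhdsWithin_iff.2 ⟨hlim'.comp hξlim, Eventually.of_forall fun k =>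
        (hY _ (by linarith [hξ k, (Nat.cast_nonneg k : (0 : ℝ) ≤ k)])).1⟩)
  have hL := ((dotForm x x).continuous.tendsto _).comp hF
  refine tendsto_nhds_unique hL (hR.congr fun k => ?_)
  simp [hξ' k]

/-- By uniqueness the solution with horizon `T` is `t ↦ Y (t - T)`, so letting `T` grow means
following `Y` to `-∞`. -/
theorem IsAutonomous.exists_isARE_zero (hS : S.IsAutonomous) (h2 : S.H₂) :
    ∃ M, S.IsARE 0 M ∧ ∀ ET : ℝ → ℝ → Matrix (Fin n) (Fin n) ℝ,
      (∀ T > 0, S.IsPDRE 0 T (ET T)) → ∀ t ≥ 0, Tendsto (fun T => ET T t) atTop (𝓝 M) := by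
  obtain ⟨Y, hY0, hY⟩ := S.exists_riccati_solution (P := 0) Matrix.PosSemidef.zero 0
  obtain ⟨M, hM, hlim⟩ := hS.exists_tendsto_riccati h2 hY0 hY
  refine ⟨M, hM, fun ET hET t ht => ?_⟩
  have h1 : Tendsto (fun T => Y (-(T - t))) atTop (𝓝 M) :=
    hlim.comp (tendsto_atTop_add_const_right atTop (-t) tendsto_id)
  refine h1.congr' ?_
  filter_upwards [eventually_ge_atTop t, eventually_gt_atTop 0] with T hTt hT0
  have h3 := S.isPDRE_of_hasDerivAt (hS.shift hY (T := T) le_rfl)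
  simp only [sub_self, hY0] at h3
  rw [neg_sub]
  exact (h3.eqOn (hET T hT0)) ⟨ht, hTt⟩

end InfiniteHorizon

end LQSystem

namespace LQSystem

variable {n m : ℕ} {S : LQSystem n m}

/-! ### Sampled controls -/

theorem arc_apply_absolutelyContinuous {a b : ℝ} (hab : a ≤ b) (s : ℝ) (x : Fin n → ℝ)
    (v : Fin m → ℝ) (i : Fin n) :
    AbsolutelyContinuousOnInterval (fun τ => S.arc s τ x v i) a b := by
  refine absolutelyContinuousOnInterval_of_hasDerivAt hab
    (fun t _ => hasDerivAt_pi.1 (S.arc_hasDerivAt s t x v) i) (Continuous.continuousOn ?_)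
  exact (continuous_apply i).comp ((S.continuous_A.matrix_mulVec (S.arc_continuous s x v)).add
    (S.continuous_B.matrix_mulVec continuous_const))

/-- Trajectories follow the arcs as long as the control is constant. -/
theorem IsTrajectory.eq_arc {x₀ : Fin n → ℝ} {x : ℝ → Fin n → ℝ} {u : ℝ → Fin m → ℝ}
    (hx : S.IsTrajectory x₀ x u) {a b : ℝ} (ha : 0 ≤ a) (hab : a < b) {v : Fin m → ℝ}
    (hu : ∀ t ∈ Ico a b, u t = v) {τ : ℝ} (hτ : τ ∈ Icc a b) :
    x τ = S.arc a τ (x a) v := by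
  set z : ℝ → Fin n → ℝ := fun t => x t - S.arc a t (x a) v with hz
  -- The difference from the arc solves the homogeneous equation almost everywhere. Transported back
  -- to time `a` it has zero derivative almost everywhere and is absolutely continuous, hence
  -- constant.
  set w : ℝ → Fin n → ℝ := fun t => S.Φ a t *ᵥ z t with hw
  have hder : ∀ᵐ t, t ∈ uIcc a b → HasDerivAt w 0 t := by
    have h1 := (ae_restrict_iff' measurableSet_Ici).1 hx.2.1
    -- The control is prescribed on `[a, b)` only, so the right endpoint is discarded as a null set.
    have h2 : ∀ᵐ t : ℝ, t ≠ b := by simp [ae_iff]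
    filter_upwards [h1, h2] with t ht htb htab
    rw [uIcc_of_le hab.le] at htab
    have h3 := ht (ha.trans htab.1)
    rw [hu t ⟨htab.1, lt_of_le_of_ne htab.2 htb⟩] at h3
    have h4 := (stateTransition_hasDerivAt_right S.continuous_A a t).matrix_mulVec
      (h3.sub (S.arc_hasDerivAt a t (x a) v))
    refine h4.congr_deriv ?_
    rw [add_sub_add_right_eq_sub, ← Matrix.mulVec_sub, Matrix.neg_mulVec, ← Matrix.mulVec_mulVec]
    exact neg_add_cancel _
  have hac : ∀ i, AbsolutelyContinuousOnInterval (fun t => w t i) a b := fun i => by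
    refine AbsolutelyContinuousOnInterval.sum Finset.univ (f := fun j t => S.Φ a t i j * z t j)
      fun j _ => AbsolutelyContinuousOnInterval.fun_mul ?_ ?_
    · refine absolutelyContinuousOnInterval_of_hasDerivAt hab.le (fun t _ => hasDerivAt_matrix.1
        (stateTransition_hasDerivAt_right S.continuous_A a t) i j) (Continuous.continuousOn ?_)
      refine ((Continuous.matrix_mul ?_ S.continuous_A).neg).matrix_elem i j
      exact S.Φ_continuous.comp (f := fun t : ℝ => (a, t)) (by fun_prop)
    · refine AbsolutelyContinuousOnInterval.fun_sub ?_
        (arc_apply_absolutelyContinuous hab.le _ _ _ j)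
      refine ((hx.1 b (ha.trans_lt hab)).apply j).mono ?_
      rw [uIcc_of_le hab.le, uIcc_of_le (ha.trans hab.le)]
      exact Icc_subset_Icc_left ha
  have hw0 : w τ = 0 := by
    funext i
    obtain ⟨C, hC⟩ := (hac i).const_of_ae_hasDerivAt_zero
      (hder.mono fun t ht htab => hasDerivAt_pi.1 (ht htab) i)
    rw [uIcc_of_le hab.le] at hC
    rw [hC τ hτ, ← hC a (left_mem_Icc.2 hab.le)]
    simp [hw, hz, arc_self]
  have hz0 : z τ = 0 := by
    calc z τ = (S.Φ τ a * S.Φ a τ) *ᵥ z τ := by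
          rw [Φ, Φ, stateTransition_mul_symm S.continuous_A, Matrix.one_mulVec]
      _ = 0 := by
          rw [← Matrix.mulVec_mulVec]
          change S.Φ τ a *ᵥ w τ = 0
          rw [hw0, Matrix.mulVec_zero]
  exact sub_eq_zero.1 hz0

theorem lintegral_runningCost_arc {x : ℝ → Fin n → ℝ} {u : ℝ → Fin m → ℝ} {a : ℝ} {h : NNReal}
    {y : Fin n → ℝ} {v : Fin m → ℝ} (hx : ∀ t ∈ Ico a (a + h), x t = S.arc a t y v)
    (hu : ∀ t ∈ Ico a (a + h), u t = v) :
    ∫⁻ τ in Ico a (a + h), ENNReal.ofReal (S.runningCost τ (x τ) (u τ)) =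
      ENNReal.ofReal (h * (S.data (a + h) h).stepCost y v) := by
  have hc := S.runningCost_arc_continuous a y v
  rw [data_smul_stepCost, add_sub_cancel_right,
    intervalIntegral.integral_of_le (by linarith [h.coe_nonneg]),
    ofReal_integral_eq_lintegral_ofReal (hc.integrableOn_Ioc)
      (Eventually.of_forall fun _ => S.runningCost_nonneg _ _ _),
    ← setLIntegral_congr (Ico_ae_eq_Ioc (μ := volume))]
  refine setLIntegral_congr_fun measurableSet_Ico fun t ht => ?_
  simp only [hx t ht, hu t ht]

/-- The iterated sampled-data Riccati operator bounds the cost of sampled controls from below. -/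
theorem IsAutonomous.ofReal_quad_iterate_le (hS : S.IsAutonomous) {h : NNReal} (hh : 0 < h)
    {x₀ : Fin n → ℝ} {x : ℝ → Fin n → ℝ} {u : ℝ → Fin m → ℝ} (hx : S.IsTrajectory x₀ x u)
    {v : ℕ → Fin m → ℝ} (hu : ∀ i : ℕ, ∀ t ∈ Ico (i * (h : ℝ)) ((i + 1) * h), u t = v i) (k : ℕ) :
    ∀ i : ℕ, ENNReal.ofReal (x (i * h) ⬝ᵥ (S.data 0 h).step^[k] 0 *ᵥ x (i * h)) ≤
      ∫⁻ τ in Ici (i * (h : ℝ)), ENNReal.ofReal (S.runningCost τ (x τ) (u τ)) := by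
  have hpos := (S.data 0 h).iterate_step_posSemidef
  have hh' : (0 : ℝ) < h := hh
  -- The starting index `i` stays arbitrary: the hypothesis for `k` is applied from the next
  -- sampling time.
  induction k with
  | zero => intro i; simp
  | succ k ih =>
    intro i
    have e : ((i : ℝ) + 1) * h = i * h + h := by ring
    have hi : (0 : ℝ) ≤ i * h := by positivity
    have hui := hu i
    rw [e] at hui
    have harc := fun τ (hτ : τ ∈ Icc (i * (h : ℝ)) (i * h + h)) =>
      hx.eq_arc hi (by linarith) hui hτ
    have hnext := ih (i + 1)
    push_cast at hnext
    rw [e] at hnext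
    have hstep := (S.data (i * h + h) h).quad_step_le (hpos k) (x (i * h)) (v i)
    rw [data_h, data_velocity, add_sub_cancel_right, ← harc _ (right_mem_Icc.2 (by linarith)),
      hS.data_eq] at hstep
    rw [Function.iterate_succ_apply']
    have hsplit : Ici (i * (h : ℝ)) = Ico (i * (h : ℝ)) (i * h + h) ∪ Ici (i * h + h) :=
      (Ico_union_Ici_eq_Ici (by linarith)).symm
    rw [hsplit, lintegral_union measurableSet_Ici
      (Set.disjoint_left.2 fun t ht ht' => absurd ht.2 (not_lt.2 ht')),
      lintegral_runningCost_arc (fun t ht => harc t (Ico_subset_Icc_self ht)) hui, hS.data_eq (i * h + h)]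
    calc _ ≤ _ := ENNReal.ofReal_le_ofReal hstep
      _ ≤ _ := ENNReal.ofReal_add_le
      _ ≤ _ := by gcongr

/-! ### Convergence of the iterated Riccati operator -/

/-- Starting from `0`, the first iterate is larger and monotonicity of the step propagates this. The
bounded monotone limit is a fixed point of `E - h ricc E`, and `h ≠ 0`. -/
theorem IsAutonomous.exists_tendsto_iterate_step (hS : S.IsAutonomous) {h : NNReal} (hh : 0 < h)
    (hbdd : ∀ x, ∃ C, ∀ k, x ⬝ᵥ (S.data 0 h).step^[k] 0 *ᵥ x ≤ C) :
    ∃ M, S.IsARE h M ∧ Tendsto (fun k => (S.data 0 h).step^[k] 0) atTop (𝓝 M) := by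
  set D := S.data 0 h with hD
  have hpos := D.iterate_step_posSemidef
  have hmono : ∀ k x, x ⬝ᵥ D.step^[k] 0 *ᵥ x ≤ x ⬝ᵥ D.step^[k + 1] 0 *ᵥ x := fun k => by
    induction k with
    | zero => intro x; simpa using (hpos 1).quad_nonneg x
    | succ k ih =>
      rw [Function.iterate_succ_apply' _ k, Function.iterate_succ_apply' _ (k + 1)]
      exact D.step_mono (hpos k) (hpos (k + 1)) ih
  obtain ⟨M, hM, hlim, -⟩ := exists_tendsto_of_monotone_quadForm hpos
    (fun x => monotone_nat_of_le_succ fun k => hmono k x)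
    (fun x => (hbdd x).imp fun C hC => by rintro _ ⟨k, rfl⟩; exact hC k)
  refine ⟨M, (hS.isARE_iff h M).2 ⟨hM, ?_⟩, hlim⟩
  have h1 : Tendsto (fun k => D.ricc (D.step^[k] 0)) atTop (𝓝 (D.ricc M)) :=
    (S.ricc_continuousOn_right 0 h M hM).tendsto.comp
      (tendsto_nhdsWithin_iff.2 ⟨hlim, Eventually.of_forall hpos⟩)
  have h2 : Tendsto (fun k => D.step^[k + 1] 0) atTop (𝓝 (M - D.h • D.ricc M)) := by
    simp only [Function.iterate_succ_apply']
    exact hlim.sub (h1.const_smul D.h)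
  have h3 := tendsto_nhds_unique h2 ((tendsto_add_atTop_iff_nat 1).2 hlim)
  have h4 : (h : ℝ) • D.ricc M = 0 := by simpa [hD] using h3
  exact (smul_eq_zero.1 h4).resolve_left (NNReal.coe_pos.2 hh).ne'

theorem IsAutonomous.sddreSol_uniformPartition (hS : S.IsAutonomous) {h : ℝ} (hh : 0 < h) (N : ℕ)
    (hN : 0 < N) (j : ℕ) : sddreSol S 0 (uniformPartition h hh N hN) j =
      (S.data 0 h.toNNReal).step^[j] 0 := by
  induction j with
  | zero => rfl
  | succ j ih =>
    have : ∀ i, (uniformPartition h hh N hN).step i = h := fun i => by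
      simp only [TimePartition.step, uniformPartition]
      push_cast
      ring
    rw [Function.iterate_succ_apply', sddreSol, ih, this, hS.data_eq]

theorem IsAutonomous.exists_isARE_sampled (hS : S.IsAutonomous) {h : ℝ} (hh : 0 < h)
    (h2 : S.H₂Sampled h) :
    ∃ M, S.IsARE h M ∧ ∀ EΔ : ℕ → ℕ → Matrix (Fin n) (Fin n) ℝ,
      (∀ (N : ℕ) (hN : 0 < N), S.IsSDDRE 0 (uniformPartition h hh N hN) (EΔ N)) →
      ∀ i : ℕ, Tendsto (fun N => EΔ N i) atTop (𝓝 M) := by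
  lift h to NNReal using hh.le
  obtain ⟨M, hM, hlim⟩ := hS.exists_tendsto_iterate_step (NNReal.coe_pos.1 hh) fun x₀ => by
    obtain ⟨x, u, ⟨v, hv⟩, htraj, hcost⟩ := h2 x₀
    refine ⟨(S.cost x u).toReal, fun k => ?_⟩
    have h3 := hS.ofReal_quad_iterate_le (NNReal.coe_pos.1 hh) htraj hv k 0
    simp only [Nat.cast_zero, zero_mul, htraj.2.2] at h3
    exact (ENNReal.ofReal_le_iff_le_toReal hcost.ne).1 h3
  refine ⟨M, hM, fun EΔ hEΔ i => ?_⟩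
  -- On a uniform partition `EΔ N i` is the iterate of order `N - i`, the number of steps left to
  -- the horizon.
  refine (hlim.comp (tendsto_sub_atTop_nat i)).congr' ?_
  filter_upwards [eventually_gt_atTop i] with N hN
  have h3 := (hEΔ N (by lia)).eq_sddreSol (N - i) (Nat.sub_le _ _)
  rw [hS.sddreSol_uniformPartition, Real.toNNReal_coe] at h3
  rw [show (uniformPartition (h : ℝ) hh N (by lia)).N = N from rfl, show N - (N - i) = i by lia]
    at h3
  exact h3.symm

end LQSystem

namespace LQSystem

variable {n m : ℕ} {S : LQSystem n m}

/-! ### Concatenation of arcs -/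

section Concatenation

variable {h : ℝ} {y : ℕ → Fin n → ℝ} {v : ℕ → Fin m → ℝ}

/-- The concatenation of the arcs on the intervals `[i h, (i + 1) h)` which start at `y i` and have
the constant control `v i`. -/
def concat (S : LQSystem n m) (h : ℝ) (y : ℕ → Fin n → ℝ) (v : ℕ → Fin m → ℝ) (t : ℝ) :
    Fin n → ℝ :=
  S.arc (⌊t / h⌋₊ * h) t (y ⌊t / h⌋₊) (v ⌊t / h⌋₊)

theorem floor_div_eq (hh : 0 < h) {i : ℕ} {t : ℝ} (ht : t ∈ Ico (i * h) ((i + 1) * h)) :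
    ⌊t / h⌋₊ = i := by
  have hi : (0 : ℝ) ≤ i * h := by positivity
  rw [Nat.floor_eq_iff (div_nonneg (hi.trans ht.1) hh.le), le_div_iff₀ hh, div_lt_iff₀ hh]
  exact ht

theorem mem_Ico_floor (hh : 0 < h) {t : ℝ} (ht : 0 ≤ t) :
    t ∈ Ico (⌊t / h⌋₊ * h) ((⌊t / h⌋₊ + 1) * h) := by
  have h1 := Nat.floor_le (div_nonneg ht hh.le)
  have h2 := Nat.lt_floor_add_one (t / h)
  rw [le_div_iff₀ hh] at h1
  rw [div_lt_iff₀ hh] at h2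
  exact ⟨h1, h2⟩

theorem concat_eq (hh : 0 < h) (hy : ∀ i : ℕ, y (i + 1) = S.arc (i * h) ((i + 1) * h) (y i) (v i))
    {i : ℕ} {t : ℝ} (ht : t ∈ Icc (i * h) ((i + 1) * h)) :
    S.concat h y v t = S.arc (i * h) t (y i) (v i) := by
  rcases ht.2.eq_or_lt with rfl | hlt
  · have : ⌊((i : ℝ) + 1) * h / h⌋₊ = i + 1 := by
      rw [mul_div_cancel_right₀ _ hh.ne']
      exact_mod_cast Nat.floor_natCast (R := ℝ) (i + 1)
    rw [concat, this, Nat.cast_add, Nat.cast_one, arc_self, hy]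
  · rw [concat, floor_div_eq hh ⟨ht.1, hlt⟩]

theorem concat_eventuallyEq_right (hh : 0 < h)
    (hy : ∀ i : ℕ, y (i + 1) = S.arc (i * h) ((i + 1) * h) (y i) (v i)) {t : ℝ} (ht : 0 ≤ t) :
    S.concat h y v =ᶠ[𝓝[≥] t] fun τ => S.arc (⌊t / h⌋₊ * h) τ (y ⌊t / h⌋₊) (v ⌊t / h⌋₊) := by
  have h1 := mem_Ico_floor hh ht
  filter_upwards [Icc_mem_nhdsGE_of_mem h1] with τ hτ
  exact concat_eq hh hy hτ

/-- Only a right derivative is available at every time, since the control may jump at sampling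
times; the floor selects the arc that leaves `t`. -/
theorem concat_hasDerivWithinAt (hh : 0 < h)
    (hy : ∀ i : ℕ, y (i + 1) = S.arc (i * h) ((i + 1) * h) (y i) (v i)) {t : ℝ} (ht : 0 ≤ t) :
    HasDerivWithinAt (S.concat h y v)
      (S.A t *ᵥ S.concat h y v t + S.B t *ᵥ v ⌊t / h⌋₊) (Ici t) t :=
  ((S.arc_hasDerivAt _ t _ _).hasDerivWithinAt).congr_of_eventuallyEq
    (concat_eventuallyEq_right hh hy ht) rfl

theorem concat_continuousAt (hh : 0 < h)
    (hy : ∀ i : ℕ, y (i + 1) = S.arc (i * h) ((i + 1) * h) (y i) (v i)) {t : ℝ} (ht : 0 < t) :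
    ContinuousAt (S.concat h y v) t := by
  refine continuousAt_iff_continuous_left_right.2
    ⟨?_, (concat_hasDerivWithinAt hh hy ht.le).continuousWithinAt⟩
  -- For left continuity the ceiling selects the interval closed on the right, whose arc arrives at
  -- `t`.
  obtain ⟨j, hj⟩ : ∃ j : ℕ, t ∈ Ioc (j * h) ((j + 1) * h) := by
    have h1 := Nat.ceil_pos.2 (div_pos ht hh)
    have h2 := Nat.le_ceil (t / h)
    have h3 := Nat.ceil_lt_add_one (div_pos ht hh).le
    obtain ⟨j, hj⟩ := Nat.exists_eq_succ_of_ne_zero h1.ne'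
    rw [hj, Nat.succ_eq_add_one] at h2 h3
    push_cast at h2 h3
    rw [div_le_iff₀ hh] at h2
    have h4 : (j : ℝ) < t / h := by linarith
    rw [lt_div_iff₀ hh] at h4
    exact ⟨j, h4, h2⟩
  refine (S.arc_continuous (j * h) (y j) (v j)).continuousWithinAt.congr_of_eventuallyEq ?_
    (concat_eq hh hy (Ioc_subset_Icc_self hj))
  filter_upwards [Icc_mem_nhdsLE_of_mem hj] with τ hτ
  exact concat_eq hh hy hτ

theorem concat_continuousOn (hh : 0 < h)
    (hy : ∀ i : ℕ, y (i + 1) = S.arc (i * h) ((i + 1) * h) (y i) (v i)) :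
    ContinuousOn (S.concat h y v) (Ici 0) := fun t (ht : 0 ≤ t) => by
  rcases ht.eq_or_lt with rfl | ht
  · exact (concat_hasDerivWithinAt hh hy le_rfl).continuousWithinAt
  · exact (concat_continuousAt hh hy ht).continuousWithinAt

/-- A continuous function with bounded right derivative is Lipschitz, so the corners at sampling
times do no harm. -/
theorem concat_absolutelyContinuous (hh : 0 < h)
    (hy : ∀ i : ℕ, y (i + 1) = S.arc (i * h) ((i + 1) * h) (y i) (v i)) {T : ℝ} (hT : 0 < T) :
    AbsolutelyContinuousOnInterval (S.concat h y v) 0 T := by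
  have hb : ∀ i : ℕ, ∃ C, ∀ t ∈ Icc 0 T,
      ‖S.A t *ᵥ S.concat h y v t + S.B t *ᵥ v i‖ ≤ C := fun i => by
    refine isCompact_Icc.exists_bound_of_continuousOn (ContinuousOn.add ?_ ?_)
    · exact (continuous_fst.matrix_mulVec continuous_snd).comp_continuousOn
        (S.continuous_A.continuousOn.prodMk ((concat_continuousOn hh hy).mono Icc_subset_Ici_self))
    · exact (S.continuous_B.matrix_mulVec continuous_const).continuousOn
  choose C hC using hb
  -- Finitely many controls act before `T`; summing the absolute values of their bounds dominates
  -- each of them.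
  set K : ℝ := ∑ i ∈ Finset.range (⌊T / h⌋₊ + 1), |C i| with hK
  have hK0 : 0 ≤ K := Finset.sum_nonneg fun _ _ => abs_nonneg _
  have hbound : ∀ t ∈ Icc 0 T,
      ‖S.A t *ᵥ S.concat h y v t + S.B t *ᵥ v ⌊t / h⌋₊‖ ≤ K := fun t ht => by
    refine (hC _ t ht).trans ((le_abs_self _).trans ?_)
    refine Finset.single_le_sum (f := fun i => |C i|) (fun _ _ => abs_nonneg _)
      (Finset.mem_range.2 (Nat.lt_succ_of_le (Nat.floor_mono ?_)))
    gcongr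
    exact ht.2
  refine LipschitzOnWith.absolutelyContinuousOnInterval (K := K.toNNReal) ?_
  rw [uIcc_of_le hT.le]
  have key : ∀ s ∈ Icc 0 T, ∀ t ∈ Icc 0 T, s ≤ t →
      ‖S.concat h y v t - S.concat h y v s‖ ≤ K * (t - s) := fun s hs t ht hst =>
    norm_image_sub_le_of_norm_deriv_right_le_segment
      ((concat_continuousOn hh hy).mono fun τ hτ => hs.1.trans hτ.1)
      (fun τ hτ => concat_hasDerivWithinAt hh hy (hs.1.trans hτ.1))
      (fun τ hτ => hbound τ ⟨hs.1.trans hτ.1, hτ.2.le.trans ht.2⟩) t (right_mem_Icc.2 hst)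
  refine LipschitzOnWith.of_dist_le_mul fun s hs t ht => ?_
  rw [Real.coe_toNNReal K hK0]
  rcases le_total s t with hst | hst
  · rw [dist_comm s t, dist_comm, dist_eq_norm, Real.dist_eq, abs_of_nonneg (sub_nonneg.2 hst)]
    exact key s hs t ht hst
  · rw [dist_eq_norm, Real.dist_eq, abs_of_nonneg (sub_nonneg.2 hst)]
    exact key t ht s hs hst

/-- The equation can fail only at the sampling times, which form a countable null set. -/
theorem concat_isTrajectory (hh : 0 < h)
    (hy : ∀ i : ℕ, y (i + 1) = S.arc (i * h) ((i + 1) * h) (y i) (v i)) :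
    S.IsTrajectory (y 0) (S.concat h y v) fun t => v ⌊t / h⌋₊ := by
  refine ⟨fun T hT => concat_absolutelyContinuous hh hy hT, ?_, by simp [concat, arc_self]⟩
  have hcount : (range fun i : ℕ => (i : ℝ) * h).Countable := countable_range _
  filter_upwards [ae_restrict_mem measurableSet_Ici,
    ae_restrict_of_ae (hcount.ae_notMem volume)] with t ht hnot
  have h1 := mem_Ico_floor hh ht
  have h2 : t ∈ Ioo (⌊t / h⌋₊ * h) ((⌊t / h⌋₊ + 1) * h) :=
    ⟨lt_of_le_of_ne h1.1 fun he => hnot ⟨_, he⟩, h1.2⟩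
  refine (S.arc_hasDerivAt _ t _ _).congr_of_eventuallyEq ?_
  filter_upwards [Icc_mem_nhds h2.1 h2.2] with τ hτ
  exact concat_eq hh hy hτ

theorem isSampled_floor (hh : 0 < h) (v : ℕ → Fin m → ℝ) :
    IsSampled h fun t => v ⌊t / h⌋₊ :=
  ⟨v, fun _ _ ht => congrArg v (floor_div_eq hh ht)⟩

end Concatenation

/-! ### Supersolutions and sampled feedback controls -/

/-- A supersolution of the sampled-data algebraic Riccati equation bounds the cost of a sampled
feedback control. -/
theorem IsAutonomous.exists_sampled_cost_le (hS : S.IsAutonomous) {h : NNReal} (hh : 0 < h)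
    {X : Matrix (Fin n) (Fin n) ℝ} (hX : X.PosSemidef)
    (hF : ∀ x, 0 ≤ x ⬝ᵥ (S.data 0 h).ricc X *ᵥ x) (x₀ : Fin n → ℝ) :
    ∃ (x : ℝ → Fin n → ℝ) (u : ℝ → Fin m → ℝ), IsSampled h u ∧ S.IsTrajectory x₀ x u ∧
      S.cost x u ≤ ENNReal.ofReal (x₀ ⬝ᵥ X *ᵥ x₀) := by
  have hh' : (0 : ℝ) < h := hh
  set D := S.data 0 h with hD
  -- States at the sampling times under the feedback `gain X`, held constant until the next sample.
  let y : ℕ → Fin n → ℝ := fun k => Nat.rec x₀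
    (fun i z => S.arc (i * h) ((i + 1) * h) z (D.gain X *ᵥ z)) k
  have hy : ∀ i : ℕ, y (i + 1) = S.arc (i * h) ((i + 1) * h) (y i) (D.gain X *ᵥ y i) :=
    fun _ => rfl
  set v : ℕ → Fin m → ℝ := fun i => D.gain X *ᵥ y i with hv
  refine ⟨S.concat h y v, fun t => v ⌊t / (h : ℝ)⌋₊, isSampled_floor hh' v,
    concat_isTrajectory (v := v) hh' hy, ?_⟩
  have hpiece : ∀ i : ℕ, ∫⁻ τ in Ico (i * (h : ℝ)) (i * h + h),
      ENNReal.ofReal (S.runningCost τ (S.concat h y v τ) (v ⌊τ / (h : ℝ)⌋₊)) =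
      ENNReal.ofReal (h * D.stepCost (y i) (v i)) := fun i => by
    have e : (i : ℝ) * h + h = (i + 1) * h := by ring
    rw [lintegral_runningCost_arc (y := y i) (v := v i)
      (u := fun τ => v ⌊τ / (h : ℝ)⌋₊), hS.data_eq (i * h + h)]
    · intro t ht
      rw [e] at ht
      exact concat_eq hh' hy (Ico_subset_Icc_self ht)
    · intro t ht
      rw [e] at ht
      simp only [floor_div_eq hh' ht]
  -- Bellman's identity with `ricc X ≥ 0`: the form of `X` decreases over each step by at least the
  -- cost incurred. These inequalities telescope.
  have hstep : ∀ i : ℕ, h * D.stepCost (y i) (v i) + y (i + 1) ⬝ᵥ X *ᵥ y (i + 1) ≤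
      y i ⬝ᵥ X *ᵥ y i := fun i => by
    have h1 := (S.data ((i + 1) * h) h).quad_step_eq hX (y i)
    rw [data_h, data_velocity, hS.data_eq ((i + 1) * h), ← hD,
      show ((i : ℝ) + 1) * h - h = i * h by ring, ← hy] at h1
    rw [← h1, RiccatiData.quad_step]
    have := mul_nonneg D.h_nonneg (hF (y i))
    linarith
  have hsum : ∀ k : ℕ, ∑ i ∈ Finset.range k, h * D.stepCost (y i) (v i) + y k ⬝ᵥ X *ᵥ y k ≤
      x₀ ⬝ᵥ X *ᵥ x₀ := fun k => by
    induction k with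
    | zero => simp [y]
    | succ k ih => rw [Finset.sum_range_succ]; linarith [hstep k]
  have hcover : Ici (0 : ℝ) ⊆ ⋃ i : ℕ, Ico (i * (h : ℝ)) (i * h + h) := fun t ht => by
    refine mem_iUnion.2 ⟨⌊t / (h : ℝ)⌋₊, ?_⟩
    have := mem_Ico_floor hh' ht
    rwa [add_mul, one_mul] at this
  calc S.cost (S.concat h y v) (fun t => v ⌊t / (h : ℝ)⌋₊)
      ≤ ∫⁻ τ in ⋃ i : ℕ, Ico (i * (h : ℝ)) (i * h + h),
        ENNReal.ofReal (S.runningCost τ (S.concat h y v τ) (v ⌊τ / (h : ℝ)⌋₊)) :=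
        lintegral_mono_set hcover
    _ ≤ ∑' i : ℕ, ∫⁻ τ in Ico (i * (h : ℝ)) (i * h + h),
        ENNReal.ofReal (S.runningCost τ (S.concat h y v τ) (v ⌊τ / (h : ℝ)⌋₊)) :=
        lintegral_iUnion_le _ _
    _ = ∑' i : ℕ, ENNReal.ofReal (h * D.stepCost (y i) (v i)) := by simp only [hpiece]
    _ ≤ _ := by
        refine ENNReal.tsum_le_of_sum_range_le fun k => ?_
        rw [← ENNReal.ofReal_sum_of_nonneg fun i _ =>
          (mul_nonneg hh'.le (D.cost_nonneg _ _) : 0 ≤ h * D.stepCost (y i) (v i))]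
        exact ENNReal.ofReal_le_ofReal (by linarith [hsum k, hX.quad_nonneg (y k)])

/-- A supersolution satisfies `step X ≤ X`, so monotonicity of the step keeps every iterate started
at `0` below `X`. -/
theorem IsAutonomous.exists_isARE_of_supersolution (hS : S.IsAutonomous) {h : NNReal} (hh : 0 < h)
    {X : Matrix (Fin n) (Fin n) ℝ} (hX : X.PosSemidef)
    (hF : ∀ x, 0 ≤ x ⬝ᵥ (S.data 0 h).ricc X *ᵥ x) : ∃ M, S.IsARE h M := by
  obtain ⟨M, hM, -⟩ := hS.exists_tendsto_iterate_step hh fun x => by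
    refine ⟨x ⬝ᵥ X *ᵥ x, fun k => ?_⟩
    induction k generalizing x with
    | zero => simpa using hX.quad_nonneg x
    | succ k ih =>
      rw [Function.iterate_succ_apply']
      refine (RiccatiData.step_mono _ (RiccatiData.iterate_step_posSemidef _ k) hX ih x).trans ?_
      rw [RiccatiData.quad_step]
      have := mul_nonneg (S.data 0 h).h_nonneg (hF x)
      linarith
  exact ⟨M, hM⟩

/-! ### Small sampling periods -/

theorem tendsto_ricc_zero {X : Matrix (Fin n) (Fin n) ℝ} (hX : X.PosSemidef) :
    Tendsto (fun h : NNReal => (S.data 0 h).ricc X) (𝓝 0) (𝓝 ((S.data 0 0).ricc X)) := by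
  have h1 : ContinuousOn (fun h : NNReal => (S.data 0 h).ricc X) univ :=
    S.ricc_continuousOn.comp (f := fun h : NNReal => (((0 : ℝ), h), X)) (by fun_prop) fun _ _ => hX
  exact (continuousOn_univ.1 h1).tendsto 0

/-- At `h = 0` the operator takes a positive definite value at `r • E`, and such values have a
neighbourhood of matrices with nonnegative form. -/
theorem IsAutonomous.eventually_ricc_smul_nonneg (hS : S.IsAutonomous) (hQ : S.H₁)
    {E : Matrix (Fin n) (Fin n) ℝ} (hE : S.IsARE 0 E) {r : ℝ} (hr : 1 < r) :
    ∀ᶠ h : NNReal in 𝓝 0, ∀ x, 0 ≤ x ⬝ᵥ (S.data 0 h).ricc (r • E) *ᵥ x := by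
  rw [hS.isARE_zero_iff] at hE
  have hrE : (r • E).PosSemidef := hE.1.smul (zero_le_one.trans hr.le)
  refine Matrix.PosDef.eventually_quad_nonneg (posDef_iff_quadForm.2
    ⟨RiccatiData.ricc_transpose _ hrE, fun x hx => ?_⟩) (tendsto_ricc_zero hrE)
  exact RiccatiData.ricc_smul_pos _ (S.data_stepCost_pos hQ 0 0) hE.1 hE.2 hr hx

theorem IsAutonomous.eventually_ricc_smul_nonpos (hS : S.IsAutonomous) (hQ : S.H₁)
    {E : Matrix (Fin n) (Fin n) ℝ} (hE : S.IsARE 0 E) {r : ℝ} (hr0 : 0 ≤ r) (hr : r < 1) :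
    ∀ᶠ h : NNReal in 𝓝 0, ∀ x, x ⬝ᵥ (S.data 0 h).ricc (r • E) *ᵥ x ≤ 0 := by
  rw [hS.isARE_zero_iff] at hE
  have hrE : (r • E).PosSemidef := hE.1.smul hr0
  have h1 := Matrix.PosDef.eventually_quad_nonneg (posDef_iff_quadForm.2
    ⟨by rw [Matrix.transpose_neg, RiccatiData.ricc_transpose _ hrE], fun x hx => by
      rw [Matrix.neg_mulVec, dotProduct_neg, neg_pos]
      exact RiccatiData.ricc_smul_neg _ (S.data_stepCost_pos hQ 0 0) hE.1 hE.2 hr0 hr hx⟩)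
    (tendsto_ricc_zero (S := S) hrE).neg
  refine h1.mono fun h hh x => ?_
  have := hh x
  rwa [Matrix.neg_mulVec, dotProduct_neg, Right.nonneg_neg_iff] at this

/-- For small `h` the multiples `(1 - η) E` and `(1 + η) E` are a sub- and a supersolution of the
sampled equation, and comparison squeezes its solution between them. -/
theorem IsAutonomous.tendsto_isARE (hS : S.IsAutonomous) (hQ : S.H₁)
    {E : Matrix (Fin n) (Fin n) ℝ} (hE : S.IsARE 0 E) {EΔ : ℝ → Matrix (Fin n) (Fin n) ℝ}
    (hEΔ : ∀ᶠ h in 𝓝[>] (0 : ℝ), S.IsARE h (EΔ h)) : Tendsto EΔ (𝓝[>] 0) (𝓝 E) := by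
  refine tendsto_of_tendsto_quadForm (hEΔ.mono fun h hh => hh.1.transpose_eq) hE.1.transpose_eq
    fun x => ?_
  rw [Metric.tendsto_nhds]
  intro ε hε
  set q := x ⬝ᵥ E *ᵥ x with hq
  have hq0 : 0 ≤ q := hE.1.quad_nonneg x
  -- The bound `1 / 2` keeps `1 - η` nonnegative; the other makes `η q < ε`, with `q + 1` avoiding
  -- division by zero.
  set η := min (1 / 2) (ε / (2 * (q + 1))) with hη
  have hη0 : 0 < η := by positivity
  have hη1 : η ≤ 1 / 2 := min_le_left _ _
  have hηq : η * q < ε := by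
    calc η * q ≤ ε / (2 * (q + 1)) * q := by
          gcongr
          exact min_le_right _ _
      _ < ε := by
          rw [div_mul_eq_mul_div, div_lt_iff₀ (by positivity)]
          nlinarith
  have hcoe : Tendsto Real.toNNReal (𝓝[>] (0 : ℝ)) (𝓝 0) := by
    have := continuous_real_toNNReal.tendsto (0 : ℝ)
    rw [Real.toNNReal_zero] at this
    exact this.mono_left nhdsWithin_le_nhds
  filter_upwards [hEΔ, self_mem_nhdsWithin,
    hcoe.eventually (hS.eventually_ricc_smul_nonneg hQ hE (r := 1 + η) (by linarith)),
    hcoe.eventually (hS.eventually_ricc_smul_nonpos hQ hE (r := 1 - η) (by linarith)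
      (by linarith))] with h hare hpos hsup hsub
  have hARE : S.IsARE h.toNNReal (EΔ h) := by rwa [Real.coe_toNNReal h (le_of_lt hpos)]
  rw [hS.isARE_iff] at hARE
  have hc := S.data_stepCost_pos hQ 0 h.toNNReal
  have h1 := RiccatiData.le_of_ricc_nonpos_of_ricc_nonneg _ hc hARE.1
    (hE.1.smul (by linarith : 0 ≤ 1 + η)) (by simp [hARE.2]) hsup x
  have h2 := RiccatiData.le_of_ricc_nonpos_of_ricc_nonneg _ hc
    (hE.1.smul (by linarith : 0 ≤ 1 - η)) hARE.1 hsub (by simp [hARE.2]) x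
  simp only [Matrix.smul_mulVec, dotProduct_smul, smul_eq_mul, ← hq] at h1 h2
  rw [Real.dist_eq, abs_lt]
  constructor <;> linarith

end LQSystem

end

/-- Existence and uniqueness of the Riccati matrices and the four convergences between them. -/
theorem theorem1 (n m : ℕ) (S : LQSystem n m) (P : Matrix (Fin n) (Fin n) ℝ)
    (hP : P.PosSemidef) :
    -- (i) left arrow
    (∀ T > 0,
      ∃ ET : ℝ → Matrix (Fin n) (Fin n) ℝ, S.IsPDRE P T ET ∧
        (∀ E, S.IsPDRE P T E → EqOn E ET (Icc 0 T)) ∧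
        (∀ Δ : TimePartition T, ∃ EΔ : ℕ → Matrix (Fin n) (Fin n) ℝ, S.IsSDDRE P Δ EΔ ∧
          ∀ E, S.IsSDDRE P Δ E → ∀ i ≤ Δ.N, E i = EΔ i) ∧
        ∀ ε > 0, ∃ δ > 0, ∀ Δ : TimePartition T, Δ.mesh < δ →
          ∀ EΔ, S.IsSDDRE P Δ EΔ → ∀ i ≤ Δ.N, ‖ET (Δ.t i) - EΔ i‖ < ε) ∧
    -- (ii) bottom arrow
    (P = 0 → S.IsAutonomous → S.H₁ → S.H₂ →
      ∃ Einf, S.IsARE 0 Einf ∧ (∀ E, S.IsARE 0 E → E = Einf) ∧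
        ∀ ET : ℝ → ℝ → Matrix (Fin n) (Fin n) ℝ, (∀ T > 0, S.IsPDRE P T (ET T)) →
          ∀ t ≥ 0, Tendsto (fun T => ET T t) atTop (𝓝 Einf)) ∧
    -- (iii) top arrow
    (P = 0 → S.IsAutonomous → S.H₁ → ∀ (h : ℝ) (hh : 0 < h), S.H₂Sampled h →
      ∃ EinfΔ, S.IsARE h EinfΔ ∧ (∀ E, S.IsARE h E → E = EinfΔ) ∧
        ∀ EΔ : ℕ → ℕ → Matrix (Fin n) (Fin n) ℝ,
          (∀ (N : ℕ) (hN : 0 < N), S.IsSDDRE P (uniformPartition h hh N hN) (EΔ N)) →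
          ∀ i : ℕ, Tendsto (fun N => EΔ N i) atTop (𝓝 EinfΔ)) ∧
    -- (iv) right arrow
    (S.IsAutonomous → S.H₁ → S.H₂ →
      ∃ Einf, S.IsARE 0 Einf ∧ (∀ E, S.IsARE 0 E → E = Einf) ∧
        ∃ hbar > 0,
          (∃ cbar ≥ 0, ∀ h, 0 < h → h ≤ hbar → ∀ x₀ : Fin n → ℝ,
            ∃ (x : ℝ → Fin n → ℝ) (u : ℝ → Fin m → ℝ), LQSystem.IsSampled h u ∧
              S.IsTrajectory x₀ x u ∧
              S.cost x u ≤ ENNReal.ofReal (cbar * ((Einf *ᵥ x₀) ⬝ᵥ x₀))) ∧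
          (∀ h, 0 < h → h ≤ hbar → ∃! E, S.IsARE h E) ∧
          ∀ EinfΔ : ℝ → Matrix (Fin n) (Fin n) ℝ,
            (∀ h, 0 < h → h ≤ hbar → S.IsARE h (EinfΔ h)) →
            Tendsto EinfΔ (𝓝[>] 0) (𝓝 Einf)) := by
  refine ⟨fun T hT => ?_, ?_, ?_, fun hS hQ h2 => ?_⟩
  · obtain ⟨E, hET, hE⟩ := S.exists_riccati_solution hP T
    have hPDRE := S.isPDRE_of_hasDerivAt hE
    rw [hET] at hPDRE
    exact ⟨E, hPDRE, fun E' hE' => hE'.eqOn hPDRE,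
      fun Δ => ⟨_, LQSystem.isSDDRE_sddreSol hP Δ, fun E' hE' =>
        hE'.eq (LQSystem.isSDDRE_sddreSol hP Δ)⟩,
      fun ε hε => hPDRE.exists_norm_sub_lt hT hε⟩
  · rintro rfl hS hQ h2
    obtain ⟨M, hM, hlim⟩ := hS.exists_isARE_zero h2
    exact ⟨M, hM, fun E hE => hS.isARE_unique hQ (h := 0) (by simpa using hE) (by simpa using hM),
      hlim⟩
  · rintro rfl hS hQ h hh h2
    obtain ⟨M, hM, hlim⟩ := hS.exists_isARE_sampled hh h2
    lift h to NNReal using hh.le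
    exact ⟨M, hM, fun E hE => hS.isARE_unique hQ hE hM, hlim⟩
  · obtain ⟨M, hM, -⟩ := hS.exists_isARE_zero h2
    refine ⟨M, hM, fun E hE => hS.isARE_unique hQ (h := 0) (by simpa using hE) (by simpa using hM),
      ?_⟩
    -- For `h < δ` the matrix `2 M` is a supersolution, which yields the cost constant `2`; the
    -- threshold `δ / 2` allows the non-strict bound on `h`.
    obtain ⟨δ, hδ, hsup⟩ := Metric.eventually_nhds_iff.1
      (hS.eventually_ricc_smul_nonneg hQ hM one_lt_two)
    have hsup' : ∀ h : NNReal, (h : ℝ) ≤ δ / 2 →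
        ∀ x, 0 ≤ x ⬝ᵥ (S.data 0 h).ricc ((2 : ℝ) • M) *ᵥ x := fun h hh => hsup (by
      rw [NNReal.dist_eq, NNReal.coe_zero, sub_zero, abs_of_nonneg h.coe_nonneg]
      linarith)
    have hM2 : ((2 : ℝ) • M).PosSemidef := hM.1.smul zero_le_two
    refine ⟨δ / 2, by positivity, ⟨2, zero_le_two, fun h hh hle x₀ => ?_⟩, fun h hh hle => ?_,
      fun EΔ hEΔ => ?_⟩
    · lift h to NNReal using hh.le
      obtain ⟨x, u, hu, htraj, hcost⟩ :=
        hS.exists_sampled_cost_le (NNReal.coe_pos.1 hh) hM2 (hsup' h hle) x₀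
      refine ⟨x, u, hu, htraj, hcost.trans_eq ?_⟩
      rw [Matrix.smul_mulVec, dotProduct_smul, smul_eq_mul, dotProduct_comm x₀]
    · lift h to NNReal using hh.le
      obtain ⟨E, hE⟩ := hS.exists_isARE_of_supersolution (NNReal.coe_pos.1 hh) hM2 (hsup' h hle)
      exact ⟨E, hE, fun E' hE' => hS.isARE_unique hQ hE' hE⟩
    · refine hS.tendsto_isARE hQ hM ?_
      filter_upwards [Ioc_mem_nhdsGT (half_pos hδ)] with h hh
      exact hEΔ h hh.1 hh.2
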